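/- Let $d\in\mathbb N$, let $S$ be a $d$-dimensional $C^2$ manifold, let $T\subset\mathbb R$ be open and connected, and let $a_t$, $b_t$, $U$, $\psi>0$ be, respectively, a positive definite metric, a $1$-form and two scalar fields on $S$, all depending on $t\in T$ and of class $C^1$ in $(t,q)\in T\times S$. Let $M=T\times S\times\mathbb R$, with points $(t,q,y)$, $\pi_S:M\to S$ the projection and $n=-\psi\,dt$, be endowed with the Eisenhart metric $$g=\pi_S^*a_t+n\otimes(dy-\pi_S^*b_t)+(dy-\pi_S^*b_t)\otimes n-(2U+1)\,n\otimes n .$$ Put $L(t,q,v)=\frac1{2\psi}a_t(v,v)+b_t(v)-(U+\frac12)\psi$. Let $t_0<t_1$ be in $T$, let $q:[t_0,t_1]\to S$ be a $C^1$ curve and $y_0\in\mathbb R$. The light lift of $(t,q(t))$ starting at $y_0$ is the curve $x(t)=(t,q(t),y(t))$ on $M$ with $y(t)=y_0+\int_{t_0}^{t}L(t',q,\dot q)\,dt'$. Then: 1. The light lift is a regular $C^1$ lightlike curve of $(M,g)$, and $$y(t_1)-y(t_0)=\int_{t_0}^{t_1}\Big[\frac1{2\psi}a_t(\dot q,\dot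 q)+b_t(\dot q)-\Big(U+\frac12\Big)\psi\Big]dt .$$ 2. The functional on the right-hand side is stationary on $q$ if and only if the light lift of $q$ is an (unparametrized) lightlike geodesic of $(M,g)$. Here stationary means that for every variation $q(t,r)$, $|r|<\epsilon$, of $q=q(\cdot,0)$ with fixed endpoints which is a $C^1$ family of $C^1$ curves ($q(t,r)$ is $C^1$ and, in charts, $\partial_r\partial_tq$ exists and is continuous) the derivative in $r$ of the functional exists and vanishes at $r=0$. Unparametrized lightlike geodesic means that some $C^1$ reparametrization $t=\tau(s)$, $\tau'>0$, of the curve is a ($C^2$, affinely parametrized) geodesic with lightlike tangent vectors. 3. The $0$-Euler-Lagrange equations are the Euler-Lagrange equations of this functional: $q$ satisfies the former on $[t_0,t_1]$ if and only if it satisfies the latter, $\frac{d}{dt}\frac{\partial L}{\partial v}=\frac{\partial L}{\partial q}$. Here the $0$-Euler-Lagrange equations are the components relative to the coordinates of $S$ of the Euler-Lagrange equations of $\int -g(\frac{dx}{ds},\frac{dx}{ds})\,ds$ on $M$, in which the parameter $s$ is eliminated through $2\psi\,\frac{dt}{ds}=\mu$, with $\mu>0$ a constant, and $y$ is eliminated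 through $g(\frac{dx}{ds},\frac{dx}{ds})=0$, i.e. $(t,q(t),y(t))$ is a light lift. -/

import Mathlib

open Set Topology MeasureTheory Bundle
open scoped Manifold ContDiff

noncomputable section

namespace Eisenhart

/-! ### Calculus in charts on a manifold without boundary -/

section General

variable {E : Type*} [NormedAddCommGroup E] [NormedSpace ℝ E]
  {H : Type*} [TopologicalSpace H] (I : ModelWithCorners ℝ E H)
  {N : Type*} [TopologicalSpace N] [ChartedSpace H N]

/-- The velocity `dγ/ds` at `s` of a curve `γ` defined on the set `J` of parameters
(one-sided at the endpoints when `J` is a compact interval). -/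
def velocity (J : Set ℝ) (γ : ℝ → N) (s : ℝ) : TangentSpace I (γ s) :=
  mfderivWithin 𝓘(ℝ, ℝ) I γ J s (1 : ℝ)

/-- The tangent vector at the point with coordinates `z` (in the chart around `x₀`) whose
components in that chart are `v`. -/
def chartVector (x₀ : N) (z v : E) : TangentSpace I ((extChartAt I x₀).symm z) :=
  mfderivWithin 𝓘(ℝ, E) I (extChartAt I x₀).symm (range I) z v

/-- The coordinate expression of a curve in the chart around `x₀`. -/
def chartCurve (x₀ : N) (γ : ℝ → N) (s : ℝ) : E := extChartAt I x₀ (γ s)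

/-- The coordinate expression of the tensor `g` in the chart around `x₀`:
`metricCoord g x₀ z u v = g_{ij}(z) uⁱ vʲ`. -/
def metricCoord (g : ∀ x : N, TangentSpace I x →L[ℝ] TangentSpace I x →L[ℝ] ℝ)
    (x₀ : N) (z u v : E) : ℝ :=
  g ((extChartAt I x₀).symm z) (chartVector I x₀ z u) (chartVector I x₀ z v)

/-- The Christoffel symbols of the first kind of `g` in the chart around `x₀`, contracted with
`u`, `v`, `w`: `½ (∂ᵢ g_{jk} + ∂ⱼ g_{ik} - ∂ₖ g_{ij}) uⁱ vʲ wᵏ`. -/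
def christoffelFirst (g : ∀ x : N, TangentSpace I x →L[ℝ] TangentSpace I x →L[ℝ] ℝ)
    (x₀ : N) (z u v w : E) : ℝ :=
  (1 / 2) * (fderiv ℝ (fun z' => metricCoord I g x₀ z' v w) z u
    + fderiv ℝ (fun z' => metricCoord I g x₀ z' u w) z v
    - fderiv ℝ (fun z' => metricCoord I g x₀ z' u v) z w)

/-- `γ` is an affinely parametrized geodesic of the (nondegenerate) metric `g` on `J`: it is `C²`
and `g_{kl} γ''ˡ + Γ_{ij,k} γ'ⁱ γ'ʲ = 0` at each parameter, in the chart around that point. -/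
def IsGeodesicOn (g : ∀ x : N, TangentSpace I x →L[ℝ] TangentSpace I x →L[ℝ] ℝ)
    (J : Set ℝ) (γ : ℝ → N) : Prop :=
  ContMDiffOn 𝓘(ℝ, ℝ) I 2 γ J ∧
  ∀ s ∈ J, ∀ w : E,
    let c : ℝ → E := chartCurve I (γ s) γ
    let c' : ℝ → E := derivWithin c J
    let c'' : ℝ → E := derivWithin c' J
    metricCoord I g (γ s) (c s) (c'' s) w
      + christoffelFirst I g (γ s) (c s) (c' s) (c' s) w = 0

/-- A `C¹` regular curve with lightlike tangent vectors. -/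
def IsLightlikeOn (g : ∀ x : N, TangentSpace I x →L[ℝ] TangentSpace I x →L[ℝ] ℝ)
    (J : Set ℝ) (γ : ℝ → N) : Prop :=
  ContMDiffOn 𝓘(ℝ, ℝ) I 1 γ J ∧
  ∀ s ∈ J, velocity I J γ s ≠ 0 ∧ g (γ s) (velocity I J γ s) (velocity I J γ s) = 0

/-- The curve `x` on `[t₀, t₁]` is an unparametrized lightlike geodesic: some orientation
preserving `C¹` reparametrization of it, with nonvanishing derivative, is an affinely parametrized
geodesic with lightlike tangent vectors. -/
def IsUnparametrizedLightlikeGeodesic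
    (g : ∀ x : N, TangentSpace I x →L[ℝ] TangentSpace I x →L[ℝ] ℝ)
    (t₀ t₁ : ℝ) (x : ℝ → N) : Prop :=
  ∃ (s₀ s₁ : ℝ) (τ : ℝ → ℝ), s₀ < s₁ ∧ τ s₀ = t₀ ∧ τ s₁ = t₁ ∧
    ContDiffOn ℝ 1 τ (Icc s₀ s₁) ∧ (∀ s ∈ Icc s₀ s₁, 0 < derivWithin τ (Icc s₀ s₁) s) ∧
    IsGeodesicOn I g (Icc s₀ s₁) (x ∘ τ) ∧ IsLightlikeOn I g (Icc s₀ s₁) (x ∘ τ)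

/-- The coordinate expression in the chart around `x₀` of a time dependent Lagrangian `L`. -/
def lagrangianCoord (L : ℝ → ∀ x : N, TangentSpace I x → ℝ) (x₀ : N) (s : ℝ) (z v : E) : ℝ :=
  L s ((extChartAt I x₀).symm z) (chartVector I x₀ z v)

/-- The curve `γ` satisfies, on `J`, the components along the coordinate directions `w ∈ W` of the
Euler-Lagrange equations of `L`: `d/ds (∂L/∂vⁱ) wⁱ = (∂L/∂xⁱ) wⁱ`, at each parameter, in the
chart around that point. -/
def SatisfiesEulerLagrange (L : ℝ → ∀ x : N, TangentSpace I x → ℝ) (W : Set E)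
    (J : Set ℝ) (γ : ℝ → N) : Prop :=
  ∀ s ∈ J, ∀ w ∈ W,
    let c : ℝ → E := chartCurve I (γ s) γ
    let c' : ℝ → E := derivWithin c J
    HasDerivWithinAt
      (fun σ => fderiv ℝ (fun v => lagrangianCoord I L (γ s) σ (c σ) v) (c' σ) w)
      (fderiv ℝ (fun z => lagrangianCoord I L (γ s) s z (c' s)) (c s) w) J s

/-- `Q` is a variation with fixed endpoints, with parameter `r ∈ (-ε, ε)`, of the curve `q` on
`[t₀, t₁]`, and is `C¹` as a family of `C¹` curves: `Q` is `C¹` in `(r, t)`, and in charts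
`∂Q/∂t` is differentiable in `r` and `∂²Q/∂r∂t` is continuous in `(r, t)`. -/
structure IsVariation (t₀ t₁ : ℝ) (q : ℝ → N) (ε : ℝ) (Q : ℝ → ℝ → N) : Prop where
  pos : 0 < ε
  base : ∀ t ∈ Icc t₀ t₁, Q 0 t = q t
  left : ∀ r ∈ Ioo (-ε) ε, Q r t₀ = q t₀
  right : ∀ r ∈ Ioo (-ε) ε, Q r t₁ = q t₁
  contMDiffOn : ContMDiffOn 𝓘(ℝ, ℝ × ℝ) I 1 (fun p : ℝ × ℝ => Q p.1 p.2)
    (Ioo (-ε) ε ×ˢ Icc t₀ t₁)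
  mixed : ∀ p₀ ∈ Ioo (-ε) ε ×ˢ Icc t₀ t₁, ∃ V ∈ 𝓝[Ioo (-ε) ε ×ˢ Icc t₀ t₁] p₀,
    let c' : ℝ → ℝ → E :=
      fun r => derivWithin (chartCurve I (Q p₀.1 p₀.2) (Q r)) (Icc t₀ t₁)
    (∀ p ∈ V, DifferentiableAt ℝ (fun r => c' r p.2) p.1) ∧
      ContinuousOn (fun p : ℝ × ℝ => deriv (fun r => c' r p.2) p.1) V

/-- The action `∫ L(t, q, dq/dt) dt` over `[t₀, t₁]`. -/
def action (L : ℝ → ∀ x : N, TangentSpace I x → ℝ) (t₀ t₁ : ℝ) (q : ℝ → N) : ℝ :=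
  ∫ t in t₀..t₁, L t (q t) (velocity I (Icc t₀ t₁) q t)

/-- `q` is a stationary point of the action of `L`, for variations with fixed endpoints. -/
def IsStationary (L : ℝ → ∀ x : N, TangentSpace I x → ℝ) (t₀ t₁ : ℝ) (q : ℝ → N) : Prop :=
  ∀ (ε : ℝ) (Q : ℝ → ℝ → N), IsVariation I t₀ t₁ q ε Q →
    HasDerivAt (fun r => action I L t₀ t₁ (Q r)) 0 0

end General

/-! ### Eisenhart spacetimes -/

/-- The coordinate space of the configuration space `S`. -/
abbrev ModelS (d : ℕ) := EuclideanSpace ℝ (Fin d)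

/-- The data defining an Eisenhart spacetime over the `d`-dimensional manifold `S`, with
`t` ranging over `T`: a time dependent Riemannian metric `a`, one-form `b` and scalars `U` and
`ψ > 0`, all of class `C¹` in `(t, q) ∈ T × S`. (Values at times outside `T` play no role.) -/
structure Data (d : ℕ) (T : Set ℝ) (S : Type*) [TopologicalSpace S]
    [ChartedSpace (ModelS d) S] [IsManifold (𝓡 d) 2 S] where
  a : ℝ → ∀ q : S, TangentSpace (𝓡 d) q →L[ℝ] TangentSpace (𝓡 d) q →L[ℝ] ℝ
  b : ℝ → ∀ q : S, TangentSpace (𝓡 d) q →L[ℝ] ℝ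
  U : ℝ → S → ℝ
  ψ : ℝ → S → ℝ
  a_symm : ∀ t ∈ T, ∀ (q : S) (v w : TangentSpace (𝓡 d) q), a t q v w = a t q w v
  a_pos : ∀ t ∈ T, ∀ (q : S) (v : TangentSpace (𝓡 d) q), v ≠ 0 → 0 < a t q v v
  ψ_pos : ∀ t ∈ T, ∀ q : S, 0 < ψ t q
  a_contMDiffOn : ContMDiffOn (𝓘(ℝ, ℝ).prod (𝓡 d))
    ((𝓡 d).prod 𝓘(ℝ, ModelS d →L[ℝ] ModelS d →L[ℝ] ℝ)) 1
    (fun p : ℝ × S => TotalSpace.mk' (ModelS d →L[ℝ] ModelS d →L[ℝ] ℝ)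
      (E := fun q : S => TangentSpace (𝓡 d) q →L[ℝ] TangentSpace (𝓡 d) q →L[ℝ] ℝ)
      p.2 (a p.1 p.2)) (T ×ˢ univ)
  b_contMDiffOn : ContMDiffOn (𝓘(ℝ, ℝ).prod (𝓡 d))
    ((𝓡 d).prod 𝓘(ℝ, ModelS d →L[ℝ] ℝ)) 1
    (fun p : ℝ × S => TotalSpace.mk' (ModelS d →L[ℝ] ℝ)
      (E := fun q : S => TangentSpace (𝓡 d) q →L[ℝ] ℝ) p.2 (b p.1 p.2)) (T ×ˢ univ)
  U_contMDiffOn : ContMDiffOn (𝓘(ℝ, ℝ).prod (𝓡 d)) 𝓘(ℝ, ℝ) 1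
    (fun p : ℝ × S => U p.1 p.2) (T ×ˢ univ)
  ψ_contMDiffOn : ContMDiffOn (𝓘(ℝ, ℝ).prod (𝓡 d)) 𝓘(ℝ, ℝ) 1
    (fun p : ℝ × S => ψ p.1 p.2) (T ×ˢ univ)

/-- The model of `ℝ × S × ℝ`, in which the spacetime `M = T × S × ℝ`, with points
`(t, q, y)`, is an open subset. -/
abbrev modelM (d : ℕ) := 𝓘(ℝ, ℝ).prod ((𝓡 d).prod 𝓘(ℝ, ℝ))

variable {d : ℕ} {T : Set ℝ} {S : Type*} [TopologicalSpace S]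
  [ChartedSpace (ModelS d) S] [IsManifold (𝓡 d) 2 S]

/-- The one-form `dt` on the spacetime. -/
def dt (x : ℝ × S × ℝ) : TangentSpace (modelM d) x →L[ℝ] ℝ :=
  mfderiv (modelM d) 𝓘(ℝ, ℝ) (fun m : ℝ × S × ℝ => m.1) x

/-- The one-form `dy` on the spacetime. -/
def dy (x : ℝ × S × ℝ) : TangentSpace (modelM d) x →L[ℝ] ℝ :=
  mfderiv (modelM d) 𝓘(ℝ, ℝ) (fun m : ℝ × S × ℝ => m.2.2) x

/-- The differential of the projection `π_S : M → S`. -/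
def dπ (x : ℝ × S × ℝ) : TangentSpace (modelM d) x →L[ℝ] TangentSpace (𝓡 d) x.2.1 :=
  mfderiv (modelM d) (𝓡 d) (fun m : ℝ × S × ℝ => m.2.1) x

namespace Data

variable (D : Data d T S)

/-- The one-form `n = -ψ dt`. -/
def n (x : ℝ × S × ℝ) : TangentSpace (modelM d) x →L[ℝ] ℝ := -(D.ψ x.1 x.2.1) • dt x

/-- The one-form `θ = dy - π_S^* b`. -/
def θ (x : ℝ × S × ℝ) : TangentSpace (modelM d) x →L[ℝ] ℝ :=
  dy x - (D.b x.1 x.2.1).comp (dπ x)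

/-- The Eisenhart metric `π_S^* a + n ⊗ θ + θ ⊗ n - (2U + 1) n ⊗ n`. -/
def metric (x : ℝ × S × ℝ) :
    TangentSpace (modelM d) x →L[ℝ] TangentSpace (modelM d) x →L[ℝ] ℝ :=
  (ContinuousLinearMap.precomp ℝ (dπ x)).comp ((D.a x.1 x.2.1).comp (dπ x))
    + (D.n x).smulRight (D.θ x) + (D.θ x).smulRight (D.n x)
    - (2 * D.U x.1 x.2.1 + 1) • (D.n x).smulRight (D.n x)

/-- The classical Lagrangian `a(v, v) / (2ψ) + b(v) - (U + 1/2) ψ`. -/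
def lagrangian (t : ℝ) (q : S) (v : TangentSpace (𝓡 d) q) : ℝ :=
  1 / (2 * D.ψ t q) * D.a t q v v + D.b t q v - (D.U t q + 1 / 2) * D.ψ t q

/-- The last coordinate of the light lift, starting at `y₀`, of the curve `(t, q t)`,
`t ∈ [t₀, t₁]`. -/
def liftY (t₀ t₁ : ℝ) (q : ℝ → S) (y₀ t : ℝ) : ℝ :=
  y₀ + ∫ s in t₀..t, D.lagrangian s (q s) (velocity (𝓡 d) (Icc t₀ t₁) q s)

/-- The light lift `(t, q t, y t)` starting on `y = y₀` of the curve `(t, q t)`,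
`t ∈ [t₀, t₁]`. -/
def lightLift (t₀ t₁ : ℝ) (q : ℝ → S) (y₀ : ℝ) (t : ℝ) : ℝ × S × ℝ :=
  (t, q t, D.liftY t₀ t₁ q y₀ t)

/-- The Lagrangian `-g(x', x')` on the spacetime, whose extremals are the affinely parametrized
geodesics. -/
def geodesicLagrangian (_ : ℝ) (x : ℝ × S × ℝ) (V : TangentSpace (modelM d) x) : ℝ :=
  -D.metric x V V

/-- The curve `q` on `[t₀, t₁]` satisfies the `0`-Euler-Lagrange equations: the
Euler-Lagrange equations of `-g(x', x')` relative to the coordinates of `S`, in which the affine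
parameter `s` is eliminated through conservation of the momentum conjugate to `y`,
`2 ψ dt/ds = μ > 0`, and `y` through conservation of `g(x', x') = 0` (that is, `y` is
the last coordinate of a light lift). -/
def SatisfiesZeroEulerLagrange (t₀ t₁ : ℝ) (q : ℝ → S) : Prop :=
  ∃ (s₀ s₁ μ y₀ : ℝ) (τ : ℝ → ℝ), s₀ < s₁ ∧ 0 < μ ∧ τ s₀ = t₀ ∧ τ s₁ = t₁ ∧
    (∀ s ∈ Icc s₀ s₁,
      HasDerivWithinAt τ (μ / (2 * D.ψ (τ s) (q (τ s)))) (Icc s₀ s₁) s) ∧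
    SatisfiesEulerLagrange (modelM d) D.geodesicLagrangian
      {w : ℝ × ModelS d × ℝ | w.1 = 0 ∧ w.2.2 = 0}
      (Icc s₀ s₁) (D.lightLift t₀ t₁ q y₀ ∘ τ)

end Data

end Eisenhart

end

/-! On a tangent vector of components (r, r v, ℓ) the Eisenhart metric takes the value 2ψr(rL − ℓ),
with L evaluated at (t, q, v). A curve projecting to (t, q(t)) is therefore lightlike exactly when
dy/dt = L; this is the light lift, and its increment in y is the action by construction.

The same identity carries the dynamics. The metric pairing of the velocity with (0, w, 0) is ψr
∂L/∂v(w) (`metricCoord_spatial`). Differentiating g(x', x') in position along w gives 2ψr² ∂L/∂q(w),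
because the derivative of the prefactor is multiplied by rL − ℓ = 0 (`fderiv_metricCoord_spatial`).
If r = dt/ds is such that ψr is constant, this constant factors out of the spatial equations, and
d/ds ∂L/∂v = (dt/ds) ∂L/∂q remains, which is the Euler-Lagrange equation of L after a change of
parameter (`spatial_eulerLagrange_iff`). This settles the 0-Euler-Lagrange equations
(`satisfiesZeroEulerLagrange_iff`).

For geodesics, the coefficients of g do not involve y, so the momentum −ψ dt/ds conjugate to y is
conserved, and affine parameters are of the above kind. Conversely, with such a parameter the y and
spatial components of the acceleration vanish. The remaining one vanishes because the acceleration
of a lightlike curve is orthogonal to its velocity, whose t-component is not zero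
(`acceleration_eq_zero`).

Stationarity is equivalent to the Euler-Lagrange equations (`isStationary_iff`), although q is only
C¹ and need not lie in one chart. In one direction, variations supported in a chart and the du
Bois-Reymond lemma give the equations (`hasDerivWithinAt_of_forall_integral_eq_zero`). In the other,
the integrand of the first variation is the derivative of the momentum paired with the variation
field, a quantity independent of charts that vanishes at the endpoints (`pairing_eq`). Finally, a
geodesic has to be C²: the momentum of a stationary curve is C¹, and since a is positive definite
the velocity can be recovered from it (`contMDiffOn_two_of_isStationary`). -/

noncomputable section

namespace Eisenhart

/-! ### Velocities and coordinate vectors in charts. -/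

section

section Charts

variable {E : Type*} [NormedAddCommGroup E] [NormedSpace ℝ E]
  {H : Type*} [TopologicalSpace H] {I : ModelWithCorners ℝ E H}
  {N : Type*} [TopologicalSpace N] [ChartedSpace H N] [IsManifold I 2 N] [I.Boundaryless]

theorem mdifferentiableAt_extChartAt_symm {x₀ : N} {z : E} (hz : z ∈ (extChartAt I x₀).target) :
    MDifferentiableAt 𝓘(ℝ, E) I (extChartAt I x₀).symm z := by
  have := mdifferentiableWithinAt_extChartAt_symm (I := I) hz
  rwa [I.range_eq_univ, mdifferentiableWithinAt_univ] at this

omit [IsManifold I 2 N] in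
theorem chartVector_eq_mfderiv (x₀ : N) (z v : E) :
    chartVector I x₀ z v = mfderiv 𝓘(ℝ, E) I (extChartAt I x₀).symm z v := by
  rw [chartVector, I.range_eq_univ, mfderivWithin_univ]

omit [I.Boundaryless] in
theorem chartVector_ne_zero {x₀ : N} {z v : E} (hz : z ∈ (extChartAt I x₀).target)
    (hv : v ≠ 0) : chartVector I x₀ z v ≠ 0 := by
  obtain ⟨e, he⟩ := isInvertible_mfderivWithin_extChartAt_symm (I := I) hz
  intro h0
  rw [chartVector, ← he] at h0
  exact hv (e.injective (h0.trans e.map_zero.symm))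

/-- The field is the tangent map of the inverse chart applied to a constant section. The tangent map
costs one derivative, so a C² manifold gives C¹ fields, as much as the C¹ coefficients of the metric
require. -/
theorem contMDiffOn_chartVector (x₀ : N) (u : E) :
    ContMDiffOn 𝓘(ℝ, E) I.tangent 1
      (fun z => TotalSpace.mk' E (E := (TangentSpace I : N → Type _))
        ((extChartAt I x₀).symm z) (chartVector I x₀ z u))
      (extChartAt I x₀).target := by
  have ho : IsOpen (extChartAt I x₀).target := isOpen_extChartAt_target x₀
  have h1 := (contMDiffOn_extChartAt_symm (I := I) (n := 2) x₀).contMDiffOn_tangentMapWithin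
    (m := 1) (by norm_num) ho.uniqueMDiffOn
  have h2 : ContMDiffOn 𝓘(ℝ, E) 𝓘(ℝ, E).tangent 1
      (fun z : E => (TotalSpace.mk' E z u : TangentBundle 𝓘(ℝ, E) E))
      (extChartAt I x₀).target := by
    intro z hz
    rw [contMDiffWithinAt_totalSpace]
    refine ⟨contMDiffWithinAt_id, ?_⟩
    simpa using contMDiffWithinAt_const
  refine (h1.comp h2 (fun z hz => hz)).congr fun z hz => ?_
  simp only [Function.comp, tangentMapWithin, chartVector_eq_mfderiv]
  rw [mfderivWithin_of_isOpen ho hz]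

variable {J : Set ℝ} {γ : ℝ → N} {s : ℝ} {x₀ : N} {c' : E}

/-- The velocity of a curve, from the derivative of its coordinate expression. -/
theorem velocity_eq_chartVector (hJ : UniqueDiffWithinAt ℝ J s)
    (hγ : ContinuousWithinAt γ J s) (hs : γ s ∈ (extChartAt I x₀).source)
    (hc : HasDerivWithinAt (chartCurve I x₀ γ) c' J s) :
    (velocity I J γ s : E) = chartVector I x₀ (chartCurve I x₀ γ s) c' := by
  have hz : chartCurve I x₀ γ s ∈ (extChartAt I x₀).target := (extChartAt I x₀).map_source hs
  have hev : ∀ᶠ σ in 𝓝[J] s, ((extChartAt I x₀).symm ∘ chartCurve I x₀ γ) σ = γ σ := by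
    filter_upwards [hγ ((isOpen_extChartAt_source x₀).mem_nhds hs)] with σ hσ
    exact (extChartAt I x₀).left_inv hσ
  have h1 : HasMFDerivWithinAt 𝓘(ℝ, ℝ) I ((extChartAt I x₀).symm ∘ chartCurve I x₀ γ) J s
      ((mfderiv 𝓘(ℝ, E) I (extChartAt I x₀).symm (chartCurve I x₀ γ s)).comp
        (ContinuousLinearMap.toSpanSingleton ℝ c')) :=
    (mdifferentiableAt_extChartAt_symm hz).hasMFDerivAt.comp_hasMFDerivWithinAt s
      hc.hasFDerivWithinAt.hasMFDerivWithinAt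
  have h2 : HasMFDerivWithinAt 𝓘(ℝ, ℝ) I γ J s
      ((mfderiv 𝓘(ℝ, E) I (extChartAt I x₀).symm (chartCurve I x₀ γ s)).comp
        (ContinuousLinearMap.toSpanSingleton ℝ c')) := by
    refine h1.congr_of_eventuallyEq (hev.mono fun σ h => h.symm) ?_
    exact ((extChartAt I x₀).left_inv hs).symm
  have h3 := h2.mfderivWithin hJ.uniqueMDiffWithinAt
  rw [velocity, h3, chartVector_eq_mfderiv]
  change (mfderiv 𝓘(ℝ, E) I (extChartAt I x₀).symm (chartCurve I x₀ γ s))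
    ((1 : ℝ) • c') = _
  rw [one_smul]

theorem velocity_ne_zero (hJ : UniqueDiffWithinAt ℝ J s)
    (hγ : ContinuousWithinAt γ J s) (hs : γ s ∈ (extChartAt I x₀).source)
    (hc : HasDerivWithinAt (chartCurve I x₀ γ) c' J s) (h0 : c' ≠ 0) :
    velocity I J γ s ≠ 0 := fun h =>
  chartVector_ne_zero (I := I) ((extChartAt I x₀).map_source hs) h0
    ((velocity_eq_chartVector hJ hγ hs hc).symm.trans h)

/-- A Lagrangian evaluated on a velocity, in coordinates. -/
theorem lagrangianCoord_chartCurve (L : ℝ → ∀ x : N, TangentSpace I x → ℝ) (t : ℝ)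
    (hJ : UniqueDiffWithinAt ℝ J s)
    (hγ : ContinuousWithinAt γ J s) (hs : γ s ∈ (extChartAt I x₀).source)
    (hc : HasDerivWithinAt (chartCurve I x₀ γ) c' J s) :
    L t (γ s) (velocity I J γ s) = lagrangianCoord I L x₀ t (chartCurve I x₀ γ s) c' := by
  have h1 := velocity_eq_chartVector hJ hγ hs hc
  have h2 : (extChartAt I x₀).symm (chartCurve I x₀ γ s) = γ s := (extChartAt I x₀).left_inv hs
  -- The two vectors lie over points that are equal but not definitionally so; they are compared as
  -- elements of the model space after substituting the base point.
  have key : ∀ (y : N) (u : TangentSpace I (γ s)) (w : TangentSpace I y), y = γ s →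
      (u : E) = (w : E) → L t (γ s) u = L t y w := by
    rintro y u w rfl huw
    exact congrArg _ huw
  exact key _ _ _ h2 h1

omit [I.Boundaryless] in
/-- A `C^n` curve is `C^n` in coordinates. -/
theorem contDiffWithinAt_chartCurve {n : WithTop ℕ∞} (hn : n ≤ 2)
    (hγ : ContMDiffWithinAt 𝓘(ℝ, ℝ) I n γ J s)
    (hs : γ s ∈ (extChartAt I x₀).source) :
    ContDiffWithinAt ℝ n (chartCurve I x₀ γ) J s := by
  have : IsManifold I n N := IsManifold.of_le hn
  rw [extChartAt_source] at hs
  have h1 := (contMDiffWithinAt_iff_target_of_mem_source (I' := I) (y := x₀) hs).1 hγ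
  exact h1.2.contDiffWithinAt

omit [I.Boundaryless] in
theorem contMDiffWithinAt_of_chartCurve {n : WithTop ℕ∞} (hn : n ≤ 2)
    (hγ : ContinuousWithinAt γ J s) (hs : γ s ∈ (extChartAt I x₀).source)
    (h : ContDiffWithinAt ℝ n (chartCurve I x₀ γ) J s) :
    ContMDiffWithinAt 𝓘(ℝ, ℝ) I n γ J s := by
  have : IsManifold I n N := IsManifold.of_le hn
  rw [extChartAt_source] at hs
  exact (contMDiffWithinAt_iff_target_of_mem_source (I' := I) (y := x₀) hs).2
    ⟨hγ, h.contMDiffWithinAt⟩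

end Charts

end

/-! ### Coordinate expressions of a, b, U, ψ and of the classical Lagrangian. -/

section

section Forms

variable {E : Type*} [NormedAddCommGroup E] [NormedSpace ℝ E]
  {H : Type*} [TopologicalSpace H] (I : ModelWithCorners ℝ E H)
  {N : Type*} [TopologicalSpace N] [ChartedSpace H N]

/-- The coordinate expression of a covariant 2-tensor, as a field of bilinear forms. -/
def metricForm (g : ∀ x : N, TangentSpace I x →L[ℝ] TangentSpace I x →L[ℝ] ℝ)
    (x₀ : N) (z : E) : E →L[ℝ] E →L[ℝ] ℝ :=
  (ContinuousLinearMap.precomp ℝ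
    (mfderivWithin 𝓘(ℝ, E) I (extChartAt I x₀).symm (range I) z)).comp
    ((g ((extChartAt I x₀).symm z)).comp
      (mfderivWithin 𝓘(ℝ, E) I (extChartAt I x₀).symm (range I) z))

theorem metricForm_apply (g : ∀ x : N, TangentSpace I x →L[ℝ] TangentSpace I x →L[ℝ] ℝ)
    (x₀ : N) (z u v : E) : metricForm I g x₀ z u v = metricCoord I g x₀ z u v := rfl

/-- The coordinate expression of a 1-form. -/
def oneFormCoord (b : ∀ x : N, TangentSpace I x →L[ℝ] ℝ) (x₀ : N) (z : E) : E →L[ℝ] ℝ :=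
  (b ((extChartAt I x₀).symm z)).comp
    (mfderivWithin 𝓘(ℝ, E) I (extChartAt I x₀).symm (range I) z)

end Forms

variable {d : ℕ} {T : Set ℝ} {S : Type*} [TopologicalSpace S]
  [ChartedSpace (ModelS d) S] [IsManifold (𝓡 d) 2 S]

namespace Data

variable (D : Data d T S)

/-- The metric `a` in the chart around `x₀`. -/
def cA (x₀ : S) (t : ℝ) (z : ModelS d) : ModelS d →L[ℝ] ModelS d →L[ℝ] ℝ :=
  metricForm (𝓡 d) (D.a t) x₀ z

/-- The one-form `b` in the chart around `x₀`. -/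
def cB (x₀ : S) (t : ℝ) (z : ModelS d) : ModelS d →L[ℝ] ℝ := oneFormCoord (𝓡 d) (D.b t) x₀ z

/-- The scalar `U` in the chart around `x₀`. -/
def cU (x₀ : S) (t : ℝ) (z : ModelS d) : ℝ := D.U t ((extChartAt (𝓡 d) x₀).symm z)

/-- The scalar `ψ` in the chart around `x₀`. -/
def cψ (x₀ : S) (t : ℝ) (z : ModelS d) : ℝ := D.ψ t ((extChartAt (𝓡 d) x₀).symm z)

theorem lagrangianCoord_eq (x₀ : S) (t : ℝ) (z v : ModelS d) :
    lagrangianCoord (𝓡 d) D.lagrangian x₀ t z v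
      = 1 / (2 * D.cψ x₀ t z) * D.cA x₀ t z v v + D.cB x₀ t z v
        - (D.cU x₀ t z + 1 / 2) * D.cψ x₀ t z := rfl

variable {x₀ : S} {t : ℝ} {z : ModelS d}

theorem cψ_pos (ht : t ∈ T) : 0 < D.cψ x₀ t z := D.ψ_pos t ht _

theorem cA_symm (ht : t ∈ T) (u v : ModelS d) : D.cA x₀ t z u v = D.cA x₀ t z v u :=
  D.a_symm t ht _ _ _

theorem cA_pos (ht : t ∈ T) (hz : z ∈ (extChartAt (𝓡 d) x₀).target) {u : ModelS d}
    (hu : u ≠ 0) : 0 < D.cA x₀ t z u u :=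
  D.a_pos t ht _ _ (chartVector_ne_zero hz hu)

variable (x₀)

theorem contMDiffOn_prodSymm :
    ContMDiffOn 𝓘(ℝ, ℝ × ModelS d) (𝓘(ℝ, ℝ).prod (𝓡 d)) 1
      (fun p : ℝ × ModelS d => (p.1, (extChartAt (𝓡 d) x₀).symm p.2))
      (T ×ˢ (extChartAt (𝓡 d) x₀).target) := by
  have : IsManifold (𝓡 d) 1 S := IsManifold.of_le one_le_two
  refine ContMDiffOn.prodMk ?_ ?_
  · exact contDiff_fst.contMDiff.contMDiffOn
  · exact (contMDiffOn_extChartAt_symm (I := 𝓡 d) (n := 1) x₀).comp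
      contDiff_snd.contMDiff.contMDiffOn (fun _ hp => hp.2)

theorem contMDiffOn_prodChartVector (u : ModelS d) :
    ContMDiffOn 𝓘(ℝ, ℝ × ModelS d) (𝓡 d).tangent 1
      (fun p : ℝ × ModelS d => TotalSpace.mk' (ModelS d) (E := (TangentSpace (𝓡 d) : S → Type _))
        ((extChartAt (𝓡 d) x₀).symm p.2) (chartVector (𝓡 d) x₀ p.2 u))
      (T ×ˢ (extChartAt (𝓡 d) x₀).target) :=
  (contMDiffOn_chartVector (I := 𝓡 d) x₀ u).comp
    contDiff_snd.contMDiff.contMDiffOn (fun _ hp => hp.2)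

omit [IsManifold (𝓡 d) 2 S] in
theorem mapsTo_prodSymm : MapsTo (fun p : ℝ × ModelS d => (p.1, (extChartAt (𝓡 d) x₀).symm p.2))
    (T ×ˢ (extChartAt (𝓡 d) x₀).target) (T ×ˢ univ) := fun _ hp => ⟨hp.1, mem_univ _⟩

theorem contDiffOn_cU : ContDiffOn ℝ 1 (fun p : ℝ × ModelS d => D.cU x₀ p.1 p.2)
    (T ×ˢ (extChartAt (𝓡 d) x₀).target) :=
  (D.U_contMDiffOn.comp (contMDiffOn_prodSymm x₀) (mapsTo_prodSymm x₀)).contDiffOn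

theorem contDiffOn_cψ : ContDiffOn ℝ 1 (fun p : ℝ × ModelS d => D.cψ x₀ p.1 p.2)
    (T ×ˢ (extChartAt (𝓡 d) x₀).target) :=
  (D.ψ_contMDiffOn.comp (contMDiffOn_prodSymm x₀) (mapsTo_prodSymm x₀)).contDiffOn

/-- The components of a covector field are its values on the constant-component fields, which are
C¹. The evaluation is a section of a trivial line bundle, where regularity as a section is
regularity as a function. -/
theorem contDiffOn_cB : ContDiffOn ℝ 1 (fun p : ℝ × ModelS d => D.cB x₀ p.1 p.2)
    (T ×ˢ (extChartAt (𝓡 d) x₀).target) := by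
  rw [contDiffOn_clm_apply]
  intro u
  have h1 := D.b_contMDiffOn.comp (contMDiffOn_prodSymm x₀) (mapsTo_prodSymm x₀)
  have h2 := ContMDiffOn.clm_bundle_apply (E₂ := Bundle.Trivial S ℝ) (F₂ := ℝ)
    (b := fun p : ℝ × ModelS d => (extChartAt (𝓡 d) x₀).symm p.2)
    (ϕ := fun p => D.b p.1 ((extChartAt (𝓡 d) x₀).symm p.2)) h1
    (contMDiffOn_prodChartVector x₀ u)
  intro p hp
  have h3 := h2 p hp
  rw [contMDiffWithinAt_totalSpace] at h3
  exact h3.2.contDiffWithinAt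

theorem contDiffOn_cA : ContDiffOn ℝ 1 (fun p : ℝ × ModelS d => D.cA x₀ p.1 p.2)
    (T ×ˢ (extChartAt (𝓡 d) x₀).target) := by
  rw [contDiffOn_clm_apply]
  intro u
  rw [contDiffOn_clm_apply]
  intro v
  have h1 := D.a_contMDiffOn.comp (contMDiffOn_prodSymm x₀) (mapsTo_prodSymm x₀)
  have h2 := ContMDiffOn.clm_bundle_apply₂ (E₃ := Bundle.Trivial S ℝ) (F₃ := ℝ)
    (b := fun p : ℝ × ModelS d => (extChartAt (𝓡 d) x₀).symm p.2)
    (ψ := fun p => D.a p.1 ((extChartAt (𝓡 d) x₀).symm p.2)) h1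
    (contMDiffOn_prodChartVector x₀ u) (contMDiffOn_prodChartVector x₀ v)
  intro p hp
  have h3 := h2 p hp
  rw [contMDiffWithinAt_totalSpace] at h3
  exact h3.2.contDiffWithinAt

/-- The coordinate expression of the classical Lagrangian is `C¹`. -/
theorem contDiffOn_lagrangianCoord :
    ContDiffOn ℝ 1 (fun p : ℝ × ModelS d × ModelS d =>
      lagrangianCoord (𝓡 d) D.lagrangian x₀ p.1 p.2.1 p.2.2)
      (T ×ˢ (extChartAt (𝓡 d) x₀).target ×ˢ univ) := by
  have hm : MapsTo (fun p : ℝ × ModelS d × ModelS d => (p.1, p.2.1))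
    (T ×ˢ (extChartAt (𝓡 d) x₀).target ×ˢ univ) (T ×ˢ (extChartAt (𝓡 d) x₀).target) :=
    fun p hp => ⟨hp.1, hp.2.1⟩
  have hp : ContDiff ℝ 1 (fun p : ℝ × ModelS d × ModelS d => (p.1, p.2.1)) := by fun_prop
  have hv : ContDiff ℝ 1 (fun p : ℝ × ModelS d × ModelS d => p.2.2) := by fun_prop
  have hA := (D.contDiffOn_cA x₀).comp hp.contDiffOn hm
  have hB := (D.contDiffOn_cB x₀).comp hp.contDiffOn hm
  have hU := (D.contDiffOn_cU x₀).comp hp.contDiffOn hm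
  have hψ := (D.contDiffOn_cψ x₀).comp hp.contDiffOn hm
  simp only [lagrangianCoord_eq]
  refine ((ContDiffOn.mul ?_ ((hA.clm_apply hv.contDiffOn).clm_apply hv.contDiffOn)).add
    (hB.clm_apply hv.contDiffOn)).sub ((hU.add contDiffOn_const).mul hψ)
  exact contDiffOn_const.div (contDiffOn_const.mul hψ)
    fun _ hp => mul_ne_zero two_ne_zero (D.cψ_pos hp.1).ne'

end Data

end

/-! ### The Eisenhart metric in coordinates. -/

section

variable {d : ℕ} {T : Set ℝ} {S : Type*} [TopologicalSpace S]
  [ChartedSpace (ModelS d) S] [IsManifold (𝓡 d) 2 S]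

section SpacetimeCharts

variable (p₀ : ℝ × S × ℝ) (z u v : ℝ × ModelS d × ℝ)

omit [IsManifold (𝓡 d) 2 S] in
theorem extChartAt_spacetime_symm :
    (extChartAt (modelM d) p₀).symm z
      = (z.1, (extChartAt (𝓡 d) p₀.2.1).symm z.2.1, z.2.2) := by
  rw [extChartAt_prod, extChartAt_prod]
  rfl

omit [IsManifold (𝓡 d) 2 S] in
theorem extChartAt_spacetime_target :
    (extChartAt (modelM d) p₀).target
      = univ ×ˢ (extChartAt (𝓡 d) p₀.2.1).target ×ˢ univ := by
  rw [extChartAt_prod, extChartAt_prod, extChartAt_model_space_eq_id,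
    extChartAt_model_space_eq_id]
  simp only [PartialEquiv.prod_target, PartialEquiv.refl_target]

omit [IsManifold (𝓡 d) 2 S] in
theorem extChartAt_spacetime_apply (x : ℝ × S × ℝ) :
    extChartAt (modelM d) p₀ x = (x.1, extChartAt (𝓡 d) p₀.2.1 x.2.1, x.2.2) := by
  rw [extChartAt_prod, extChartAt_prod]
  rfl

omit [IsManifold (𝓡 d) 2 S] in
theorem chartCurve_spacetime (γ : ℝ → ℝ × S × ℝ) (s : ℝ) :
    chartCurve (modelM d) p₀ γ s
      = ((γ s).1, chartCurve (𝓡 d) p₀.2.1 (fun σ => (γ σ).2.1) s, (γ s).2.2) :=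
  extChartAt_spacetime_apply p₀ (γ s)

variable {z} (hz : z.2.1 ∈ (extChartAt (𝓡 d) p₀.2.1).target)
include hz

omit [IsManifold (𝓡 d) 2 S] in
theorem mem_extChartAt_spacetime_target : z ∈ (extChartAt (modelM d) p₀).target := by
  rw [extChartAt_spacetime_target]
  exact ⟨mem_univ _, hz, mem_univ _⟩

/-- The chain rule, which reduces `dt`, `dy` and `dπ` on coordinate vectors to derivatives of linear
projections of the model space. -/
theorem mfderiv_chartVector_spacetime {E' : Type*} [NormedAddCommGroup E'] [NormedSpace ℝ E']
    {H' : Type*} [TopologicalSpace H'] {I' : ModelWithCorners ℝ E' H'}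
    {N' : Type*} [TopologicalSpace N'] [ChartedSpace H' N'] {f : ℝ × S × ℝ → N'}
    (hf : MDifferentiableAt (modelM d) I' f ((extChartAt (modelM d) p₀).symm z)) :
    mfderiv (modelM d) I' f ((extChartAt (modelM d) p₀).symm z)
        (chartVector (modelM d) p₀ z u)
      = mfderiv 𝓘(ℝ, ℝ × ModelS d × ℝ) I' (f ∘ (extChartAt (modelM d) p₀).symm) z u := by
  have h1 := mfderiv_comp z hf
    (mdifferentiableAt_extChartAt_symm (mem_extChartAt_spacetime_target p₀ hz))
  rw [h1, chartVector_eq_mfderiv]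
  rfl

theorem dt_chartVector :
    dt ((extChartAt (modelM d) p₀).symm z) (chartVector (modelM d) p₀ z u) = u.1 := by
  refine (mfderiv_chartVector_spacetime p₀ u hz mdifferentiableAt_fst).trans ?_
  have : ((fun m : ℝ × S × ℝ => m.1) ∘ (extChartAt (modelM d) p₀).symm)
      = (fun z : ℝ × ModelS d × ℝ => z.1) := by
    funext z
    simp only [Function.comp, extChartAt_spacetime_symm]
  rw [this, mfderiv_eq_fderiv, fderiv_fst]
  rfl

theorem dy_chartVector :
    dy ((extChartAt (modelM d) p₀).symm z) (chartVector (modelM d) p₀ z u) = u.2.2 := by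
  refine (mfderiv_chartVector_spacetime p₀ u hz
    (MDifferentiableAt.snd mdifferentiableAt_snd)).trans ?_
  have : ((fun m : ℝ × S × ℝ => m.2.2) ∘ (extChartAt (modelM d) p₀).symm)
      = (fun z : ℝ × ModelS d × ℝ => z.2.2) := by
    funext z
    simp only [Function.comp, extChartAt_spacetime_symm]
  rw [this, mfderiv_eq_fderiv]
  have h : HasFDerivAt (fun z : ℝ × ModelS d × ℝ => z.2.2)
      ((ContinuousLinearMap.snd ℝ (ModelS d) ℝ).comp
        (ContinuousLinearMap.snd ℝ ℝ (ModelS d × ℝ))) z :=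
    hasFDerivAt_snd.comp z hasFDerivAt_snd
  rw [h.fderiv]
  rfl

theorem dπ_chartVector :
    (dπ ((extChartAt (modelM d) p₀).symm z) (chartVector (modelM d) p₀ z u) : ModelS d)
      = chartVector (𝓡 d) p₀.2.1 z.2.1 u.2.1 := by
  rw [dπ, mfderiv_chartVector_spacetime p₀ u hz
    (MDifferentiableAt.fst mdifferentiableAt_snd)]
  have : ((fun m : ℝ × S × ℝ => m.2.1) ∘ (extChartAt (modelM d) p₀).symm)
      = (extChartAt (𝓡 d) p₀.2.1).symm ∘ (fun z : ℝ × ModelS d × ℝ => z.2.1) := by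
    funext z
    simp only [Function.comp, extChartAt_spacetime_symm]
  have h : HasFDerivAt (fun z : ℝ × ModelS d × ℝ => z.2.1)
      ((ContinuousLinearMap.fst ℝ (ModelS d) ℝ).comp
        (ContinuousLinearMap.snd ℝ ℝ (ModelS d × ℝ))) z :=
    hasFDerivAt_fst.comp z hasFDerivAt_snd
  have h2 := HasMFDerivAt.comp z
    (mdifferentiableAt_extChartAt_symm (I := 𝓡 d) (x₀ := p₀.2.1) hz).hasMFDerivAt
    h.hasMFDerivAt
  rw [this, h2.mfderiv, chartVector_eq_mfderiv]
  rfl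

end SpacetimeCharts

namespace Data

variable (D : Data d T S) (p₀ : ℝ × S × ℝ) {z : ℝ × ModelS d × ℝ}

/-- The Eisenhart metric in coordinates. -/
theorem metricCoord_metric (hz : z.2.1 ∈ (extChartAt (𝓡 d) p₀.2.1).target)
    (u v : ℝ × ModelS d × ℝ) :
    metricCoord (modelM d) D.metric p₀ z u v
      = D.cA p₀.2.1 z.1 z.2.1 u.2.1 v.2.1
        - D.cψ p₀.2.1 z.1 z.2.1 * u.1 * (v.2.2 - D.cB p₀.2.1 z.1 z.2.1 v.2.1)
        - D.cψ p₀.2.1 z.1 z.2.1 * v.1 * (u.2.2 - D.cB p₀.2.1 z.1 z.2.1 u.2.1)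
        - (2 * D.cU p₀.2.1 z.1 z.2.1 + 1) * D.cψ p₀.2.1 z.1 z.2.1 ^ 2 * u.1 * v.1 := by
  -- The tensor products are expanded before passing to coordinates; the sign of n = −ψ dt makes the
  -- mixed terms negative and disappears from n ⊗ n.
  have key : ∀ (x : ℝ × S × ℝ) (X Y : TangentSpace (modelM d) x),
      D.metric x X Y = D.a x.1 x.2.1 (dπ x X) (dπ x Y)
        - D.ψ x.1 x.2.1 * dt x X * (dy x Y - D.b x.1 x.2.1 (dπ x Y))
        - D.ψ x.1 x.2.1 * dt x Y * (dy x X - D.b x.1 x.2.1 (dπ x X))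
        - (2 * D.U x.1 x.2.1 + 1) * D.ψ x.1 x.2.1 ^ 2 * dt x X * dt x Y := by
    intro x X Y
    have : D.metric x X Y = D.a x.1 x.2.1 (dπ x X) (dπ x Y)
      + (-(D.ψ x.1 x.2.1) * dt x X) * (dy x Y - D.b x.1 x.2.1 (dπ x Y))
      + (dy x X - D.b x.1 x.2.1 (dπ x X)) * (-(D.ψ x.1 x.2.1) * dt x Y)
      - (2 * D.U x.1 x.2.1 + 1) *
        ((-(D.ψ x.1 x.2.1) * dt x X) * (-(D.ψ x.1 x.2.1) * dt x Y)) := rfl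
    rw [this]
    ring
  rw [metricCoord, key, dt_chartVector p₀ u hz, dt_chartVector p₀ v hz, dy_chartVector p₀ u hz,
    dy_chartVector p₀ v hz]
  have hsy := extChartAt_spacetime_symm p₀ z
  have h1 : ((extChartAt (modelM d) p₀).symm z).1 = z.1 := by rw [hsy]
  have h2 : ((extChartAt (modelM d) p₀).symm z).2.1 = (extChartAt (𝓡 d) p₀.2.1).symm z.2.1 := by
    rw [hsy]
  -- The forms are evaluated over the base point of the product chart, which agrees with that of the
  -- chart of S only up to rewriting; this transports them.
  have hA : ∀ (t : ℝ) (q : S) (X Y : TangentSpace (𝓡 d) q) (u v : ModelS d), t = z.1 →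
      q = (extChartAt (𝓡 d) p₀.2.1).symm z.2.1 →
      (X : ModelS d) = chartVector (𝓡 d) p₀.2.1 z.2.1 u →
      (Y : ModelS d) = chartVector (𝓡 d) p₀.2.1 z.2.1 v →
      D.a t q X Y = D.cA p₀.2.1 z.1 z.2.1 u v ∧ D.b t q X = D.cB p₀.2.1 z.1 z.2.1 u := by
    rintro t q X Y u v rfl rfl hX hY
    constructor
    · exact congrArg₂ (fun X Y => D.a z.1 _ X Y) hX hY
    · exact congrArg (fun X => D.b z.1 _ X) hX
  have hψ : D.ψ ((extChartAt (modelM d) p₀).symm z).1 ((extChartAt (modelM d) p₀).symm z).2.1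
    = D.cψ p₀.2.1 z.1 z.2.1 := by rw [h1, h2, cψ]
  have hU : D.U ((extChartAt (modelM d) p₀).symm z).1 ((extChartAt (modelM d) p₀).symm z).2.1
    = D.cU p₀.2.1 z.1 z.2.1 := by rw [h1, h2, cU]
  rw [hψ, hU, (hA _ _ _ _ _ _ h1 h2 (dπ_chartVector p₀ u hz) (dπ_chartVector p₀ v hz)).1,
    (hA _ _ _ _ _ _ h1 h2 (dπ_chartVector p₀ u hz) (dπ_chartVector p₀ v hz)).2,
    (hA _ _ _ _ _ _ h1 h2 (dπ_chartVector p₀ v hz) (dπ_chartVector p₀ v hz)).2]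

/-- The Eisenhart metric is `C¹` in coordinates. -/
theorem contDiffOn_metricForm :
    ContDiffOn ℝ 1 (metricForm (modelM d) D.metric p₀)
      (T ×ˢ (extChartAt (𝓡 d) p₀.2.1).target ×ˢ univ) := by
  rw [contDiffOn_clm_apply]
  intro u
  rw [contDiffOn_clm_apply]
  intro v
  have hm : MapsTo (fun p : ℝ × ModelS d × ℝ => (p.1, p.2.1))
    (T ×ˢ (extChartAt (𝓡 d) p₀.2.1).target ×ˢ univ)
    (T ×ˢ (extChartAt (𝓡 d) p₀.2.1).target) := fun p hp => ⟨hp.1, hp.2.1⟩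
  have hp : ContDiff ℝ 1 (fun p : ℝ × ModelS d × ℝ => (p.1, p.2.1)) := by fun_prop
  have hA := (D.contDiffOn_cA p₀.2.1).comp hp.contDiffOn hm
  have hB := (D.contDiffOn_cB p₀.2.1).comp hp.contDiffOn hm
  have hU := (D.contDiffOn_cU p₀.2.1).comp hp.contDiffOn hm
  have hψ := (D.contDiffOn_cψ p₀.2.1).comp hp.contDiffOn hm
  refine ContDiffOn.congr ?_
    (fun z hz => (metricForm_apply _ _ _ _ _ _).trans (D.metricCoord_metric p₀ hz.2.1 u v))
  refine ((((hA.clm_apply contDiffOn_const).clm_apply contDiffOn_const).sub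
    ((hψ.mul contDiffOn_const).mul (contDiffOn_const.sub (hB.clm_apply contDiffOn_const)))).sub
    ((hψ.mul contDiffOn_const).mul (contDiffOn_const.sub (hB.clm_apply contDiffOn_const)))).sub
    (((((contDiffOn_const.mul hU).add contDiffOn_const).mul (hψ.pow 2)).mul
      contDiffOn_const).mul contDiffOn_const)

theorem metricCoord_symm {p₀} (hz1 : z.1 ∈ T) (hz : z.2.1 ∈ (extChartAt (𝓡 d) p₀.2.1).target)
    (u v : ℝ × ModelS d × ℝ) :
    metricCoord (modelM d) D.metric p₀ z u v = metricCoord (modelM d) D.metric p₀ z v u := by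
  rw [D.metricCoord_metric p₀ hz, D.metricCoord_metric p₀ hz, D.cA_symm hz1]
  ring

end Data

end

/-! ### Light lifts: regularity and lightlike tangent vectors. -/

section

section Calculus

variable {F : Type*} [NormedAddCommGroup F] [NormedSpace ℝ F]

theorem ContDiffWithinAt.derivWithin_right' {f : ℝ → F} {J : Set ℝ} {s : ℝ}
    {n m : WithTop ℕ∞} (hf : ContDiffWithinAt ℝ n f J s) (hJ : UniqueDiffOn ℝ J)
    (hmn : m + 1 ≤ n) (hs : s ∈ J) : ContDiffWithinAt ℝ m (derivWithin f J) J s :=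
  (hf.fderivWithin_right hJ hmn hs).clm_apply contDiffWithinAt_const

/-- The fundamental theorem of calculus on a compact interval, with one-sided derivatives at the
endpoints. -/
theorem hasDerivWithinAt_integral_Icc [CompleteSpace F] {f : ℝ → F} {a b t : ℝ}
    (hf : ContinuousOn f (Icc a b)) (ht : t ∈ Icc a b) :
    HasDerivWithinAt (fun u => ∫ x in a..u, f x) (f t) (Icc a b) t := by
  have hab : a ≤ b := ht.1.trans ht.2
  -- Extended by its end values, the integrand is continuous on the whole line, so the two-sided
  -- theorem covers the endpoints too.
  set g : ℝ → F := IccExtend hab (domRestrict (Icc a b) f) with hg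
  have hgc : Continuous g := (continuousOn_iff_continuous_domRestrict.1 hf).Icc_extend'
  have hgf : ∀ x ∈ Icc a b, g x = f x := fun x hx => IccExtend_of_mem hab _ hx
  have h1 : HasDerivAt (fun u => ∫ x in a..u, g x) (g t) t :=
    intervalIntegral.integral_hasDerivAt_right (hgc.intervalIntegrable _ _)
      (hgc.stronglyMeasurableAtFilter _ _) hgc.continuousAt
  rw [hgf t ht] at h1
  refine h1.hasDerivWithinAt.congr (fun u hu => ?_) ?_
  · refine intervalIntegral.integral_congr fun x hx => ?_
    rw [uIcc_of_le hu.1] at hx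
    exact (hgf x ⟨hx.1, hx.2.trans hu.2⟩).symm
  · refine intervalIntegral.integral_congr fun x hx => ?_
    rw [uIcc_of_le ht.1] at hx
    exact (hgf x ⟨hx.1, hx.2.trans ht.2⟩).symm

theorem contDiffOn_succ_of_hasDerivWithinAt {f f' : ℝ → F} {a b : ℝ} (hab : a < b)
    {n : ℕ} (h : ∀ t ∈ Icc a b, HasDerivWithinAt f (f' t) (Icc a b) t)
    (hf' : ContDiffOn ℝ n f' (Icc a b)) : ContDiffOn ℝ (n + 1) f (Icc a b) := by
  rw [contDiffOn_succ_iff_derivWithin (uniqueDiffOn_Icc hab)]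
  refine ⟨fun t ht => (h t ht).differentiableWithinAt, by simp, hf'.congr fun t ht => ?_⟩
  exact (h t ht).derivWithin (uniqueDiffOn_Icc hab t ht)

end Calculus

variable {d : ℕ} {T : Set ℝ} {S : Type*} [TopologicalSpace S]
  [ChartedSpace (ModelS d) S] [IsManifold (𝓡 d) 2 S]

section Curves

variable {t₀ t₁ t : ℝ} {q : ℝ → S} {x₀ : S}

theorem hasDerivWithinAt_chartCurve (hq : ContMDiffOn 𝓘(ℝ, ℝ) (𝓡 d) 1 q (Icc t₀ t₁))
    (ht : t ∈ Icc t₀ t₁) (hx : q t ∈ (extChartAt (𝓡 d) x₀).source) :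
    HasDerivWithinAt (chartCurve (𝓡 d) x₀ q)
      (derivWithin (chartCurve (𝓡 d) x₀ q) (Icc t₀ t₁) t) (Icc t₀ t₁) t :=
  ((contDiffWithinAt_chartCurve one_le_two (hq t ht) hx).differentiableWithinAt
    one_ne_zero).hasDerivWithinAt

omit [IsManifold (𝓡 d) 2 S] in
theorem eventually_mem_source (hq : ContMDiffOn 𝓘(ℝ, ℝ) (𝓡 d) 1 q (Icc t₀ t₁))
    (ht : t ∈ Icc t₀ t₁) (hx : q t ∈ (extChartAt (𝓡 d) x₀).source) :
    ∀ᶠ t' in 𝓝[Icc t₀ t₁] t, q t' ∈ (extChartAt (𝓡 d) x₀).source :=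
  (hq t ht).continuousWithinAt ((isOpen_extChartAt_source x₀).mem_nhds hx)

end Curves

namespace Data

variable (D : Data d T S) {t₀ t₁ : ℝ} {q : ℝ → S} {x₀ : S} (h : t₀ < t₁)
  (hT : IsOpen T) (hJ : Icc t₀ t₁ ⊆ T) (hq : ContMDiffOn 𝓘(ℝ, ℝ) (𝓡 d) 1 q (Icc t₀ t₁))
include h hq

theorem lagrangian_velocity {t : ℝ} (ht : t ∈ Icc t₀ t₁)
    (hx : q t ∈ (extChartAt (𝓡 d) x₀).source) :
    D.lagrangian t (q t) (velocity (𝓡 d) (Icc t₀ t₁) q t)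
      = lagrangianCoord (𝓡 d) D.lagrangian x₀ t (chartCurve (𝓡 d) x₀ q t)
        (derivWithin (chartCurve (𝓡 d) x₀ q) (Icc t₀ t₁) t) :=
  lagrangianCoord_chartCurve D.lagrangian t (uniqueDiffOn_Icc h t ht)
    (hq t ht).continuousWithinAt hx (hasDerivWithinAt_chartCurve hq ht hx)

include hT hJ

/-- Two values of `n` matter: `n = 0` makes the lift of a C¹ curve C¹, and `n = 1` makes the lift of
a C² curve C². The Lagrangian, being only C¹, allows nothing beyond. -/
theorem contDiffOn_lagrangian_velocity {n : WithTop ℕ∞} (hn : n ≤ 1)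
    (hq' : ContMDiffOn 𝓘(ℝ, ℝ) (𝓡 d) (n + 1) q (Icc t₀ t₁)) :
    ContDiffOn ℝ n (fun t => D.lagrangian t (q t) (velocity (𝓡 d) (Icc t₀ t₁) q t))
      (Icc t₀ t₁) := by
  intro t ht
  have hx : q t ∈ (extChartAt (𝓡 d) (q t)).source := mem_extChartAt_source _
  have hn2 : n + 1 ≤ 2 := by
    calc n + 1 ≤ 1 + 1 := by gcongr
      _ = 2 := one_add_one_eq_two
  have hc := contDiffWithinAt_chartCurve hn2 (hq' t ht) hx
  have hc' := ContDiffWithinAt.derivWithin_right' hc (uniqueDiffOn_Icc h) le_rfl ht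
  have hmem : (t, chartCurve (𝓡 d) (q t) q t,
      derivWithin (chartCurve (𝓡 d) (q t) q) (Icc t₀ t₁) t)
      ∈ T ×ˢ (extChartAt (𝓡 d) (q t)).target ×ˢ univ :=
    ⟨hJ ht, (extChartAt (𝓡 d) (q t)).map_source hx, mem_univ _⟩
  have hL : ContDiffAt ℝ n _ _ := ((D.contDiffOn_lagrangianCoord (q t)).of_le hn).contDiffAt
    ((hT.prod ((isOpen_extChartAt_target (q t)).prod isOpen_univ)).mem_nhds hmem)
  have := hL.comp_contDiffWithinAt t (contDiffWithinAt_id.prodMk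
    ((hc.of_le le_self_add).prodMk hc'))
  refine this.congr_of_eventuallyEq ?_ (D.lagrangian_velocity h hq ht hx)
  filter_upwards [eventually_mem_source hq ht hx, self_mem_nhdsWithin] with t' hx' ht'
  exact D.lagrangian_velocity h hq ht' hx'

theorem continuousOn_lagrangian_velocity :
    ContinuousOn (fun t => D.lagrangian t (q t) (velocity (𝓡 d) (Icc t₀ t₁) q t))
      (Icc t₀ t₁) :=
  (D.contDiffOn_lagrangian_velocity h hT hJ hq (n := 0) zero_le_one
    (by simpa using hq)).continuousOn

theorem hasDerivWithinAt_liftY (y₀ : ℝ) {t : ℝ} (ht : t ∈ Icc t₀ t₁) :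
    HasDerivWithinAt (D.liftY t₀ t₁ q y₀)
      (D.lagrangian t (q t) (velocity (𝓡 d) (Icc t₀ t₁) q t)) (Icc t₀ t₁) t :=
  (hasDerivWithinAt_integral_Icc (D.continuousOn_lagrangian_velocity h hT hJ hq) ht).const_add y₀

/-- The derivative lost by forming the velocity is regained by integrating L, so the lift is as
regular as the curve. -/
theorem contMDiffOn_lightLift (y₀ : ℝ) {n : ℕ} (hn : n ≤ 1)
    (hq' : ContMDiffOn 𝓘(ℝ, ℝ) (𝓡 d) (n + 1) q (Icc t₀ t₁)) :
    ContMDiffOn 𝓘(ℝ, ℝ) (modelM d) (n + 1) (D.lightLift t₀ t₁ q y₀) (Icc t₀ t₁) := by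
  refine contMDiffOn_id.prodMk (hq'.prodMk (ContDiffOn.contMDiffOn ?_))
  exact contDiffOn_succ_of_hasDerivWithinAt h
    (fun t ht => D.hasDerivWithinAt_liftY h hT hJ hq y₀ ht)
    (D.contDiffOn_lagrangian_velocity h hT hJ hq (by exact_mod_cast hn) hq')

variable {J : Set ℝ} {τ : ℝ → ℝ} {τ' s : ℝ} (p₀ : ℝ × S × ℝ) (y₀ : ℝ)

/-- The velocity of a reparametrized light lift in coordinates. -/
theorem hasDerivWithinAt_chartCurve_lightLift (hs : s ∈ J) (hm : MapsTo τ J (Icc t₀ t₁))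
    (hτ : HasDerivWithinAt τ τ' J s) (hx : q (τ s) ∈ (extChartAt (𝓡 d) p₀.2.1).source) :
    HasDerivWithinAt (chartCurve (modelM d) p₀ (D.lightLift t₀ t₁ q y₀ ∘ τ))
      (τ', τ' • derivWithin (chartCurve (𝓡 d) p₀.2.1 q) (Icc t₀ t₁) (τ s),
        τ' * lagrangianCoord (𝓡 d) D.lagrangian p₀.2.1 (τ s) (chartCurve (𝓡 d) p₀.2.1 q (τ s))
          (derivWithin (chartCurve (𝓡 d) p₀.2.1 q) (Icc t₀ t₁) (τ s))) J s := by
  have h1 := (hasDerivWithinAt_chartCurve hq (hm hs) hx).scomp s hτ hm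
  have h2 := (D.hasDerivWithinAt_liftY h hT hJ hq y₀ (hm hs)).scomp s hτ hm
  rw [D.lagrangian_velocity h hq (hm hs) hx] at h2
  have h3 := hτ.prodMk (h1.prodMk h2)
  exact h3.congr (fun σ hσ => chartCurve_spacetime _ _ _) (chartCurve_spacetime _ _ _)

omit h hq hT hJ in
/-- The tangent vectors of a light lift are lightlike. -/
theorem metricCoord_lift_eq_zero {z : ℝ × ModelS d × ℝ} (hz1 : z.1 ∈ T)
    (hz : z.2.1 ∈ (extChartAt (𝓡 d) p₀.2.1).target) (v : ModelS d) (r : ℝ) :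
    metricCoord (modelM d) D.metric p₀ z
      (r, r • v, r * lagrangianCoord (𝓡 d) D.lagrangian p₀.2.1 z.1 z.2.1 v)
      (r, r • v, r * lagrangianCoord (𝓡 d) D.lagrangian p₀.2.1 z.1 z.2.1 v) = 0 := by
  -- With last component ℓ the value would be 2ψr(rL − ℓ); here ℓ = rL.
  rw [D.metricCoord_metric p₀ hz, D.lagrangianCoord_eq]
  have hψ : D.cψ p₀.2.1 z.1 z.2.1 ≠ 0 := (D.cψ_pos hz1).ne'
  simp only [map_smul, smul_apply, smul_eq_mul]
  field_simp
  ring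

/-- The reparametrization is included so that the result serves both the lift itself, with the
identity, and the geodesic obtained from it. Regularity comes from the t-component, which is the
derivative of `τ`. -/
theorem isLightlikeOn_lightLift_comp {s₀ s₁ : ℝ} (hs : s₀ < s₁)
    (hm : MapsTo τ (Icc s₀ s₁) (Icc t₀ t₁)) (hτ : ContDiffOn ℝ 1 τ (Icc s₀ s₁))
    (hτ' : ∀ s ∈ Icc s₀ s₁, 0 < derivWithin τ (Icc s₀ s₁) s) :
    IsLightlikeOn (modelM d) D.metric (Icc s₀ s₁) (D.lightLift t₀ t₁ q y₀ ∘ τ) := by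
  have hlift : ContMDiffOn 𝓘(ℝ, ℝ) (modelM d) 1 (D.lightLift t₀ t₁ q y₀) (Icc t₀ t₁) := by
    simpa using D.contMDiffOn_lightLift h hT hJ hq y₀ (n := 0) zero_le_one (by simpa using hq)
  have hC : ContMDiffOn 𝓘(ℝ, ℝ) (modelM d) 1 (D.lightLift t₀ t₁ q y₀ ∘ τ) (Icc s₀ s₁) :=
    hlift.comp hτ.contMDiffOn fun _ hs => hm hs
  refine ⟨hC, fun s hsJ => ?_⟩
  set p₀ := D.lightLift t₀ t₁ q y₀ (τ s) with hp₀
  have hx : q (τ s) ∈ (extChartAt (𝓡 d) p₀.2.1).source := mem_extChartAt_source _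
  have hz : chartCurve (𝓡 d) p₀.2.1 q (τ s) ∈ (extChartAt (𝓡 d) p₀.2.1).target :=
    (extChartAt (𝓡 d) p₀.2.1).map_source hx
  have hτs := ((hτ.differentiableOn one_ne_zero) s hsJ).hasDerivWithinAt
  have hd := D.hasDerivWithinAt_chartCurve_lightLift h hT hJ hq p₀ y₀ hsJ hm hτs hx
  have hu := uniqueDiffOn_Icc hs s hsJ
  have hsrc : (D.lightLift t₀ t₁ q y₀ ∘ τ) s ∈ (extChartAt (modelM d) p₀).source :=
    mem_extChartAt_source _
  constructor
  · refine velocity_ne_zero hu (hC s hsJ).continuousWithinAt hsrc hd fun h0 => ?_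
    exact (hτ' s hsJ).ne' (congrArg Prod.fst h0)
  · have h1 := lagrangianCoord_chartCurve (I := modelM d)
      (fun _ x V => D.metric x V V) 0 hu (hC s hsJ).continuousWithinAt hsrc hd
    refine h1.trans ?_
    rw [chartCurve_spacetime]
    exact D.metricCoord_lift_eq_zero p₀ (z := (τ s, chartCurve (𝓡 d) p₀.2.1 q (τ s), _))
      (hJ (hm hsJ)) hz _ _

theorem isLightlikeOn_lightLift :
    IsLightlikeOn (modelM d) D.metric (Icc t₀ t₁) (D.lightLift t₀ t₁ q y₀) := by
  refine D.isLightlikeOn_lightLift_comp h hT hJ hq y₀ (τ := id) h (mapsTo_id _)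
    contDiffOn_id fun s hs => ?_
  rw [derivWithin_id _ _ (uniqueDiffOn_Icc h s hs)]
  exact one_pos

end Data

end

/-! ### Momenta and forces of the metric compared with those of L. -/

section

variable {d : ℕ} {T : Set ℝ} {S : Type*} [TopologicalSpace S]
  [ChartedSpace (ModelS d) S] [IsManifold (𝓡 d) 2 S]

section Quadratic

variable {F : Type*} [NormedAddCommGroup F] [NormedSpace ℝ F]

theorem hasFDerivAt_quadratic (B : F →L[ℝ] F →L[ℝ] ℝ) (v : F) :
    HasFDerivAt (fun v => B v v) (B v + B.flip v) v := by
  have := B.hasFDerivAt (x := v) |>.clm_apply (hasFDerivAt_id v)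
  refine this.congr_fderiv ?_
  ext w
  simp

theorem HasFDerivAt.hasDerivAt_line {G : Type*} [NormedAddCommGroup G] [NormedSpace ℝ G]
    {f : F → G} {f' : F →L[ℝ] G} {z w : F}
    (hf : HasFDerivAt f f' z) : HasDerivAt (fun r : ℝ => f (z + r • w)) (f' w) 0 := by
  have h1 : HasDerivAt (fun r : ℝ => z + r • w) w 0 := by
    simpa using ((hasDerivAt_id (0 : ℝ)).smul_const w).const_add z
  have h2 : HasFDerivAt f f' (z + (0 : ℝ) • w) := by simpa using hf
  exact h2.comp_hasDerivAt (0 : ℝ) h1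

end Quadratic

omit [IsManifold (𝓡 d) 2 S] in
theorem prod_target_univ_mem_nhds {G : Type*} [TopologicalSpace G] {x₀ : S} {t : ℝ}
    {z : ModelS d} (hT : IsOpen T) (hz : z ∈ (extChartAt (𝓡 d) x₀).target) (ht : t ∈ T) (g : G) :
    T ×ˢ (extChartAt (𝓡 d) x₀).target ×ˢ (univ : Set G) ∈ 𝓝 (t, z, g) :=
  (hT.prod ((isOpen_extChartAt_target x₀).prod isOpen_univ)).mem_nhds ⟨ht, hz, mem_univ g⟩

namespace Data

variable (D : Data d T S) {x₀ : S} {t : ℝ} {z v w : ModelS d}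

/-- The momentum of the classical Lagrangian. -/
theorem fderiv_lagrangianCoord_velocity (ht : t ∈ T) :
    fderiv ℝ (fun v => lagrangianCoord (𝓡 d) D.lagrangian x₀ t z v) v w
      = 1 / D.cψ x₀ t z * D.cA x₀ t z v w + D.cB x₀ t z w := by
  have h := (((hasFDerivAt_quadratic (D.cA x₀ t z) v).const_mul (1 / (2 * D.cψ x₀ t z))).add
    (D.cB x₀ t z).hasFDerivAt).sub_const ((D.cU x₀ t z + 1 / 2) * D.cψ x₀ t z)
  have h' : HasFDerivAt (fun v => lagrangianCoord (𝓡 d) D.lagrangian x₀ t z v) _ v := h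
  rw [h'.fderiv]
  have := D.cψ_pos (x₀ := x₀) (z := z) ht
  simp only [add_apply, smul_apply, ContinuousLinearMap.flip_apply, smul_eq_mul,
    D.cA_symm ht w v]
  field_simp
  ring

variable {p₀ : ℝ × S × ℝ} {Z V W : ℝ × ModelS d × ℝ}

theorem fderiv_geodesicLagrangianCoord_velocity (hZ1 : Z.1 ∈ T)
    (hZ : Z.2.1 ∈ (extChartAt (𝓡 d) p₀.2.1).target) (σ : ℝ) :
    fderiv ℝ (fun V => lagrangianCoord (modelM d) D.geodesicLagrangian p₀ σ Z V) V W
      = -2 * metricCoord (modelM d) D.metric p₀ Z V W := by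
  have h : HasFDerivAt (fun V => lagrangianCoord (modelM d) D.geodesicLagrangian p₀ σ Z V) _ V :=
    (hasFDerivAt_quadratic (metricForm (modelM d) D.metric p₀ Z) V).neg
  rw [h.fderiv]
  simp only [neg_apply, add_apply, ContinuousLinearMap.flip_apply, metricForm_apply,
    D.metricCoord_symm hZ1 hZ W V]
  ring

/-- The direction `w` has neither t- nor y-component, so `ℓ` drops out and a(rv, w) + ψr b(w) is
left: this is ψr times the classical momentum a(v, w)/ψ + b(w). -/
theorem metricCoord_spatial (hz : z ∈ (extChartAt (𝓡 d) p₀.2.1).target) (ht : t ∈ T)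
    (y r ℓ : ℝ) :
    metricCoord (modelM d) D.metric p₀ (t, z, y) (r, r • v, ℓ) (0, w, 0)
      = D.cψ p₀.2.1 t z * r *
        fderiv ℝ (fun v => lagrangianCoord (𝓡 d) D.lagrangian p₀.2.1 t z v) v w := by
  rw [D.metricCoord_metric p₀ hz, D.fderiv_lagrangianCoord_velocity ht]
  have := (D.cψ_pos (x₀ := p₀.2.1) (z := z) ht).ne'
  simp only [map_smul, smul_apply, smul_eq_mul]
  field_simp
  ring

/-- Names the four directional derivatives once, so that the position derivatives of L and of g(x',
x') are polynomial expressions in the same quantities and can be compared by algebra. -/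
theorem exists_hasDerivAt_line (hT : IsOpen T) (hz : z ∈ (extChartAt (𝓡 d) x₀).target)
    (ht : t ∈ T) (v w : ModelS d) : ∃ ψ' U' B' A' : ℝ,
      HasDerivAt (fun ρ : ℝ => D.cψ x₀ t (z + ρ • w)) ψ' 0 ∧
      HasDerivAt (fun ρ : ℝ => D.cU x₀ t (z + ρ • w)) U' 0 ∧
      HasDerivAt (fun ρ : ℝ => D.cB x₀ t (z + ρ • w) v) B' 0 ∧
      HasDerivAt (fun ρ : ℝ => D.cA x₀ t (z + ρ • w) v v) A' 0 := by
  have hnhds : T ×ˢ (extChartAt (𝓡 d) x₀).target ∈ 𝓝 (t, z) :=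
    (hT.prod (isOpen_extChartAt_target x₀)).mem_nhds ⟨ht, hz⟩
  have key : ∀ {G : Type} [NormedAddCommGroup G] [NormedSpace ℝ G] (f : ℝ × ModelS d → G),
      ContDiffOn ℝ 1 f (T ×ˢ (extChartAt (𝓡 d) x₀).target) →
      ∃ f', HasDerivAt (fun ρ : ℝ => f (t, z + ρ • w)) f' 0 := by
    intro G _ _ f hf
    have := HasFDerivAt.hasDerivAt_line (w := ((0 : ℝ), w))
      ((hf.contDiffAt hnhds).differentiableAt one_ne_zero).hasFDerivAt
    simp only [Prod.smul_mk, smul_zero, Prod.mk_add_mk, add_zero] at this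
    exact ⟨_, this⟩
  obtain ⟨ψ', hψ⟩ := key _ (D.contDiffOn_cψ x₀)
  obtain ⟨U', hU⟩ := key _ (D.contDiffOn_cU x₀)
  obtain ⟨B', hB⟩ := key _ ((D.contDiffOn_cB x₀).clm_apply (contDiffOn_const (c := v)))
  obtain ⟨A', hA⟩ := key _ (((D.contDiffOn_cA x₀).clm_apply
    (contDiffOn_const (c := v))).clm_apply (contDiffOn_const (c := v)))
  exact ⟨ψ', U', B', A', hψ, hU, hB, hA⟩

theorem fderiv_lagrangianCoord_position (hT : IsOpen T)
    (hz : z ∈ (extChartAt (𝓡 d) x₀).target) (ht : t ∈ T) {ψ' U' B' A' : ℝ}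
    (hψ : HasDerivAt (fun ρ : ℝ => D.cψ x₀ t (z + ρ • w)) ψ' 0)
    (hU : HasDerivAt (fun ρ : ℝ => D.cU x₀ t (z + ρ • w)) U' 0)
    (hB : HasDerivAt (fun ρ : ℝ => D.cB x₀ t (z + ρ • w) v) B' 0)
    (hA : HasDerivAt (fun ρ : ℝ => D.cA x₀ t (z + ρ • w) v v) A' 0) :
    fderiv ℝ (fun z => lagrangianCoord (𝓡 d) D.lagrangian x₀ t z v) z w
      = A' / (2 * D.cψ x₀ t z) - D.cA x₀ t z v v * ψ' / (2 * D.cψ x₀ t z ^ 2) + B'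
        - U' * D.cψ x₀ t z - (D.cU x₀ t z + 1 / 2) * ψ' := by
  have hΩ : IsOpen (extChartAt (𝓡 d) x₀).target := isOpen_extChartAt_target x₀
  have hψ00 : 2 * D.cψ x₀ t (z + (0 : ℝ) • w) ≠ 0 :=
    mul_ne_zero two_ne_zero (D.cψ_pos ht).ne'
  have hψ0 : D.cψ x₀ t z ≠ 0 := (D.cψ_pos ht).ne'
  have hL1 : DifferentiableAt ℝ (fun z => lagrangianCoord (𝓡 d) D.lagrangian x₀ t z v) z := by
    have h1 := ((D.contDiffOn_lagrangianCoord x₀).contDiffAt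
      (prod_target_univ_mem_nhds hT hz ht v)).differentiableAt one_ne_zero
    exact DifferentiableAt.comp (g := fun p : ℝ × ModelS d × ModelS d =>
      lagrangianCoord (𝓡 d) D.lagrangian x₀ p.1 p.2.1 p.2.2)
      (f := fun z : ModelS d => (t, z, v)) z h1 (by fun_prop)
  have hL2 := HasFDerivAt.hasDerivAt_line (w := w) hL1.hasFDerivAt
  have hL3 := (((((hasDerivAt_const (0 : ℝ) (1 : ℝ)).fun_div (hψ.const_mul 2) hψ00).fun_mul
    hA).fun_add hB).fun_sub ((hU.add_const (1 / 2)).fun_mul hψ))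
  rw [hL2.unique hL3]
  simp only [zero_smul, add_zero]
  field_simp
  ring

/-- The component `ℓ` is kept free: it is held fixed while the base point moves, and may be replaced
by rL only after the differentiation. -/
theorem fderiv_metricCoord_position (hT : IsOpen T)
    (hz : z ∈ (extChartAt (𝓡 d) p₀.2.1).target) (ht : t ∈ T) (y r ℓ : ℝ) {ψ' U' B' A' : ℝ}
    (hψ : HasDerivAt (fun ρ : ℝ => D.cψ p₀.2.1 t (z + ρ • w)) ψ' 0)
    (hU : HasDerivAt (fun ρ : ℝ => D.cU p₀.2.1 t (z + ρ • w)) U' 0)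
    (hB : HasDerivAt (fun ρ : ℝ => D.cB p₀.2.1 t (z + ρ • w) v) B' 0)
    (hA : HasDerivAt (fun ρ : ℝ => D.cA p₀.2.1 t (z + ρ • w) v v) A' 0) :
    fderiv ℝ (fun Z => metricCoord (modelM d) D.metric p₀ Z (r, r • v, ℓ) (r, r • v, ℓ))
      (t, z, y) (0, w, 0)
      = r ^ 2 * A' - 2 * r * ψ' * (ℓ - r * D.cB p₀.2.1 t z v)
        + 2 * r ^ 2 * D.cψ p₀.2.1 t z * B'
        - r ^ 2 * (2 * U' * D.cψ p₀.2.1 t z ^ 2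
          + (2 * D.cU p₀.2.1 t z + 1) * 2 * D.cψ p₀.2.1 t z * ψ') := by
  have hΩ : IsOpen (extChartAt (𝓡 d) p₀.2.1).target := isOpen_extChartAt_target _
  have hM1 : DifferentiableAt ℝ
      (fun Z => metricCoord (modelM d) D.metric p₀ Z (r, r • v, ℓ) (r, r • v, ℓ)) (t, z, y) := by
    have h1 := ((D.contDiffOn_metricForm p₀).contDiffAt
      (prod_target_univ_mem_nhds hT hz ht y)).differentiableAt one_ne_zero
    exact (h1.clm_apply (differentiableAt_const (r, r • v, ℓ))).clm_apply
      (differentiableAt_const (r, r • v, ℓ))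
  have hM2 := HasFDerivAt.hasDerivAt_line (w := ((0 : ℝ), w, (0 : ℝ))) hM1.hasFDerivAt
  -- The coordinate formula of the metric is available only while the line stays in the target of
  -- the chart.
  have hev : ∀ᶠ ρ : ℝ in 𝓝 0, z + ρ • w ∈ (extChartAt (𝓡 d) p₀.2.1).target := by
    have : ContinuousAt (fun ρ : ℝ => z + ρ • w) 0 := by fun_prop
    exact this.preimage_mem_nhds (hΩ.mem_nhds (by simpa using hz))
  have hM3 := ((hA.const_mul (r ^ 2)).fun_sub
    ((hψ.const_mul (2 * r)).fun_mul ((hasDerivAt_const (0 : ℝ) ℓ).fun_sub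
      (hB.const_mul r)))).fun_sub
    ((((hU.const_mul 2).add_const 1).fun_mul (hψ.fun_mul hψ)).const_mul (r ^ 2))
  have hM4 := hM3.congr_of_eventuallyEq
    (f₁ := fun ρ : ℝ => metricCoord (modelM d) D.metric p₀
      ((t, z, y) + ρ • ((0 : ℝ), w, (0 : ℝ))) (r, r • v, ℓ) (r, r • v, ℓ)) ?_
  · rw [hM2.unique hM4]
    simp only [zero_smul, add_zero]
    ring
  · filter_upwards [hev] with ρ hρ
    have e : (t, z, y) + ρ • ((0 : ℝ), w, (0 : ℝ)) = (t, z + ρ • w, y) := by simp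
    rw [e, D.metricCoord_metric p₀ hρ]
    simp only [map_smul, smul_apply, smul_eq_mul]
    ring

/-- The spatial derivatives of `g(x', x')` at a lightlike vector are proportional to those of the
classical Lagrangian. -/
theorem fderiv_metricCoord_spatial (hT : IsOpen T)
    (hz : z ∈ (extChartAt (𝓡 d) p₀.2.1).target) (ht : t ∈ T) (y r : ℝ) :
    fderiv ℝ (fun Z => metricCoord (modelM d) D.metric p₀ Z
      (r, r • v, r * lagrangianCoord (𝓡 d) D.lagrangian p₀.2.1 t z v)
      (r, r • v, r * lagrangianCoord (𝓡 d) D.lagrangian p₀.2.1 t z v)) (t, z, y) (0, w, 0)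
      = 2 * D.cψ p₀.2.1 t z * r ^ 2 *
        fderiv ℝ (fun z => lagrangianCoord (𝓡 d) D.lagrangian p₀.2.1 t z v) z w := by
  -- Since g(x', x') = 2ψr(rL − ℓ), its derivative is 2ψr² ∂L + 2rψ'(rL − ℓ), and the last term is
  -- zero for ℓ = rL. The algebra below confirms this.
  obtain ⟨ψ', U', B', A', hψ, hU, hB, hA⟩ := D.exists_hasDerivAt_line hT hz ht v w
  rw [D.fderiv_metricCoord_position hT hz ht y r _ hψ hU hB hA,
    D.fderiv_lagrangianCoord_position hT hz ht hψ hU hB hA, D.lagrangianCoord_eq]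
  have hψ0 : D.cψ p₀.2.1 t z ≠ 0 := (D.cψ_pos ht).ne'
  field_simp
  ring

end Data

end

/-! ### Changes of parameter and the spatial equations of a light lift. -/

section

section Reparametrization

variable {t₀ t₁ s₀ s₁ : ℝ} {τ τ' k : ℝ → ℝ}

/-- A barrier argument: wherever `τ` touches the level `t₀` it is strictly increasing, so it cannot
cross downwards. Positivity is asked only on that level because ψ is known to be positive only at
times in `T`, and the values of `τ` are not yet known to lie there. -/
theorem le_of_hasDerivWithinAt_pos (hτ : ∀ s ∈ Icc s₀ s₁, HasDerivWithinAt τ (τ' s) (Icc s₀ s₁) s)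
    (h₀ : t₀ ≤ τ s₀) (hpos : ∀ s ∈ Icc s₀ s₁, τ s = t₀ → 0 < τ' s) :
    ∀ s ∈ Icc s₀ s₁, t₀ ≤ τ s := by
  intro s hs
  have h := image_le_of_deriv_right_lt_deriv_boundary (f := fun s => -τ s) (f' := fun s => -τ' s)
    (B := fun _ => -t₀) (B' := fun _ => 0) (a := s₀) (b := s₁)
    (fun s hs => (hτ s hs).continuousWithinAt.neg)
    (fun s hs => ((hτ s (Ico_subset_Icc_self hs)).mono_of_mem_nhdsWithin
      (Icc_mem_nhdsGE_of_mem hs)).neg) (neg_le_neg h₀)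
    (fun _ => hasDerivAt_const _ _)
    (fun s hs he => neg_lt_zero.2 (hpos s (Ico_subset_Icc_self hs) (neg_inj.1 he))) hs
  exact neg_le_neg_iff.1 h

/-- A function whose derivative is positive where it takes the values `t₀` and `t₁` stays in
`[t₀, t₁]` if its initial and final values are there. -/
theorem mapsTo_Icc_of_hasDerivWithinAt_pos
    (hτ : ∀ s ∈ Icc s₀ s₁, HasDerivWithinAt τ (τ' s) (Icc s₀ s₁) s)
    (h₀ : τ s₀ = t₀) (h₁ : τ s₁ = t₁)
    (hpos : ∀ s ∈ Icc s₀ s₁, τ s = t₀ ∨ τ s = t₁ → 0 < τ' s) :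
    MapsTo τ (Icc s₀ s₁) (Icc t₀ t₁) := by
  intro s hs
  refine ⟨le_of_hasDerivWithinAt_pos hτ h₀.ge (fun s hs he => hpos s hs (Or.inl he)) s hs, ?_⟩
  -- The upper bound is the lower bound for the reflected function −τ(−s).
  have hneg : ∀ x ∈ Icc (-s₁) (-s₀), -x ∈ Icc s₀ s₁ :=
    fun x hx => ⟨le_neg_of_le_neg hx.2, neg_le_of_neg_le hx.1⟩
  have h := le_of_hasDerivWithinAt_pos (τ := fun s => -τ (-s)) (τ' := fun s => τ' (-s))
    (t₀ := -t₁) (s₀ := -s₁) (s₁ := -s₀) (fun x hx => ?_) (by simp [h₁])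
    (fun x hx he => hpos _ (hneg x hx) (Or.inr (neg_inj.1 he))) (-s)
    ⟨neg_le_neg hs.2, neg_le_neg hs.1⟩
  · simpa using h
  · have : HasDerivWithinAt (fun s => -τ (-s)) (-((-1 : ℝ) • τ' (-x))) (Icc (-s₁) (-s₀)) x :=
      ((hτ (-x) (hneg x hx)).scomp x (hasDerivAt_neg x).hasDerivWithinAt
        (fun y hy => hneg y hy)).neg
    simpa using this

/-- The inverse of a change of parameter solving an autonomous equation. -/
theorem exists_inverse_reparametrization (hs : s₀ ≤ s₁) (hk : ContinuousOn k (Icc t₀ t₁))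
    (hkpos : ∀ t ∈ Icc t₀ t₁, 0 < k t)
    (hτ : ∀ s ∈ Icc s₀ s₁, HasDerivWithinAt τ (1 / k (τ s)) (Icc s₀ s₁) s)
    (h₀ : τ s₀ = t₀) (h₁ : τ s₁ = t₁) (hm : MapsTo τ (Icc s₀ s₁) (Icc t₀ t₁)) :
    ∃ σ : ℝ → ℝ, MapsTo σ (Icc t₀ t₁) (Icc s₀ s₁) ∧ ∀ t ∈ Icc t₀ t₁, τ (σ t) = t ∧
      HasDerivWithinAt σ (k t) (Icc t₀ t₁) t := by
  -- The inverse must have derivative `k`. That this primitive is a left inverse follows because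
  -- σ(τ(s)) − s has zero derivative and vanishes at `s₀`; surjectivity of `τ`, by the intermediate
  -- value theorem, makes it a right inverse.
  set σ : ℝ → ℝ := fun t => s₀ + ∫ x in t₀..t, k x with hσ
  have hσ' : ∀ t ∈ Icc t₀ t₁, HasDerivWithinAt σ (k t) (Icc t₀ t₁) t :=
    fun t ht => (hasDerivWithinAt_integral_Icc hk ht).const_add s₀
  have hleft : ∀ s ∈ Icc s₀ s₁, σ (τ s) = s := by
    have hd : ∀ s ∈ Icc s₀ s₁, HasDerivWithinAt (fun s => σ (τ s) - s) 0 (Icc s₀ s₁) s := by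
      intro s hs
      have h1 := ((hσ' _ (hm hs)).comp s (hτ s hs) hm).sub (hasDerivWithinAt_id s _)
      rwa [mul_one_div_cancel (hkpos _ (hm hs)).ne', sub_self] at h1
    intro s hs
    have h2 := constant_of_has_deriv_right_zero (f := fun s => σ (τ s) - s) (a := s₀) (b := s₁)
      (fun s hs => (hd s hs).continuousWithinAt)
      (fun s hs => (hd s (Ico_subset_Icc_self hs)).mono_of_mem_nhdsWithin
        (Icc_mem_nhdsGE_of_mem hs)) s hs
    have h3 : σ (τ s₀) = s₀ := by simp [hσ, h₀]
    simp only [h3, sub_self] at h2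
    linarith
  have hsurj : Icc t₀ t₁ ⊆ τ '' Icc s₀ s₁ := by
    have := intermediate_value_Icc hs (fun s hs => (hτ s hs).continuousWithinAt)
    rwa [h₀, h₁] at this
  refine ⟨σ, fun t ht => ?_, fun t ht => ⟨?_, hσ' t ht⟩⟩
  · obtain ⟨s, hs, rfl⟩ := hsurj ht
    rwa [hleft s hs]
  · obtain ⟨s, hs, rfl⟩ := hsurj ht
    rw [hleft s hs]

/-- A change of parameter with prescribed positive velocity exists. -/
theorem exists_reparametrization (h : t₀ < t₁) (hk : ContinuousOn k (Icc t₀ t₁))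
    (hkpos : ∀ t ∈ Icc t₀ t₁, 0 < k t) :
    ∃ (s₁ : ℝ) (τ : ℝ → ℝ), 0 < s₁ ∧ τ 0 = t₀ ∧ τ s₁ = t₁ ∧
      MapsTo τ (Icc 0 s₁) (Icc t₀ t₁) ∧
      ∀ s ∈ Icc 0 s₁, HasDerivWithinAt τ (1 / k (τ s)) (Icc 0 s₁) s := by
  set K : ℝ → ℝ := IccExtend h.le (domRestrict (Icc t₀ t₁) k) with hK
  have hKc : Continuous K := (continuousOn_iff_continuous_domRestrict.1 hk).Icc_extend'
  have hKk : ∀ t ∈ Icc t₀ t₁, K t = k t := fun x hx => IccExtend_of_mem h.le _ hx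
  -- The minimum of `k` bounds its extension below by a positive constant, so the primitive σ grows
  -- at least linearly and is an increasing bijection of the line. The wanted `τ` is its inverse.
  obtain ⟨m, hm, hmK⟩ : ∃ m > 0, ∀ x, m ≤ K x := by
    obtain ⟨c, hc, hmin⟩ := isCompact_Icc.exists_isMinOn (nonempty_Icc.2 h.le) hk
    exact ⟨k c, hkpos c hc, fun x => hmin (projIcc t₀ t₁ h.le x).2⟩
  set σ : ℝ → ℝ := fun u => ∫ x in t₀..u, K x with hσ
  have hσ' : ∀ u, HasDerivAt σ (K u) u := fun u =>
    intervalIntegral.integral_hasDerivAt_right (hKc.intervalIntegrable _ _)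
      (hKc.stronglyMeasurableAtFilter _ _) hKc.continuousAt
  have hσd : Differentiable ℝ σ := fun u => (hσ' u).differentiableAt
  have hσ0 : σ t₀ = 0 := by simp [hσ]
  have hmono : StrictMono σ :=
    strictMono_of_deriv_pos fun u => (hm.trans_le (hmK u)).trans_eq (hσ' u).deriv.symm
  have hgrow := mul_sub_le_image_sub_of_le_deriv hσd (C := m)
    (fun u => (hmK u).trans_eq (hσ' u).deriv.symm)
  have hsurj : Function.Surjective σ := by
    intro y
    have hy : 0 ≤ |y| / m := by positivity
    refine mem_range_of_exists_le_of_exists_ge hσd.continuous ⟨t₀ - |y| / m, ?_⟩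
      ⟨t₀ + |y| / m, ?_⟩
    · have := hgrow (sub_le_self t₀ hy)
      rw [hσ0, sub_sub_cancel, mul_div_cancel₀ _ hm.ne'] at this
      linarith [neg_abs_le y]
    · have := hgrow (le_add_of_nonneg_right hy : t₀ ≤ t₀ + |y| / m)
      rw [hσ0, add_sub_cancel_left, mul_div_cancel₀ _ hm.ne'] at this
      linarith [le_abs_self y]
  set e : ℝ ≃o ℝ := hmono.orderIsoOfSurjective σ hsurj with he
  have hes : ∀ s, σ (e.symm s) = s := fun s => e.apply_symm_apply s
  have hse : ∀ t, e.symm (σ t) = t := fun t => e.symm_apply_apply t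
  have hmaps : MapsTo e.symm (Icc 0 (σ t₁)) (Icc t₀ t₁) := by
    intro s hs
    constructor
    · rw [← hse t₀, hσ0]
      exact e.symm.monotone hs.1
    · rw [← hse t₁]
      exact e.symm.monotone hs.2
  refine ⟨σ t₁, e.symm, ?_, ?_, hse t₁, hmaps, fun s hs => ?_⟩
  · rw [← hσ0]
    exact hmono h
  · rw [← hσ0, hse]
  · rw [← hKk _ (hmaps hs), one_div]
    exact (HasDerivAt.of_local_left_inverse e.symm.continuous.continuousAt (hσ' (e.symm s))
      (hm.trans_le (hmK _)).ne' (Filter.Eventually.of_forall hes)).hasDerivWithinAt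

end Reparametrization

variable {d : ℕ} {T : Set ℝ} {S : Type*} [TopologicalSpace S]
  [ChartedSpace (ModelS d) S] [IsManifold (𝓡 d) 2 S]

namespace Data

variable (D : Data d T S) {t₀ t₁ : ℝ} {q : ℝ → S}

/-- The momentum of the classical Lagrangian along a curve, in the chart around `x₀`. -/
def momentum (t₀ t₁ : ℝ) (q : ℝ → S) (x₀ : S) (w : ModelS d) (t : ℝ) : ℝ :=
  fderiv ℝ (fun v => lagrangianCoord (𝓡 d) D.lagrangian x₀ t (chartCurve (𝓡 d) x₀ q t) v)
    (derivWithin (chartCurve (𝓡 d) x₀ q) (Icc t₀ t₁) t) w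

/-- The force of the classical Lagrangian along a curve, in the chart around `x₀`. -/
def force (t₀ t₁ : ℝ) (q : ℝ → S) (x₀ : S) (w : ModelS d) (t : ℝ) : ℝ :=
  fderiv ℝ (fun z => lagrangianCoord (𝓡 d) D.lagrangian x₀ t z
    (derivWithin (chartCurve (𝓡 d) x₀ q) (Icc t₀ t₁) t)) (chartCurve (𝓡 d) x₀ q t) w

theorem satisfiesEulerLagrange_iff :
    SatisfiesEulerLagrange (𝓡 d) D.lagrangian univ (Icc t₀ t₁) q ↔
      ∀ t ∈ Icc t₀ t₁, ∀ w, HasDerivWithinAt (D.momentum t₀ t₁ q (q t) w)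
        (D.force t₀ t₁ q (q t) w t) (Icc t₀ t₁) t :=
  ⟨fun H t ht w => H t ht w (mem_univ w), fun H t ht w _ => H t ht w⟩

theorem cψ_chartCurve {x₀ : S} {t : ℝ} (hx : q t ∈ (extChartAt (𝓡 d) x₀).source) :
    D.cψ x₀ t (chartCurve (𝓡 d) x₀ q t) = D.ψ t (q t) := by
  rw [cψ, chartCurve, (extChartAt (𝓡 d) x₀).left_inv hx]

variable (h : t₀ < t₁)
  (hT : IsOpen T) (hJ : Icc t₀ t₁ ⊆ T) (hq : ContMDiffOn 𝓘(ℝ, ℝ) (𝓡 d) 1 q (Icc t₀ t₁))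
  {J : Set ℝ} {τ τ' : ℝ → ℝ} (p₀ : ℝ × S × ℝ) (y₀ : ℝ) {s : ℝ}
  (hJu : UniqueDiffOn ℝ J) (hm : MapsTo τ J (Icc t₀ t₁))
  (hτ : ∀ s ∈ J, HasDerivWithinAt τ (τ' s) J s)
include h hT hJ hq

omit h hT in
theorem continuousOn_ψ : ContinuousOn (fun t => D.ψ t (q t)) (Icc t₀ t₁) :=
  D.ψ_contMDiffOn.continuousOn.comp (continuousOn_id.prodMk hq.continuousOn)
    fun _ ht => ⟨hJ ht, mem_univ _⟩

include hJu hm hτ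

theorem derivWithin_chartCurve_lightLift (hs : s ∈ J)
    (hx : q (τ s) ∈ (extChartAt (𝓡 d) p₀.2.1).source) :
    derivWithin (chartCurve (modelM d) p₀ (D.lightLift t₀ t₁ q y₀ ∘ τ)) J s
      = (τ' s, τ' s • derivWithin (chartCurve (𝓡 d) p₀.2.1 q) (Icc t₀ t₁) (τ s),
        τ' s * lagrangianCoord (𝓡 d) D.lagrangian p₀.2.1 (τ s) (chartCurve (𝓡 d) p₀.2.1 q (τ s))
          (derivWithin (chartCurve (𝓡 d) p₀.2.1 q) (Icc t₀ t₁) (τ s))) :=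
  (D.hasDerivWithinAt_chartCurve_lightLift h hT hJ hq p₀ y₀ hs hm (hτ s hs) hx).derivWithin
    (hJu s hs)

theorem metricCoord_lightLift_spatial (hs : s ∈ J)
    (hx : q (τ s) ∈ (extChartAt (𝓡 d) p₀.2.1).source) (w : ModelS d) :
    metricCoord (modelM d) D.metric p₀
        (chartCurve (modelM d) p₀ (D.lightLift t₀ t₁ q y₀ ∘ τ) s)
        (derivWithin (chartCurve (modelM d) p₀ (D.lightLift t₀ t₁ q y₀ ∘ τ)) J s) (0, w, 0)
      = D.ψ (τ s) (q (τ s)) * τ' s * D.momentum t₀ t₁ q p₀.2.1 w (τ s) := by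
  rw [D.derivWithin_chartCurve_lightLift h hT hJ hq p₀ y₀ hJu hm hτ hs hx, chartCurve_spacetime,
    ← D.cψ_chartCurve hx]
  exact D.metricCoord_spatial ((extChartAt (𝓡 d) p₀.2.1).map_source hx) (hJ (hm hs)) _ _ _

theorem fderiv_metricCoord_lightLift_spatial (hs : s ∈ J)
    (hx : q (τ s) ∈ (extChartAt (𝓡 d) p₀.2.1).source) (w : ModelS d) :
    fderiv ℝ (fun Z => metricCoord (modelM d) D.metric p₀ Z
        (derivWithin (chartCurve (modelM d) p₀ (D.lightLift t₀ t₁ q y₀ ∘ τ)) J s)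
        (derivWithin (chartCurve (modelM d) p₀ (D.lightLift t₀ t₁ q y₀ ∘ τ)) J s))
        (chartCurve (modelM d) p₀ (D.lightLift t₀ t₁ q y₀ ∘ τ) s) (0, w, 0)
      = 2 * D.ψ (τ s) (q (τ s)) * τ' s ^ 2 * D.force t₀ t₁ q p₀.2.1 w (τ s) := by
  rw [D.derivWithin_chartCurve_lightLift h hT hJ hq p₀ y₀ hJu hm hτ hs hx, chartCurve_spacetime,
    ← D.cψ_chartCurve hx]
  exact D.fderiv_metricCoord_spatial hT ((extChartAt (𝓡 d) p₀.2.1).map_source hx)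
    (hJ (hm hs)) _ _

/-- If `ψ dt/ds` is constant, then the spatial components of the Euler-Lagrange equations of the
metric are those of the classical Lagrangian. -/
theorem spatial_eulerLagrange_iff {μ : ℝ} (hμ : μ ≠ 0)
    (hμτ : ∀ s ∈ J, D.ψ (τ s) (q (τ s)) * τ' s = μ) (hs : s ∈ J) (w : ModelS d) {a f : ℝ}
    (ha : a ≠ 0) (hf : f = a * μ * (τ' s * D.force t₀ t₁ q (q (τ s)) w (τ s))) :
    HasDerivWithinAt (fun σ => a *
      metricCoord (modelM d) D.metric (D.lightLift t₀ t₁ q y₀ (τ s))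
        (chartCurve (modelM d) (D.lightLift t₀ t₁ q y₀ (τ s)) (D.lightLift t₀ t₁ q y₀ ∘ τ) σ)
        (derivWithin (chartCurve (modelM d) (D.lightLift t₀ t₁ q y₀ (τ s))
          (D.lightLift t₀ t₁ q y₀ ∘ τ)) J σ) (0, w, 0)) f J s ↔
    HasDerivWithinAt (D.momentum t₀ t₁ q (q (τ s)) w ∘ τ)
      (τ' s * D.force t₀ t₁ q (q (τ s)) w (τ s)) J s := by
  have hx : q (τ s) ∈ (extChartAt (𝓡 d) (q (τ s))).source := mem_extChartAt_source _
  -- The factor `a` lets one equivalence serve twice: `a = -2` for the Euler-Lagrange equations of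
  -- −g(x', x') and `a = 1` for the geodesic equation.
  have key : ∀ σ ∈ J, q (τ σ) ∈ (extChartAt (𝓡 d) (q (τ s))).source →
      a * metricCoord (modelM d) D.metric (D.lightLift t₀ t₁ q y₀ (τ s))
        (chartCurve (modelM d) (D.lightLift t₀ t₁ q y₀ (τ s)) (D.lightLift t₀ t₁ q y₀ ∘ τ) σ)
        (derivWithin (chartCurve (modelM d) (D.lightLift t₀ t₁ q y₀ (τ s))
          (D.lightLift t₀ t₁ q y₀ ∘ τ)) J σ) (0, w, 0)
        = a * μ * (D.momentum t₀ t₁ q (q (τ s)) w ∘ τ) σ := by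
    intro σ hσ hxσ
    rw [D.metricCoord_lightLift_spatial h hT hJ hq _ y₀ hJu hm hτ hσ hxσ, hμτ σ hσ, mul_assoc]
    rfl
  have hev : ∀ᶠ σ in 𝓝[J] s, q (τ σ) ∈ (extChartAt (𝓡 d) (q (τ s))).source :=
    ((hτ s hs).continuousWithinAt.tendsto_nhdsWithin hm).eventually
      (eventually_mem_source hq (hm hs) hx)
  have hevEq := (hev.and self_mem_nhdsWithin).mono fun σ hσ => key σ hσ.2 hσ.1
  rw [hf, Filter.EventuallyEq.hasDerivWithinAt_iff hevEq (key s hs hx)]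
  refine ⟨fun H => ?_, fun H => H.const_mul (a * μ)⟩
  have := H.const_mul (a * μ)⁻¹
  simpa only [inv_mul_cancel_left₀ (mul_ne_zero ha hμ)] using this

end Data

end

/-! ### The 0-Euler-Lagrange equations. -/

section

variable {d : ℕ} {T : Set ℝ} {S : Type*} [TopologicalSpace S]
  [ChartedSpace (ModelS d) S] [IsManifold (𝓡 d) 2 S]

namespace Data

variable (D : Data d T S) {t₀ t₁ : ℝ} {q : ℝ → S} (h : t₀ < t₁)
  (hT : IsOpen T) (hJ : Icc t₀ t₁ ⊆ T) (hq : ContMDiffOn 𝓘(ℝ, ℝ) (𝓡 d) 1 q (Icc t₀ t₁))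

include hJ in
theorem ψ_curve_pos {t : ℝ} (ht : t ∈ Icc t₀ t₁) : 0 < D.ψ t (q t) := D.ψ_pos t (hJ ht) _

include h hT hJ hq

/-- The spatial components of the Euler-Lagrange equations of `-g(x', x')` along a light lift
parametrized so that `2 ψ dt/ds` is constant. -/
theorem satisfiesEulerLagrange_geodesicLagrangian_iff {s₀ s₁ μ : ℝ} (y₀ : ℝ) {τ : ℝ → ℝ}
    (hs : s₀ < s₁) (hμ : 0 < μ) (hm : MapsTo τ (Icc s₀ s₁) (Icc t₀ t₁))
    (hτ : ∀ s ∈ Icc s₀ s₁,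
      HasDerivWithinAt τ (μ / (2 * D.ψ (τ s) (q (τ s)))) (Icc s₀ s₁) s) :
    SatisfiesEulerLagrange (modelM d) D.geodesicLagrangian
      {w : ℝ × ModelS d × ℝ | w.1 = 0 ∧ w.2.2 = 0}
      (Icc s₀ s₁) (D.lightLift t₀ t₁ q y₀ ∘ τ) ↔
    ∀ s ∈ Icc s₀ s₁, ∀ w, HasDerivWithinAt (D.momentum t₀ t₁ q (q (τ s)) w ∘ τ)
      (μ / (2 * D.ψ (τ s) (q (τ s))) * D.force t₀ t₁ q (q (τ s)) w (τ s)) (Icc s₀ s₁) s := by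
  set τ' : ℝ → ℝ := fun s => μ / (2 * D.ψ (τ s) (q (τ s))) with hτ'
  have hJu := uniqueDiffOn_Icc hs
  have hμτ : ∀ s ∈ Icc s₀ s₁, D.ψ (τ s) (q (τ s)) * τ' s = μ / 2 := by
    intro s hs
    have := (D.ψ_curve_pos (q := q) hJ (hm hs)).ne'
    simp only [hτ']
    field_simp
  have key : ∀ s ∈ Icc s₀ s₁, ∀ w : ModelS d,
      HasDerivWithinAt
        (fun σ => fderiv ℝ (fun V => lagrangianCoord (modelM d) D.geodesicLagrangian
            (D.lightLift t₀ t₁ q y₀ (τ s)) σ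
            (chartCurve (modelM d) (D.lightLift t₀ t₁ q y₀ (τ s))
              (D.lightLift t₀ t₁ q y₀ ∘ τ) σ) V)
          (derivWithin (chartCurve (modelM d) (D.lightLift t₀ t₁ q y₀ (τ s))
            (D.lightLift t₀ t₁ q y₀ ∘ τ)) (Icc s₀ s₁) σ) (0, w, 0))
        (fderiv ℝ (fun Z => lagrangianCoord (modelM d) D.geodesicLagrangian
            (D.lightLift t₀ t₁ q y₀ (τ s)) s Z
            (derivWithin (chartCurve (modelM d) (D.lightLift t₀ t₁ q y₀ (τ s))
              (D.lightLift t₀ t₁ q y₀ ∘ τ)) (Icc s₀ s₁) s))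
          (chartCurve (modelM d) (D.lightLift t₀ t₁ q y₀ (τ s))
            (D.lightLift t₀ t₁ q y₀ ∘ τ) s) (0, w, 0)) (Icc s₀ s₁) s ↔
      HasDerivWithinAt (D.momentum t₀ t₁ q (q (τ s)) w ∘ τ)
        (τ' s * D.force t₀ t₁ q (q (τ s)) w (τ s)) (Icc s₀ s₁) s := by
    intro s hsJ w
    have hx : q (τ s) ∈ (extChartAt (𝓡 d) (q (τ s))).source := mem_extChartAt_source _
    have hforce : fderiv ℝ (fun Z => lagrangianCoord (modelM d) D.geodesicLagrangian
            (D.lightLift t₀ t₁ q y₀ (τ s)) s Z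
            (derivWithin (chartCurve (modelM d) (D.lightLift t₀ t₁ q y₀ (τ s))
              (D.lightLift t₀ t₁ q y₀ ∘ τ)) (Icc s₀ s₁) s))
          (chartCurve (modelM d) (D.lightLift t₀ t₁ q y₀ (τ s))
            (D.lightLift t₀ t₁ q y₀ ∘ τ) s) (0, w, 0)
        = -2 * (μ / 2) * (τ' s * D.force t₀ t₁ q (q (τ s)) w (τ s)) := by
      have h1 := D.fderiv_metricCoord_lightLift_spatial h hT hJ hq
        (D.lightLift t₀ t₁ q y₀ (τ s)) y₀ hJu hm hτ hsJ hx w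
      change fderiv ℝ (fun Z => -metricCoord (modelM d) D.metric
        (D.lightLift t₀ t₁ q y₀ (τ s)) Z _ _) _ _ = _
      rw [fderiv_fun_neg, neg_apply, h1, ← hμτ s hsJ]
      change -(2 * _ * τ' s ^ 2 * D.force t₀ t₁ q (q (τ s)) w (τ s)) = _
      ring
    rw [← D.spatial_eulerLagrange_iff h hT hJ hq y₀ hJu hm hτ (half_pos hμ).ne' hμτ hsJ w
      (a := -2) (by norm_num) hforce]
    have hmom : ∀ σ ∈ Icc s₀ s₁, q (τ σ) ∈ (extChartAt (𝓡 d) (q (τ s))).source →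
        fderiv ℝ (fun V => lagrangianCoord (modelM d) D.geodesicLagrangian
            (D.lightLift t₀ t₁ q y₀ (τ s)) σ
            (chartCurve (modelM d) (D.lightLift t₀ t₁ q y₀ (τ s))
              (D.lightLift t₀ t₁ q y₀ ∘ τ) σ) V)
          (derivWithin (chartCurve (modelM d) (D.lightLift t₀ t₁ q y₀ (τ s))
            (D.lightLift t₀ t₁ q y₀ ∘ τ)) (Icc s₀ s₁) σ) (0, w, 0)
        = -2 * metricCoord (modelM d) D.metric (D.lightLift t₀ t₁ q y₀ (τ s))
            (chartCurve (modelM d) (D.lightLift t₀ t₁ q y₀ (τ s))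
              (D.lightLift t₀ t₁ q y₀ ∘ τ) σ)
            (derivWithin (chartCurve (modelM d) (D.lightLift t₀ t₁ q y₀ (τ s))
              (D.lightLift t₀ t₁ q y₀ ∘ τ)) (Icc s₀ s₁) σ) (0, w, 0) := by
      intro σ hσ hxσ
      rw [chartCurve_spacetime]
      exact D.fderiv_geodesicLagrangianCoord_velocity (hJ (hm hσ))
        ((extChartAt (𝓡 d) (q (τ s))).map_source hxσ) σ
    have hev : ∀ᶠ σ in 𝓝[Icc s₀ s₁] s, q (τ σ) ∈ (extChartAt (𝓡 d) (q (τ s))).source :=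
      ((hτ s hsJ).continuousWithinAt.tendsto_nhdsWithin hm).eventually
        (eventually_mem_source hq (hm hsJ) hx)
    exact Filter.EventuallyEq.hasDerivWithinAt_iff
      ((hev.and self_mem_nhdsWithin).mono fun σ hσ => hmom σ hσ.2 hσ.1) (hmom s hsJ hx)
  constructor
  · intro H s hsJ w
    exact (key s hsJ w).1 (H s hsJ (0, w, 0) ⟨rfl, rfl⟩)
  · rintro H s hsJ ⟨_, w, _⟩ ⟨rfl, rfl⟩
    exact (key s hsJ w).2 (H s hsJ w)

omit h hT in
/-- Spatial equations with respect to a solution of `2 ψ dt/ds = μ` give the Euler-Lagrange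
equations with respect to `t`. -/
theorem satisfiesEulerLagrange_of_comp {s₀ s₁ μ : ℝ} {τ : ℝ → ℝ}
    (hs : s₀ < s₁) (hμ : 0 < μ) (hm : MapsTo τ (Icc s₀ s₁) (Icc t₀ t₁))
    (h₀ : τ s₀ = t₀) (h₁ : τ s₁ = t₁)
    (hτ : ∀ s ∈ Icc s₀ s₁,
      HasDerivWithinAt τ (μ / (2 * D.ψ (τ s) (q (τ s)))) (Icc s₀ s₁) s)
    (H : ∀ s ∈ Icc s₀ s₁, ∀ w, HasDerivWithinAt (D.momentum t₀ t₁ q (q (τ s)) w ∘ τ)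
      (μ / (2 * D.ψ (τ s) (q (τ s))) * D.force t₀ t₁ q (q (τ s)) w (τ s)) (Icc s₀ s₁) s) :
    SatisfiesEulerLagrange (𝓡 d) D.lagrangian univ (Icc t₀ t₁) q := by
  rw [satisfiesEulerLagrange_iff]
  -- Here `k` is ds/dt; composing the equations in s with the inverse change of parameter multiplies
  -- the force by 2ψ/μ, which cancels the factor μ/(2ψ).
  obtain ⟨σ, hσm, hσ⟩ := exists_inverse_reparametrization (k := fun t => 2 * D.ψ t (q t) / μ)
    hs.le ((continuousOn_const.mul (D.continuousOn_ψ hJ hq)).div_const μ)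
    (fun t ht => div_pos (mul_pos two_pos (D.ψ_curve_pos hJ ht)) hμ)
    (fun s hs => by simpa only [one_div_div] using hτ s hs) h₀ h₁ hm
  intro t ht w
  obtain ⟨hτσ, hσ'⟩ := hσ t ht
  have h2 := (H (σ t) (hσm ht) w).scomp t hσ' hσm
  rw [hτσ] at h2
  have hψ := (D.ψ_curve_pos (q := q) hJ ht).ne'
  have e : (2 * D.ψ t (q t) / μ) • (μ / (2 * D.ψ t (q t)) * D.force t₀ t₁ q (q t) w t)
      = D.force t₀ t₁ q (q t) w t := by
    rw [smul_eq_mul]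
    field_simp
  rw [e] at h2
  refine h2.congr (fun t' ht' => ?_) ?_
  · simp only [Function.comp, (hσ t' ht').1]
  · simp only [Function.comp, hτσ]

/-- The constants μ and y₀ have no influence: the equations in s turn into those in t for any
values, and in the converse μ = 1 and y₀ = 0 are chosen. -/
theorem satisfiesZeroEulerLagrange_iff :
    D.SatisfiesZeroEulerLagrange t₀ t₁ q ↔
      SatisfiesEulerLagrange (𝓡 d) D.lagrangian univ (Icc t₀ t₁) q := by
  constructor
  · rintro ⟨s₀, s₁, μ, y₀, τ, hs, hμ, h₀, h₁, hτ, H⟩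
    have hm : MapsTo τ (Icc s₀ s₁) (Icc t₀ t₁) := by
      -- The sign of the prescribed derivative is known only where the value of `τ` is in `T`; at
      -- the two boundary levels it is, and this suffices.
      refine mapsTo_Icc_of_hasDerivWithinAt_pos hτ h₀ h₁ fun s hs he => ?_
      have hmem : τ s ∈ Icc t₀ t₁ := by
        rcases he with he | he <;> rw [he]
        exacts [left_mem_Icc.2 h.le, right_mem_Icc.2 h.le]
      exact div_pos hμ (mul_pos two_pos (D.ψ_curve_pos hJ hmem))
    exact D.satisfiesEulerLagrange_of_comp hJ hq hs hμ hm h₀ h₁ hτ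
      ((D.satisfiesEulerLagrange_geodesicLagrangian_iff h hT hJ hq y₀ hs hμ hm hτ).1 H)
  · intro H
    rw [satisfiesEulerLagrange_iff] at H
    -- The division by 1 keeps the form 2ψ/μ, whose reciprocal is literally μ/(2ψ) with μ = 1.
    obtain ⟨s₁, τ, hs, h₀, h₁, hm, hτ⟩ := exists_reparametrization
      (k := fun t => 2 * D.ψ t (q t) / 1) h
      ((continuousOn_const.mul (D.continuousOn_ψ hJ hq)).div_const 1)
      (fun t ht => div_pos (mul_pos two_pos (D.ψ_curve_pos hJ ht)) one_pos)
    simp only [one_div_div] at hτ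
    refine ⟨0, s₁, 1, 0, τ, hs, one_pos, h₀, h₁, hτ, ?_⟩
    rw [D.satisfiesEulerLagrange_geodesicLagrangian_iff h hT hJ hq 0 hs one_pos hm hτ]
    intro s hs w
    exact (H (τ s) (hm hs) w).scomp s (hτ s hs) hm

end Data

end

/-! ### Differentiation under the integral sign and the du Bois-Reymond lemma. -/

section

section Calculus

/-- Localizes to one chart. The piece is a nondegenerate interval, over which one can integrate, and
a relative neighbourhood, so that derivatives within it are derivatives within `[a, b]`, also at the
endpoints. -/
theorem exists_Icc_subset_of_mem_nhdsWithin {a b t : ℝ} (hab : a < b) (ht : t ∈ Icc a b)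
    {V : Set ℝ} (hV : V ∈ 𝓝[Icc a b] t) :
    ∃ α β, α < β ∧ t ∈ Icc α β ∧ Icc α β ⊆ Icc a b ∧ Icc α β ⊆ V ∧ Icc α β ∈ 𝓝[Icc a b] t := by
  obtain ⟨ε, hε, hsub⟩ := Metric.mem_nhdsWithin_iff.1 hV
  refine ⟨max a (t - ε / 2), min b (t + ε / 2), ?_, ⟨?_, ?_⟩, ?_, ?_, ?_⟩
  · rcases ht with ⟨h1, h2⟩
    rw [max_lt_iff, lt_min_iff, lt_min_iff]
    refine ⟨⟨hab, ?_⟩, ?_, ?_⟩ <;> linarith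
  · exact max_le ht.1 (by linarith)
  · exact le_min ht.2 (by linarith)
  · exact Icc_subset_Icc (le_max_left _ _) (min_le_left _ _)
  · intro x hx
    refine hsub ⟨?_, (le_max_left _ _).trans hx.1, hx.2.trans (min_le_left _ _)⟩
    have h1 := (le_max_right _ _).trans hx.1
    have h2 := hx.2.trans (min_le_right _ _)
    rw [Metric.mem_ball, Real.dist_eq, abs_lt]
    constructor <;> linarith
  · have : Icc (t - ε / 2) (t + ε / 2) ∈ 𝓝 t := Icc_mem_nhds (by linarith) (by linarith)
    filter_upwards [mem_nhdsWithin_of_mem_nhds this, self_mem_nhdsWithin] with x h1 h2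
    exact ⟨max_le h2.1 h1.1, le_min h2.2 h1.2⟩

variable {F : Type*} [NormedAddCommGroup F] [NormedSpace ℝ F]

/-- Differentiation under the integral sign, from local continuity of the derivative. -/
theorem hasDerivAt_integral_of_locally {a b : ℝ} (hab : a ≤ b) {f f' : ℝ → ℝ → F}
    (hloc : ∀ t ∈ Icc a b, ∃ ρ > 0, ∃ V ∈ 𝓝[Icc a b] t,
      ContinuousOn (fun p : ℝ × ℝ => f p.1 p.2) (Ioo (-ρ) ρ ×ˢ V) ∧
      ContinuousOn (fun p : ℝ × ℝ => f' p.1 p.2) (Ioo (-ρ) ρ ×ˢ V) ∧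
      ∀ p ∈ Ioo (-ρ) ρ ×ˢ V, HasDerivAt (fun r => f r p.2) (f' p.1 p.2) p.1) :
    ContinuousOn (f' 0) (Icc a b) ∧
      HasDerivAt (fun r => ∫ t in a..b, f r t) (∫ t in a..b, f' 0 t) 0 := by
  have hW : ∀ (ρ : ℝ), 0 < ρ → ∀ t, ∀ V ∈ 𝓝[Icc a b] t,
      Ioo (-ρ) ρ ×ˢ V ∈ 𝓝[univ ×ˢ Icc a b] ((0 : ℝ), t) := by
    intro ρ hρ t V hV
    rw [nhdsWithin_prod_eq, nhdsWithin_univ]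
    exact Filter.prod_mem_prod (Ioo_mem_nhds (neg_lt_zero.2 hρ) hρ) hV
  have hcont : ContinuousOn (f' 0) (Icc a b) := by
    intro t ht
    obtain ⟨ρ, hρ, V, hV, -, h2, -⟩ := hloc t ht
    have hmem : ((0 : ℝ), t) ∈ Ioo (-ρ) ρ ×ˢ V :=
      ⟨⟨neg_lt_zero.2 hρ, hρ⟩, mem_of_mem_nhdsWithin ht hV⟩
    have h3 := (h2 _ hmem).mono_of_mem_nhdsWithin (hW ρ hρ t V hV)
    exact h3.comp (f := fun u => ((0 : ℝ), u)) (s := Icc a b)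
      (continuousWithinAt_const.prodMk continuousWithinAt_id) fun u hu => ⟨mem_univ _, hu⟩
  refine ⟨hcont, ?_⟩
  obtain ⟨M, hM⟩ := isCompact_Icc.exists_bound_of_continuousOn hcont
  -- Compactness of `[a, b]` makes the local hypotheses uniform in t for small r. The membership is
  -- repeated as a premise because the property must hold on a full neighbourhood of (0, t); off the
  -- interval it is then vacuous.
  have hev : ∀ᶠ r in 𝓝 (0 : ℝ), ∀ t ∈ Icc a b, t ∈ Icc a b →
      ContinuousWithinAt (fun p : ℝ × ℝ => f p.1 p.2) (univ ×ˢ Icc a b) (r, t) ∧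
      ‖f' r t‖ ≤ M + 1 ∧ HasDerivAt (fun r => f r t) (f' r t) r := by
    refine isCompact_Icc.eventually_forall_of_forall_eventually fun t ht => ?_
    obtain ⟨ρ, hρ, V, hV, h1, h2, h3⟩ := hloc t ht
    have hmem : ((0 : ℝ), t) ∈ Ioo (-ρ) ρ ×ˢ V :=
      ⟨⟨neg_lt_zero.2 hρ, hρ⟩, mem_of_mem_nhdsWithin ht hV⟩
    have hn := hW ρ hρ t V hV
    have hb : ∀ᶠ p in 𝓝[univ ×ˢ Icc a b] ((0 : ℝ), t), ‖f' p.1 p.2‖ < M + 1 :=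
      (((h2 _ hmem).mono_of_mem_nhdsWithin hn).norm).eventually_lt
        continuousWithinAt_const ((hM t ht).trans_lt (lt_add_one M))
    have hc : ∀ᶠ p in 𝓝[univ ×ˢ Icc a b] ((0 : ℝ), t),
        Ioo (-ρ) ρ ×ˢ V ∈ 𝓝[univ ×ˢ Icc a b] p :=
      eventually_mem_nhdsWithin_iff.2 hn
    have hn' : ∀ᶠ p in 𝓝[univ ×ˢ Icc a b] ((0 : ℝ), t), p ∈ Ioo (-ρ) ρ ×ˢ V := hn
    have := hn'.and (hb.and hc)
    rw [eventually_nhdsWithin_iff] at this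
    filter_upwards [this] with p hp hp2
    obtain ⟨hpW, hpb, hpc⟩ := hp ⟨mem_univ _, hp2⟩
    exact ⟨(h1 p hpW).mono_of_mem_nhdsWithin hpc, hpb.le, h3 p hpW⟩
  have hcf : ∀ r, (∀ t ∈ Icc a b, t ∈ Icc a b →
      ContinuousWithinAt (fun p : ℝ × ℝ => f p.1 p.2) (univ ×ˢ Icc a b) (r, t) ∧
      ‖f' r t‖ ≤ M + 1 ∧ HasDerivAt (fun r => f r t) (f' r t) r) →
      ContinuousOn (f r) (Icc a b) := fun r hr t ht =>
    (hr t ht ht).1.comp (f := fun u => (r, u)) (s := Icc a b)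
      (continuousWithinAt_const.prodMk continuousWithinAt_id) fun u hu => ⟨mem_univ _, hu⟩
  have hsub : uIoc a b ⊆ Icc a b := by
    rw [uIoc_of_le hab]
    exact Ioc_subset_Icc_self
  refine (intervalIntegral.hasDerivAt_integral_of_dominated_loc_of_deriv_le (F' := f')
    (bound := fun _ => M + 1) hev ?_ ?_ ?_ ?_ (by simp) ?_).2
  · filter_upwards [hev] with r hr
    exact ((hcf r hr).mono hsub).aestronglyMeasurable measurableSet_uIoc
  · exact (hcf 0 hev.self_of_nhds).intervalIntegrable_of_Icc hab
  · exact (hcont.mono hsub).aestronglyMeasurable measurableSet_uIoc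
  · exact Filter.Eventually.of_forall fun t ht r hr => (hr t (hsub ht) (hsub ht)).2.1
  · exact Filter.Eventually.of_forall fun t ht r hr => (hr t (hsub ht) (hsub ht)).2.2

/-- The du Bois-Reymond lemma. -/
theorem hasDerivWithinAt_of_forall_integral_eq_zero {α β : ℝ} (hαβ : α < β) {P f : ℝ → ℝ}
    (hP : ContinuousOn P (Icc α β)) (hf : ContinuousOn f (Icc α β))
    (H : ∀ ξ ξ' : ℝ → ℝ, Continuous ξ' → (∀ t, HasDerivAt ξ (ξ' t) t) →
      (∀ t, t ∉ Ioo α β → ξ t = 0) → ∫ t in α..β, (ξ t * f t + ξ' t * P t) = 0) :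
    ∀ t ∈ Icc α β, HasDerivWithinAt P (f t) (Icc α β) t := by
  -- The aim is that P − Φ is constant on `[α, β]`.
  set Φ : ℝ → ℝ := fun t => ∫ x in α..t, f x with hΦ
  have hΦ' : ∀ t ∈ Icc α β, HasDerivWithinAt Φ (f t) (Icc α β) t :=
    fun t ht => hasDerivWithinAt_integral_Icc hf ht
  have hΦc : ContinuousOn Φ (Icc α β) := fun t ht => (hΦ' t ht).continuousWithinAt
  set g : ℝ → ℝ := IccExtend hαβ.le (domRestrict (Icc α β) fun t => P t - Φ t) with hg
  have hgc : Continuous g :=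
    (continuousOn_iff_continuous_domRestrict.1 (hP.sub hΦc)).Icc_extend'
  have hgt : ∀ t ∈ Icc α β, g t = P t - Φ t := fun t ht => IccExtend_of_mem hαβ.le _ ht
  -- A continuous weight, positive exactly on the open interval. It makes the derivative of the test
  -- function vanish outside, so that the test function is C¹ on the whole line.
  set χ : ℝ → ℝ := fun t => max 0 ((t - α) * (β - t)) with hχ
  have hχc : Continuous χ := by fun_prop
  have hχpos : ∀ t ∈ Ioo α β, 0 < χ t := fun t ht =>
    lt_max_of_lt_right (mul_pos (sub_pos.2 ht.1) (sub_pos.2 ht.2))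
  have hχ0 : ∀ t, t ∉ Ioo α β → χ t = 0 := by
    intro t ht
    refine max_eq_left ?_
    rcases le_or_gt t α with h1 | h1
    · exact mul_nonpos_of_nonpos_of_nonneg (by linarith) (by linarith)
    · have h2 : β ≤ t := not_lt.1 fun h2 => ht ⟨h1, h2⟩
      exact mul_nonpos_of_nonneg_of_nonpos (by linarith) (by linarith)
  have hχi : 0 < ∫ t in α..β, χ t :=
    intervalIntegral.intervalIntegral_pos_of_pos_on (hχc.intervalIntegrable _ _) hχpos hαβ
  -- The χ-weighted mean of g, chosen so that χ(g − C) has integral zero and its primitive from α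
  -- also vanishes at β.
  set C : ℝ := (∫ t in α..β, χ t * g t) / ∫ t in α..β, χ t with hC
  set ξ' : ℝ → ℝ := fun t => χ t * (g t - C) with hξ'
  have hξ'c : Continuous ξ' := by fun_prop
  set ξ : ℝ → ℝ := fun t => ∫ x in α..t, ξ' x with hξ
  have hξd : ∀ t, HasDerivAt ξ (ξ' t) t := fun t =>
    intervalIntegral.integral_hasDerivAt_right (hξ'c.intervalIntegrable _ _)
      (hξ'c.stronglyMeasurableAtFilter _ _) hξ'c.continuousAt
  have hξα : ξ α = 0 := by simp [hξ]
  have hξβ : ξ β = 0 := by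
    have h1 : ∫ t in α..β, ξ' t = (∫ t in α..β, χ t * g t) - (∫ t in α..β, χ t) * C := by
      rw [← intervalIntegral.integral_mul_const, ← intervalIntegral.integral_sub]
      · simp only [hξ', mul_sub]
      · exact (hχc.mul hgc).intervalIntegrable _ _
      · exact (hχc.mul continuous_const).intervalIntegrable _ _
    rw [hξ]
    simp only
    rw [h1, hC, mul_div_cancel₀ _ hχi.ne', sub_self]
  have hξ'0 : ∀ t, t ∉ Ioo α β → ξ' t = 0 := fun t ht => by simp only [hξ', hχ0 t ht, zero_mul]
  have hξ0 : ∀ t, t ∉ Ioo α β → ξ t = 0 := by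
    intro t ht
    rcases le_or_gt t α with h1 | h1
    · refine (intervalIntegral.integral_congr (g := fun _ => 0) fun x hx => ?_).trans (by simp)
      rw [uIcc_of_ge h1] at hx
      exact hξ'0 x fun hx' => absurd hx.2 (not_le.2 hx'.1)
    · have h2 : β ≤ t := not_lt.1 fun h2 => ht ⟨h1, h2⟩
      have h3 : ∫ x in β..t, ξ' x = 0 := by
        refine (intervalIntegral.integral_congr (g := fun _ => 0) fun x hx => ?_).trans (by simp)
        rw [uIcc_of_le h2] at hx
        exact hξ'0 x fun hx' => absurd hx.1 (not_le.2 hx'.2)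
      have h4 := intervalIntegral.integral_add_adjacent_intervals
        (hξ'c.intervalIntegrable (μ := volume) α β) (hξ'c.intervalIntegrable β t)
      rw [h3, add_zero] at h4
      exact h4.symm.trans hξβ
  have hξc : Continuous ξ := continuous_iff_continuousAt.2 fun t => (hξd t).continuousAt
  have hH := H ξ ξ' hξ'c hξd hξ0
  -- integrate by parts
  have hparts : ∫ t in α..β, (ξ' t * Φ t + ξ t * f t) = 0 := by
    have := intervalIntegral.integral_eq_sub_of_hasDerivAt_of_le (f := fun t => ξ t * Φ t)
      (f' := fun t => ξ' t * Φ t + ξ t * f t) hαβ.le (hξc.continuousOn.mul hΦc)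
      (fun t ht => (hξd t).fun_mul ((hΦ' t (Ioo_subset_Icc_self ht)).hasDerivAt
        (Icc_mem_nhds ht.1 ht.2)))
      (((hξ'c.continuousOn.mul hΦc).add (hξc.continuousOn.mul hf)).intervalIntegrable_of_Icc
        hαβ.le)
    rw [this, hξα, hξβ]
    simp
  have hξint : ∫ t in α..β, ξ' t = 0 := hξβ
  -- For this test function, the hypothesis minus the integration by parts minus C times the
  -- integral of ξ' leaves the integral of ξ'(P − Φ − C) = χ(g − C)².
  have hsq : ∫ t in α..β, χ t * (g t - C) ^ 2 = 0 := by
    have h1 : ∫ t in α..β, χ t * (g t - C) ^ 2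
        = ∫ t in α..β, ((ξ t * f t + ξ' t * P t) - (ξ' t * Φ t + ξ t * f t) - C * ξ' t) := by
      refine intervalIntegral.integral_congr fun t ht => ?_
      rw [uIcc_of_le hαβ.le] at ht
      simp only [hξ', hgt t ht]
      ring
    rw [h1, intervalIntegral.integral_sub, intervalIntegral.integral_sub, hH, hparts,
      intervalIntegral.integral_const_mul, hξint]
    · simp
    · exact ((hξc.continuousOn.mul hf).add
        (hξ'c.continuousOn.mul hP)).intervalIntegrable_of_Icc hαβ.le
    · exact ((hξ'c.continuousOn.mul hΦc).add
        (hξc.continuousOn.mul hf)).intervalIntegrable_of_Icc hαβ.le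
    · exact (((hξc.continuousOn.mul hf).add (hξ'c.continuousOn.mul hP)).sub
        ((hξ'c.continuousOn.mul hΦc).add
        (hξc.continuousOn.mul hf))).intervalIntegrable_of_Icc hαβ.le
    · exact (continuous_const.mul hξ'c).intervalIntegrable _ _
  have hgC : ∀ t ∈ Ioo α β, g t = C := by
    by_contra! hne
    obtain ⟨c, hc, hcne⟩ := hne
    have hpos : 0 < ∫ t in α..β, χ t * (g t - C) ^ 2 :=
      intervalIntegral.integral_pos hαβ (by fun_prop)
        (fun t _ => mul_nonneg (le_max_left _ _) (sq_nonneg _))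
        ⟨c, Ioo_subset_Icc_self hc, mul_pos (hχpos c hc) (by
          have := sub_ne_zero.2 hcne
          positivity)⟩
    exact hpos.ne' hsq
  have hgC' : ∀ t ∈ Icc α β, g t = C := by
    have h1 : EqOn g (fun _ => C) (closure (Ioo α β)) :=
      EqOn.closure (fun t ht => hgC t ht) hgc continuous_const
    rw [closure_Ioo hαβ.ne] at h1
    exact h1
  intro t ht
  have hPC : ∀ u ∈ Icc α β, P u = C + Φ u := fun u hu => by
    rw [← hgC' u hu, hgt u hu]
    ring
  exact ((hΦ' t ht).const_add C).congr hPC (hPC t ht)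

end Calculus

end

/-! ### Families of curves and the first variation of the action. -/

section

variable {d : ℕ} {T : Set ℝ} {S : Type*} [TopologicalSpace S]
  [ChartedSpace (ModelS d) S] [IsManifold (𝓡 d) 2 S]

section Families

/-- The velocities of a family of curves in the chart around `x₀`. -/
def familyVelocity (t₀ t₁ : ℝ) (Q : ℝ → ℝ → S) (x₀ : S) (r t : ℝ) : ModelS d :=
  derivWithin (chartCurve (𝓡 d) x₀ (Q r)) (Icc t₀ t₁) t

/-- The variation field of a family of curves in the chart around `x₀`. -/
def familyVariation (Q : ℝ → ℝ → S) (x₀ : S) (r t : ℝ) : ModelS d :=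
  deriv (fun r => chartCurve (𝓡 d) x₀ (Q r) t) r

/-- The variation of the velocities of a family of curves in the chart around `x₀`. -/
def familyVelocityVariation (t₀ t₁ : ℝ) (Q : ℝ → ℝ → S) (x₀ : S) (r t : ℝ) : ModelS d :=
  deriv (fun r => familyVelocity (d := d) t₀ t₁ Q x₀ r t) r

/-- `Q` is a `C¹` family of `C¹` curves with values in the domain of the chart around `x₀` for
`r ∈ (-ρ, ρ)` and `t ∈ [α, β] ⊆ [t₀, t₁]`. -/
structure IsC1Family (t₀ t₁ : ℝ) (Q : ℝ → ℝ → S) (x₀ : S) (ρ α β : ℝ) : Prop where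
  pos : 0 < ρ
  lt : α < β
  subset : Icc α β ⊆ Icc t₀ t₁
  source : ∀ p ∈ Ioo (-ρ) ρ ×ˢ Icc α β, Q p.1 p.2 ∈ (extChartAt (𝓡 d) x₀).source
  continuousWithinAt : ∀ p ∈ Ioo (-ρ) ρ ×ˢ Icc α β, ContinuousWithinAt (Q p.1) (Icc t₀ t₁) p.2
  continuousAt : ∀ p ∈ Ioo (-ρ) ρ ×ˢ Icc α β, ContinuousAt (fun r => Q r p.2) p.1
  continuousOn : ContinuousOn (fun p : ℝ × ℝ => chartCurve (𝓡 d) x₀ (Q p.1) p.2)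
    (Ioo (-ρ) ρ ×ˢ Icc α β)
  hasDerivWithinAt : ∀ p ∈ Ioo (-ρ) ρ ×ˢ Icc α β,
    HasDerivWithinAt (chartCurve (𝓡 d) x₀ (Q p.1)) (familyVelocity (d := d) t₀ t₁ Q x₀ p.1 p.2)
      (Icc t₀ t₁) p.2
  hasDerivAt : ∀ p ∈ Ioo (-ρ) ρ ×ˢ Icc α β,
    HasDerivAt (fun r => chartCurve (𝓡 d) x₀ (Q r) p.2) (familyVariation (d := d) Q x₀ p.1 p.2) p.1
  hasDerivAt_velocity : ∀ p ∈ Ioo (-ρ) ρ ×ˢ Icc α β,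
    HasDerivAt (fun r => familyVelocity (d := d) t₀ t₁ Q x₀ r p.2)
      (familyVelocityVariation (d := d) t₀ t₁ Q x₀ p.1 p.2) p.1
  continuousOn_velocity : ContinuousOn (fun p : ℝ × ℝ => familyVelocity (d := d) t₀ t₁ Q x₀ p.1 p.2)
    (Ioo (-ρ) ρ ×ˢ Icc α β)
  continuousOn_variation : ContinuousOn (fun p : ℝ × ℝ => familyVariation (d := d) Q x₀ p.1 p.2)
    (Ioo (-ρ) ρ ×ˢ Icc α β)
  continuousOn_velocityVariation :
    ContinuousOn (fun p : ℝ × ℝ => familyVelocityVariation (d := d) t₀ t₁ Q x₀ p.1 p.2)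
    (Ioo (-ρ) ρ ×ˢ Icc α β)

variable {t₀ t₁ : ℝ} {Q : ℝ → ℝ → S} {x₀ : S} {ρ α β : ℝ}

omit [IsManifold (𝓡 d) 2 S] in
theorem IsC1Family.mem_zero (hQ : IsC1Family (d := d) t₀ t₁ Q x₀ ρ α β) {t : ℝ} (ht : t ∈ Icc α β) :
    ((0 : ℝ), t) ∈ Ioo (-ρ) ρ ×ˢ Icc α β :=
  ⟨⟨neg_lt_zero.2 hQ.pos, hQ.pos⟩, ht⟩

/-- Near (0, t) the chart used by the `mixed` condition is the one around Q(0, t) = q(t). The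
neighbourhood it supplies and the preimage of the chart domain together contain a product rectangle.
-/
theorem IsVariation.exists_isC1Family (h : t₀ < t₁) {q : ℝ → S} {ε : ℝ}
    (hQ : IsVariation (𝓡 d) t₀ t₁ q ε Q) {t : ℝ} (ht : t ∈ Icc t₀ t₁) :
    ∃ ρ α β, t ∈ Icc α β ∧ Icc α β ∈ 𝓝[Icc t₀ t₁] t ∧ IsC1Family (d := d) t₀ t₁ Q (q t) ρ α β := by
  have : IsManifold (𝓡 d) 1 S := IsManifold.of_le one_le_two
  set x₀ := q t with hx₀
  have hε : (0 : ℝ) ∈ Ioo (-ε) ε := ⟨neg_lt_zero.2 hQ.pos, hQ.pos⟩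
  have hQ0 : Q 0 t = x₀ := hQ.base t ht
  obtain ⟨V, hV, hV1, hV2⟩ := hQ.mixed (0, t) ⟨hε, ht⟩
  simp only [hQ0] at hV1 hV2
  have hQc := hQ.contMDiffOn.continuousOn
  have hsrc : ∀ᶠ p in 𝓝[Ioo (-ε) ε ×ˢ Icc t₀ t₁] ((0 : ℝ), t),
      Q p.1 p.2 ∈ (extChartAt (𝓡 d) x₀).source := by
    refine hQc (0, t) ⟨hε, ht⟩ ((isOpen_extChartAt_source x₀).mem_nhds ?_)
    simp only [hQ0]
    exact mem_extChartAt_source x₀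
  have hN : V ∩ {p | Q p.1 p.2 ∈ (extChartAt (𝓡 d) x₀).source} ∩ Ioo (-ε) ε ×ˢ Icc t₀ t₁ ∈
      𝓝[Ioo (-ε) ε ×ˢ Icc t₀ t₁] ((0 : ℝ), t) :=
    Filter.inter_mem (Filter.inter_mem hV hsrc) self_mem_nhdsWithin
  rw [nhdsWithin_prod_eq, isOpen_Ioo.nhdsWithin_eq hε, Filter.mem_prod_iff] at hN
  obtain ⟨A, hA, B, hB, hAB⟩ := hN
  obtain ⟨ρ, hρ, hρA⟩ := Metric.mem_nhds_iff.1 hA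
  rw [Real.ball_eq_Ioo, zero_sub, zero_add] at hρA
  obtain ⟨α, β, hαβ, htαβ, hsub, hBsub, hnhds⟩ := exists_Icc_subset_of_mem_nhdsWithin h ht hB
  have hW : Ioo (-ρ) ρ ×ˢ Icc α β ⊆
      V ∩ {p | Q p.1 p.2 ∈ (extChartAt (𝓡 d) x₀).source} ∩ Ioo (-ε) ε ×ˢ Icc t₀ t₁ :=
    (prod_mono hρA hBsub).trans hAB
  set R := Ioo (-ε) ε ×ˢ Icc t₀ t₁ with hR
  -- Derivatives within the rectangle are unique, so the two partial derivatives of the family are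
  -- the values of its differential on (0, 1) and (1, 0), and inherit its continuity.
  have hRu : UniqueDiffOn ℝ R :=
    isOpen_Ioo.uniqueDiffOn.prod (uniqueDiffOn_Icc h)
  have hC : ∀ p ∈ Ioo (-ρ) ρ ×ˢ Icc α β,
      ContDiffWithinAt ℝ 1 (fun p : ℝ × ℝ => chartCurve (𝓡 d) x₀ (Q p.1) p.2) R p := by
    intro p hp
    have hp2 := (hW hp).1.2
    rw [mem_ofPred_eq, extChartAt_source] at hp2
    exact ((contMDiffWithinAt_iff_target_of_mem_source (I' := 𝓡 d) (y := x₀)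
      (f := fun p : ℝ × ℝ => Q p.1 p.2) (x := p) hp2).1
      (hQ.contMDiffOn p (hW hp).2)).2.contDiffWithinAt
  have hCd : ∀ p ∈ Ioo (-ρ) ρ ×ˢ Icc α β,
      HasFDerivWithinAt (fun p : ℝ × ℝ => chartCurve (𝓡 d) x₀ (Q p.1) p.2)
        (fderivWithin ℝ (fun p : ℝ × ℝ => chartCurve (𝓡 d) x₀ (Q p.1) p.2) R p) R p :=
    fun p hp => ((hC p hp).differentiableWithinAt one_ne_zero).hasFDerivWithinAt
  have hCc : ∀ v : ℝ × ℝ, ContinuousOn (fun p =>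
      fderivWithin ℝ (fun p : ℝ × ℝ => chartCurve (𝓡 d) x₀ (Q p.1) p.2) R p v)
      (Ioo (-ρ) ρ ×ˢ Icc α β) := fun v p hp =>
    ((((hC p hp).fderivWithin_right hRu (m := 0) (by simp)
      (hW hp).2).continuousWithinAt).clm_apply continuousWithinAt_const).mono
      fun x hx => (hW hx).2
  have hdt : ∀ p ∈ Ioo (-ρ) ρ ×ˢ Icc α β,
      HasDerivWithinAt (chartCurve (𝓡 d) x₀ (Q p.1))
        (fderivWithin ℝ (fun p : ℝ × ℝ => chartCurve (𝓡 d) x₀ (Q p.1) p.2) R p (0, 1))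
        (Icc t₀ t₁) p.2 := by
    intro p hp
    have hl : HasDerivWithinAt (fun u : ℝ => (p.1, u)) ((0 : ℝ), (1 : ℝ)) (Icc t₀ t₁) p.2 :=
      (hasDerivWithinAt_const _ _ _).prodMk (hasDerivWithinAt_id _ _)
    have hm : MapsTo (fun u : ℝ => (p.1, u)) (Icc t₀ t₁) R := fun u hu => ⟨(hW hp).2.1, hu⟩
    exact (hCd p hp).comp_hasDerivWithinAt (p.2 : ℝ) hl hm
  have hdr : ∀ p ∈ Ioo (-ρ) ρ ×ˢ Icc α β,
      HasDerivAt (fun r => chartCurve (𝓡 d) x₀ (Q r) p.2)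
        (fderivWithin ℝ (fun p : ℝ × ℝ => chartCurve (𝓡 d) x₀ (Q p.1) p.2) R p (1, 0)) p.1 := by
    intro p hp
    have hl : HasDerivWithinAt (fun u : ℝ => (u, p.2)) ((1 : ℝ), (0 : ℝ)) (Ioo (-ε) ε) p.1 :=
      (hasDerivWithinAt_id _ _).prodMk (hasDerivWithinAt_const _ _ _)
    have hm : MapsTo (fun u : ℝ => (u, p.2)) (Ioo (-ε) ε) R := fun u hu => ⟨hu, (hW hp).2.2⟩
    exact ((hCd p hp).comp_hasDerivWithinAt (p.1 : ℝ) hl hm).hasDerivAt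
      (isOpen_Ioo.mem_nhds (hW hp).2.1)
  have hvel : ∀ p ∈ Ioo (-ρ) ρ ×ˢ Icc α β, familyVelocity (d := d) t₀ t₁ Q x₀ p.1 p.2
      = fderivWithin ℝ (fun p : ℝ × ℝ => chartCurve (𝓡 d) x₀ (Q p.1) p.2) R p (0, 1) :=
    fun p hp => (hdt p hp).derivWithin (uniqueDiffOn_Icc h _ (hW hp).2.2)
  have hvar : ∀ p ∈ Ioo (-ρ) ρ ×ˢ Icc α β, familyVariation (d := d) Q x₀ p.1 p.2
      = fderivWithin ℝ (fun p : ℝ × ℝ => chartCurve (𝓡 d) x₀ (Q p.1) p.2) R p (1, 0) :=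
    fun p hp => (hdr p hp).deriv
  refine ⟨ρ, α, β, htαβ, hnhds, hρ, hαβ, hsub, fun p hp => (hW hp).1.2, fun p hp => ?_,
    fun p hp => ?_, fun p hp => ?_, fun p hp => ?_, fun p hp => ?_, fun p hp => ?_,
    (hCc (0, 1)).congr hvel, (hCc (1, 0)).congr hvar, hV2.mono fun p hp => (hW hp).1.1⟩
  · exact (hQc p (hW hp).2).comp (f := fun u => (p.1, u)) (s := Icc t₀ t₁)
      (continuousWithinAt_const.prodMk continuousWithinAt_id) fun u hu => ⟨(hW hp).2.1, hu⟩
  · exact ((hQc p (hW hp).2).comp (f := fun u => (u, p.2)) (s := Ioo (-ε) ε)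
      (continuousWithinAt_id.prodMk continuousWithinAt_const)
      fun u hu => ⟨hu, (hW hp).2.2⟩).continuousAt (isOpen_Ioo.mem_nhds (hW hp).2.1)
  · exact (hC p hp).continuousWithinAt.mono fun x hx => (hW hx).2
  · rw [hvel p hp]
    exact hdt p hp
  · rw [hvar p hp]
    exact hdr p hp
  · exact (hV1 p (hW hp).1.1).hasDerivAt

omit [IsManifold (𝓡 d) 2 S] in
/-- The symmetry of the mixed derivatives of a `C¹` family of `C¹` curves. -/
theorem IsC1Family.hasDerivWithinAt_variation (hQ : IsC1Family (d := d) t₀ t₁ Q x₀ ρ α β) {t : ℝ}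
    (ht : t ∈ Icc α β) :
    HasDerivWithinAt (familyVariation (d := d) Q x₀ 0) (familyVelocityVariation (d := d) t₀ t₁ Q x₀ 0 t)
      (Icc α β) t := by
  have hαβ := hQ.lt
  have hcv : ContinuousOn (familyVelocityVariation (d := d) t₀ t₁ Q x₀ 0) (Icc α β) :=
    hQ.continuousOn_velocityVariation.comp (f := fun u => ((0 : ℝ), u))
      (continuousOn_const.prodMk continuousOn_id) fun u hu => hQ.mem_zero hu
  have hint : ∀ u ∈ Icc α β, familyVariation (d := d) Q x₀ 0 u
      = familyVariation (d := d) Q x₀ 0 α + ∫ x in α..u, familyVelocityVariation (d := d) t₀ t₁ Q x₀ 0 x := by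
    intro u hu
    have hsub : Icc α u ⊆ Icc α β := Icc_subset_Icc_right hu.2
    have h1 : HasDerivAt (fun r => ∫ x in α..u, familyVelocity (d := d) t₀ t₁ Q x₀ r x)
        (∫ x in α..u, familyVelocityVariation (d := d) t₀ t₁ Q x₀ 0 x) 0 := by
      refine (hasDerivAt_integral_of_locally hu.1 fun x hx => ⟨ρ, hQ.pos, Icc α u,
        self_mem_nhdsWithin, ?_, ?_, ?_⟩).2
      · exact hQ.continuousOn_velocity.mono (prod_mono le_rfl hsub)
      · exact hQ.continuousOn_velocityVariation.mono (prod_mono le_rfl hsub)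
      · exact fun p hp => hQ.hasDerivAt_velocity p ⟨hp.1, hsub hp.2⟩
    have h2 := (hQ.hasDerivAt (0, α) (hQ.mem_zero (left_mem_Icc.2 hαβ.le))).fun_add h1
    -- The family need not be C²: only one mixed derivative is assumed. The other comes from writing
    -- each curve as the integral of its velocity and differentiating in r under the integral sign.
    have h3 : (fun r => chartCurve (𝓡 d) x₀ (Q r) u) =ᶠ[𝓝 0]
        fun r => chartCurve (𝓡 d) x₀ (Q r) α + ∫ x in α..u, familyVelocity (d := d) t₀ t₁ Q x₀ r x := by
      filter_upwards [Ioo_mem_nhds (neg_lt_zero.2 hQ.pos) hQ.pos] with r hr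
      have hd : ∀ x ∈ Icc α β, HasDerivWithinAt (chartCurve (𝓡 d) x₀ (Q r))
          (familyVelocity (d := d) t₀ t₁ Q x₀ r x) (Icc α β) x := fun x hx =>
        (hQ.hasDerivWithinAt (r, x) ⟨hr, hx⟩).mono hQ.subset
      have h4 := intervalIntegral.integral_eq_sub_of_hasDerivAt_of_le hu.1
        (fun x hx => ((hd x (hsub hx)).continuousWithinAt).mono hsub)
        (fun x hx => (hd x (hsub (Ioo_subset_Icc_self hx))).hasDerivAt
          (Icc_mem_nhds hx.1 (hx.2.trans_le hu.2)))
        (ContinuousOn.intervalIntegrable_of_Icc (μ := volume) hu.1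
          (hQ.continuousOn_velocity.comp (f := fun x => (r, x))
            (continuousOn_const.prodMk continuousOn_id) fun x hx => ⟨hr, hsub hx⟩))
      rw [h4]
      abel
    exact ((h2.congr_of_eventuallyEq h3).unique (hQ.hasDerivAt (0, u) (hQ.mem_zero hu))).symm
  exact ((hasDerivWithinAt_integral_Icc hcv ht).const_add _).congr hint (hint t ht)

end Families

namespace Data

variable (D : Data d T S) {t₀ t₁ : ℝ} {Q : ℝ → ℝ → S} {x₀ : S} {ρ α β : ℝ}

/-- The total differential of the coordinate expression of the Lagrangian. -/
theorem fderiv_lagrangianCoord_apply (hT : IsOpen T) {t : ℝ} {z v : ModelS d} (ht : t ∈ T)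
    (hz : z ∈ (extChartAt (𝓡 d) x₀).target) (a b : ModelS d) :
    fderiv ℝ (fun p : ℝ × ModelS d × ModelS d =>
      lagrangianCoord (𝓡 d) D.lagrangian x₀ p.1 p.2.1 p.2.2) (t, z, v) (0, a, b)
      = fderiv ℝ (fun z => lagrangianCoord (𝓡 d) D.lagrangian x₀ t z v) z a
        + fderiv ℝ (fun v => lagrangianCoord (𝓡 d) D.lagrangian x₀ t z v) v b := by
  have h1 := (((D.contDiffOn_lagrangianCoord x₀).contDiffAt
    (prod_target_univ_mem_nhds hT hz ht v)).differentiableAt one_ne_zero).hasFDerivAt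
  have hz' : HasFDerivAt (fun z : ModelS d => (t, z, v))
      ((0 : ModelS d →L[ℝ] ℝ).prod ((ContinuousLinearMap.id ℝ (ModelS d)).prod 0)) z :=
    (hasFDerivAt_const _ _).prodMk ((hasFDerivAt_id _).prodMk (hasFDerivAt_const _ _))
  have hv' : HasFDerivAt (fun v : ModelS d => (t, z, v))
      ((0 : ModelS d →L[ℝ] ℝ).prod ((0 : ModelS d →L[ℝ] ModelS d).prod
        (ContinuousLinearMap.id ℝ (ModelS d)))) v :=
    (hasFDerivAt_const _ _).prodMk ((hasFDerivAt_const _ _).prodMk (hasFDerivAt_id _))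
  have e1 : fderiv ℝ (fun z => lagrangianCoord (𝓡 d) D.lagrangian x₀ t z v) z a = _ :=
    congrArg (fun L => L a) (h1.comp z hz').fderiv
  have e2 : fderiv ℝ (fun v => lagrangianCoord (𝓡 d) D.lagrangian x₀ t z v) v b = _ :=
    congrArg (fun L => L b) (h1.comp v hv').fderiv
  rw [e1, e2]
  simp only [ContinuousLinearMap.comp_apply, ContinuousLinearMap.prod_apply,
    ContinuousLinearMap.id_apply, zero_apply]
  rw [← map_add]
  simp

/-- The integrand of the action of a family of curves. -/
def density (t₀ t₁ : ℝ) (Q : ℝ → ℝ → S) (r t : ℝ) : ℝ :=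
  D.lagrangian t (Q r t) (velocity (𝓡 d) (Icc t₀ t₁) (Q r) t)

variable (h : t₀ < t₁) (hT : IsOpen T) (hJ : Icc t₀ t₁ ⊆ T)
include h hT hJ

/-- The chain rule for the C¹ function L along (t, c, c'); these are the local hypotheses for
differentiating the action under the integral sign. -/
theorem density_regularity (hQ : IsC1Family (d := d) t₀ t₁ Q x₀ ρ α β) :
    ContinuousOn (fun p : ℝ × ℝ => D.density t₀ t₁ Q p.1 p.2) (Ioo (-ρ) ρ ×ˢ Icc α β) ∧
    ContinuousOn (fun p : ℝ × ℝ => deriv (fun r => D.density t₀ t₁ Q r p.2) p.1)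
      (Ioo (-ρ) ρ ×ˢ Icc α β) ∧
    ∀ p ∈ Ioo (-ρ) ρ ×ˢ Icc α β, HasDerivAt (fun r => D.density t₀ t₁ Q r p.2)
      (fderiv ℝ (fun p : ℝ × ModelS d × ModelS d =>
        lagrangianCoord (𝓡 d) D.lagrangian x₀ p.1 p.2.1 p.2.2)
        (p.2, chartCurve (𝓡 d) x₀ (Q p.1) p.2, familyVelocity (d := d) t₀ t₁ Q x₀ p.1 p.2)
        (0, familyVariation (d := d) Q x₀ p.1 p.2, familyVelocityVariation (d := d) t₀ t₁ Q x₀ p.1 p.2)) p.1 := by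
  have hO : IsOpen (T ×ˢ (extChartAt (𝓡 d) x₀).target ×ˢ (univ : Set (ModelS d))) :=
    hT.prod ((isOpen_extChartAt_target x₀).prod isOpen_univ)
  have hmaps : MapsTo (fun p : ℝ × ℝ =>
      (p.2, chartCurve (𝓡 d) x₀ (Q p.1) p.2, familyVelocity (d := d) t₀ t₁ Q x₀ p.1 p.2))
      (Ioo (-ρ) ρ ×ˢ Icc α β) (T ×ˢ (extChartAt (𝓡 d) x₀).target ×ˢ univ) := fun p hp =>
    ⟨hJ (hQ.subset hp.2), (extChartAt (𝓡 d) x₀).map_source (hQ.source p hp), mem_univ _⟩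
  have hcont : ContinuousOn (fun p : ℝ × ℝ =>
      (p.2, chartCurve (𝓡 d) x₀ (Q p.1) p.2, familyVelocity (d := d) t₀ t₁ Q x₀ p.1 p.2))
      (Ioo (-ρ) ρ ×ˢ Icc α β) :=
    continuousOn_snd.prodMk (hQ.continuousOn.prodMk hQ.continuousOn_velocity)
  have hF : ∀ p ∈ Ioo (-ρ) ρ ×ˢ Icc α β, D.density t₀ t₁ Q p.1 p.2
      = lagrangianCoord (𝓡 d) D.lagrangian x₀ p.2 (chartCurve (𝓡 d) x₀ (Q p.1) p.2)
        (familyVelocity (d := d) t₀ t₁ Q x₀ p.1 p.2) := fun p hp =>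
    lagrangianCoord_chartCurve D.lagrangian p.2 (uniqueDiffOn_Icc h _ (hQ.subset hp.2))
      (hQ.continuousWithinAt p hp) (hQ.source p hp) (hQ.hasDerivWithinAt p hp)
  have hderiv : ∀ p ∈ Ioo (-ρ) ρ ×ˢ Icc α β, HasDerivAt (fun r => D.density t₀ t₁ Q r p.2)
      (fderiv ℝ (fun p : ℝ × ModelS d × ModelS d =>
        lagrangianCoord (𝓡 d) D.lagrangian x₀ p.1 p.2.1 p.2.2)
        (p.2, chartCurve (𝓡 d) x₀ (Q p.1) p.2, familyVelocity (d := d) t₀ t₁ Q x₀ p.1 p.2)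
        (0, familyVariation (d := d) Q x₀ p.1 p.2, familyVelocityVariation (d := d) t₀ t₁ Q x₀ p.1 p.2)) p.1 := by
    intro p hp
    have h1 := (((D.contDiffOn_lagrangianCoord x₀).contDiffAt
      (hO.mem_nhds (hmaps hp))).differentiableAt one_ne_zero).hasFDerivAt
    have h2 : HasDerivAt (fun r =>
        (p.2, chartCurve (𝓡 d) x₀ (Q r) p.2, familyVelocity (d := d) t₀ t₁ Q x₀ r p.2))
        ((0 : ℝ), familyVariation (d := d) Q x₀ p.1 p.2,
          familyVelocityVariation (d := d) t₀ t₁ Q x₀ p.1 p.2) p.1 :=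
      (hasDerivAt_const _ _).prodMk ((hQ.hasDerivAt p hp).prodMk (hQ.hasDerivAt_velocity p hp))
    refine (h1.comp_hasDerivAt (p.1 : ℝ) h2).congr_of_eventuallyEq ?_
    filter_upwards [isOpen_Ioo.mem_nhds hp.1] with r hr
    exact hF (r, p.2) ⟨hr, hp.2⟩
  refine ⟨?_, ?_, hderiv⟩
  · exact ((D.contDiffOn_lagrangianCoord x₀).continuousOn.comp hcont hmaps).congr hF
  · have h1 := ((D.contDiffOn_lagrangianCoord x₀).continuousOn_fderiv_of_isOpen hO le_rfl).comp
      hcont hmaps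
    exact (h1.clm_apply (continuousOn_const.prodMk
      (hQ.continuousOn_variation.prodMk hQ.continuousOn_velocityVariation))).congr
      fun p hp => (hderiv p hp).deriv

/-- The first variation of the action. -/
theorem hasDerivAt_action {q : ℝ → S} {ε : ℝ} (hQ : IsVariation (𝓡 d) t₀ t₁ q ε Q) :
    ContinuousOn (fun t => deriv (fun r => D.density t₀ t₁ Q r t) 0) (Icc t₀ t₁) ∧
    HasDerivAt (fun r => action (𝓡 d) D.lagrangian t₀ t₁ (Q r))
      (∫ t in t₀..t₁, deriv (fun r => D.density t₀ t₁ Q r t) 0) 0 := by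
  refine hasDerivAt_integral_of_locally (f := D.density t₀ t₁ Q)
    (f' := fun r t => deriv (fun r => D.density t₀ t₁ Q r t) r) h.le fun t ht => ?_
  obtain ⟨ρ, α, β, -, hn, hF⟩ := hQ.exists_isC1Family h ht
  obtain ⟨h1, h2, h3⟩ := D.density_regularity h hT hJ hF
  exact ⟨ρ, hF.pos, Icc α β, hn, h1, h2, fun p hp => (h3 p hp).differentiableAt.hasDerivAt⟩

end Data

end

/-! ### Solutions of the Euler-Lagrange equations are stationary. -/

section

variable {d : ℕ} {T : Set ℝ} {S : Type*} [TopologicalSpace S]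
  [ChartedSpace (ModelS d) S] [IsManifold (𝓡 d) 2 S]

namespace Data

variable (D : Data d T S) {t₀ t₁ : ℝ} {q : ℝ → S} {Q : ℝ → ℝ → S} {x₀ : S} {ρ α β : ℝ}

/-- The Euler-Lagrange equations concern fixed directions, whereas the variation field moves.
Expanding it in a fixed basis makes the product rule applicable. -/
theorem momentum_eq_sum (w : ModelS d) (t : ℝ) :
    D.momentum t₀ t₁ q x₀ w t
      = ∑ i, w i * D.momentum t₀ t₁ q x₀ (EuclideanSpace.basisFun (Fin d) ℝ i) t := by
  conv_lhs => rw [← (EuclideanSpace.basisFun (Fin d) ℝ).sum_repr w]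
  simp only [momentum, map_sum, map_smul, smul_eq_mul, EuclideanSpace.basisFun_repr]

theorem force_eq_sum (w : ModelS d) (t : ℝ) :
    D.force t₀ t₁ q x₀ w t
      = ∑ i, w i * D.force t₀ t₁ q x₀ (EuclideanSpace.basisFun (Fin d) ℝ i) t := by
  conv_lhs => rw [← (EuclideanSpace.basisFun (Fin d) ℝ).sum_repr w]
  simp only [force, map_sum, map_smul, smul_eq_mul, EuclideanSpace.basisFun_repr]

/-- The derivative of the momentum in a moving direction. -/
theorem hasDerivWithinAt_momentum_moving {J : Set ℝ} {t : ℝ} {w : ℝ → ModelS d} {w' : ModelS d}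
    (H : ∀ w, HasDerivWithinAt (D.momentum t₀ t₁ q x₀ w) (D.force t₀ t₁ q x₀ w t) J t)
    (hw : HasDerivWithinAt w w' J t) :
    HasDerivWithinAt (fun u => D.momentum t₀ t₁ q x₀ (w u) u)
      (D.force t₀ t₁ q x₀ (w t) t + D.momentum t₀ t₁ q x₀ w' t) J t := by
  have h1 : ∀ i, HasDerivWithinAt (fun u => w u i) (w' i) J t := fun i =>
    (EuclideanSpace.proj (𝕜 := ℝ) i).hasFDerivAt.comp_hasDerivWithinAt t hw
  have h2 := HasDerivWithinAt.fun_sum (u := Finset.univ) fun i _ =>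
    (h1 i).fun_mul (H (EuclideanSpace.basisFun (Fin d) ℝ i))
  rw [Finset.sum_add_distrib, ← momentum_eq_sum, ← force_eq_sum, add_comm] at h2
  exact h2.congr (fun u _ => D.momentum_eq_sum _ _) (D.momentum_eq_sum _ _)

omit [IsManifold (𝓡 d) 2 S] in
theorem chartCurve_congr {J : Set ℝ} {q₁ q₂ : ℝ → S} (h : ∀ t ∈ J, q₁ t = q₂ t) :
    ∀ t ∈ J, chartCurve (𝓡 d) x₀ q₁ t = chartCurve (𝓡 d) x₀ q₂ t :=
  fun t ht => congrArg _ (h t ht)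

variable (h : t₀ < t₁) (hT : IsOpen T) (hJ : Icc t₀ t₁ ⊆ T)
include h hT hJ

/-- The derivative at `r = 0` of the density of the action of a family of curves. -/
theorem deriv_density_zero (hbase : ∀ t ∈ Icc t₀ t₁, Q 0 t = q t)
    (hQ : IsC1Family (d := d) t₀ t₁ Q x₀ ρ α β) {t : ℝ} (ht : t ∈ Icc α β) :
    deriv (fun r => D.density t₀ t₁ Q r t) 0
      = D.force t₀ t₁ q x₀ (familyVariation Q x₀ 0 t) t
        + D.momentum t₀ t₁ q x₀ (familyVelocityVariation t₀ t₁ Q x₀ 0 t) t := by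
  have h1 := ((D.density_regularity h hT hJ hQ).2.2 (0, t) (hQ.mem_zero ht)).deriv
  simp only at h1
  have hz : chartCurve (𝓡 d) x₀ (Q 0) t ∈ (extChartAt (𝓡 d) x₀).target :=
    (extChartAt (𝓡 d) x₀).map_source (hQ.source _ (hQ.mem_zero ht))
  rw [h1, D.fderiv_lagrangianCoord_apply hT (hJ (hQ.subset ht)) hz, force, momentum,
    chartCurve_congr hbase t (hQ.subset ht), familyVelocity,
    derivWithin_congr (chartCurve_congr hbase) (chartCurve_congr hbase t (hQ.subset ht))]

/-- The pairing of the momentum with the variation field, independently of charts. -/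
def pairing (t₀ t₁ : ℝ) (Q : ℝ → ℝ → S) (t : ℝ) : ℝ :=
  1 / D.ψ t (Q 0 t) * D.a t (Q 0 t) (velocity (𝓡 d) (Icc t₀ t₁) (Q 0) t)
      (velocity (𝓡 d) univ (fun r => Q r t) 0)
    + D.b t (Q 0 t) (velocity (𝓡 d) univ (fun r => Q r t) 0)

-- In coordinates the fibre derivative of L at v is a(v, ·)/ψ + b, an expression that does not
-- depend on the chart. The local pairings therefore glue to one function on the whole interval.
omit hT in
theorem pairing_eq (hbase : ∀ t ∈ Icc t₀ t₁, Q 0 t = q t)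
    (hQ : IsC1Family (d := d) t₀ t₁ Q x₀ ρ α β) {t : ℝ} (ht : t ∈ Icc α β) :
    D.pairing t₀ t₁ Q t = D.momentum t₀ t₁ q x₀ (familyVariation Q x₀ 0 t) t := by
  have ht0 := hQ.subset ht
  have hp := hQ.mem_zero ht
  have hsrc := hQ.source _ hp
  have hv := velocity_eq_chartVector (uniqueDiffOn_Icc h t ht0) (hQ.continuousWithinAt _ hp)
    hsrc (hQ.hasDerivWithinAt _ hp)
  have hν := velocity_eq_chartVector (γ := fun r => Q r t) (s := 0) uniqueDiffWithinAt_univ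
    (hQ.continuousAt _ hp).continuousWithinAt hsrc (hQ.hasDerivAt _ hp).hasDerivWithinAt
  have hz : (extChartAt (𝓡 d) x₀).symm (chartCurve (𝓡 d) x₀ (Q 0) t) = Q 0 t :=
    (extChartAt (𝓡 d) x₀).left_inv hsrc
  have key : ∀ (y : S) (X Y : TangentSpace (𝓡 d) y) (u v : ModelS d),
      y = (extChartAt (𝓡 d) x₀).symm (chartCurve (𝓡 d) x₀ (Q 0) t) →
      (X : ModelS d) = chartVector (𝓡 d) x₀ (chartCurve (𝓡 d) x₀ (Q 0) t) u →
      (Y : ModelS d) = chartVector (𝓡 d) x₀ (chartCurve (𝓡 d) x₀ (Q 0) t) v →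
      1 / D.ψ t y * D.a t y X Y + D.b t y Y
        = 1 / D.cψ x₀ t (chartCurve (𝓡 d) x₀ (Q 0) t)
            * D.cA x₀ t (chartCurve (𝓡 d) x₀ (Q 0) t) u v
          + D.cB x₀ t (chartCurve (𝓡 d) x₀ (Q 0) t) v := by
    rintro y X Y u v rfl hX hY
    exact congrArg₂ (fun X Y => 1 / D.ψ t _ * D.a t _ X Y + D.b t _ Y) hX hY
  rw [momentum, D.fderiv_lagrangianCoord_velocity (hJ ht0),
    ← chartCurve_congr hbase t ht0,
    ← derivWithin_congr (chartCurve_congr hbase) (chartCurve_congr hbase t ht0)]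
  exact key _ _ _ _ _ hz.symm hv hν

/-- A solution of the Euler-Lagrange equations is a stationary point. -/
theorem isStationary_of_satisfiesEulerLagrange
    (H : SatisfiesEulerLagrange (𝓡 d) D.lagrangian univ (Icc t₀ t₁) q) :
    IsStationary (𝓡 d) D.lagrangian t₀ t₁ q := by
  rw [satisfiesEulerLagrange_iff] at H
  intro ε Q hQ
  obtain ⟨hc, hd⟩ := D.hasDerivAt_action h hT hJ hQ
  -- With δ the variation field, p the momentum and F the force, the product rule gives (p·δ)' = F·δ
  -- + p·δ', which is the integrand of the first variation.
  have hN : ∀ t ∈ Icc t₀ t₁, HasDerivWithinAt (D.pairing t₀ t₁ Q)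
      (deriv (fun r => D.density t₀ t₁ Q r t) 0) (Icc t₀ t₁) t := by
    intro t ht
    obtain ⟨ρ, α, β, htαβ, hn, hF⟩ := hQ.exists_isC1Family h ht
    rw [D.deriv_density_zero h hT hJ hQ.base hF htαβ]
    refine HasDerivWithinAt.mono_of_mem_nhdsWithin (t := Icc α β) ?_ hn
    refine HasDerivWithinAt.congr ?_
      (fun u hu => D.pairing_eq h hJ hQ.base hF hu) (D.pairing_eq h hJ hQ.base hF htαβ)
    exact D.hasDerivWithinAt_momentum_moving (fun w => (H t ht w).mono hF.subset)
      (hF.hasDerivWithinAt_variation htαβ)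
  -- With fixed endpoints the variation field vanishes there, hence so do the boundary terms.
  have hend : ∀ t ∈ Icc t₀ t₁, (∀ r ∈ Ioo (-ε) ε, Q r t = q t) → D.pairing t₀ t₁ Q t = 0 := by
    intro t ht hconst
    obtain ⟨ρ, α, β, htαβ, hn, hF⟩ := hQ.exists_isC1Family h ht
    rw [D.pairing_eq h hJ hQ.base hF htαβ]
    have : familyVariation (d := d) Q (q t) 0 t = 0 := by
      refine HasDerivAt.deriv ((hasDerivAt_const 0 (extChartAt (𝓡 d) (q t) (q t))
        ).congr_of_eventuallyEq ?_)
      filter_upwards [Ioo_mem_nhds (neg_lt_zero.2 hQ.pos) hQ.pos] with r hr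
      exact congrArg _ (hconst r hr)
    rw [this, momentum, map_zero]
  have hint := intervalIntegral.integral_eq_sub_of_hasDerivAt_of_le h.le
    (fun t ht => (hN t ht).continuousWithinAt)
    (fun t ht => (hN t (Ioo_subset_Icc_self ht)).hasDerivAt (Icc_mem_nhds ht.1 ht.2))
    (hc.intervalIntegrable_of_Icc h.le)
  rw [hend t₁ (right_mem_Icc.2 h.le) hQ.right, hend t₀ (left_mem_Icc.2 h.le) hQ.left,
    sub_zero] at hint
  rwa [hint] at hd

end Data

end

/-! ### Variations supported in a chart. -/

section

variable {d : ℕ} {T : Set ℝ} {S : Type*} [TopologicalSpace S]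
  [ChartedSpace (ModelS d) S] [IsManifold (𝓡 d) 2 S]

section ChartVariation

theorem eventually_nhdsWithin_prod_snd {I J : Set ℝ} {P : ℝ → Prop} {r t : ℝ}
    (hP : ∀ᶠ u in 𝓝[J] t, P u) : ∀ᶠ p : ℝ × ℝ in 𝓝[I ×ˢ J] (r, t), P p.2 := by
  rw [nhdsWithin_prod_eq]
  exact Filter.tendsto_snd.eventually hP

open Classical in
/-- The variation of a curve by adding a multiple of a vector field in the chart around `x₀`,
for parameters in `[α, β]`. -/
def chartVariation (q : ℝ → S) (x₀ : S) (α β : ℝ) (η : ℝ → ModelS d) (r t : ℝ) : S :=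
  if t ∈ Icc α β then (extChartAt (𝓡 d) x₀).symm (chartCurve (𝓡 d) x₀ q t + r • η t) else q t

variable {q : ℝ → S} {x₀ : S} {t₀ t₁ α β : ℝ} {η η' : ℝ → ModelS d}

omit [IsManifold (𝓡 d) 2 S] in
theorem chartVariation_of_notMem (r : ℝ) {t : ℝ} (ht : t ∉ Icc α β) :
    chartVariation q x₀ α β η r t = q t := if_neg ht

-- The field vanishes off the open interval, so the chart formula reproduces q there. It thus holds
-- on both sides of α and β, and the definition by cases causes no loss of regularity.
omit [IsManifold (𝓡 d) 2 S] in
theorem chartVariation_of_mem_source (hη0 : ∀ t, t ∉ Ioo α β → η t = 0) (r : ℝ) {t : ℝ}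
    (ht : q t ∈ (extChartAt (𝓡 d) x₀).source) :
    chartVariation q x₀ α β η r t
      = (extChartAt (𝓡 d) x₀).symm (chartCurve (𝓡 d) x₀ q t + r • η t) := by
  by_cases hm : t ∈ Icc α β
  · exact if_pos hm
  · rw [chartVariation_of_notMem r hm, hη0 t fun h => hm (Ioo_subset_Icc_self h), smul_zero,
      add_zero]
    exact ((extChartAt (𝓡 d) x₀).left_inv ht).symm

omit [IsManifold (𝓡 d) 2 S] in
theorem chartVariation_of_eq_zero (hη0 : ∀ t, t ∉ Ioo α β → η t = 0)
    (hsrc : ∀ t ∈ Icc α β, q t ∈ (extChartAt (𝓡 d) x₀).source) (r : ℝ) {t : ℝ}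
    (ht : r • η t = 0) : chartVariation q x₀ α β η r t = q t := by
  by_cases hm : t ∈ Icc α β
  · rw [chartVariation_of_mem_source hη0 r (hsrc t hm), ht, add_zero]
    exact (extChartAt (𝓡 d) x₀).left_inv (hsrc t hm)
  · exact chartVariation_of_notMem r hm

-- The target of the chart is open and `[α, β]` is compact, so one bound on r works for all times.
omit [IsManifold (𝓡 d) 2 S] in
theorem exists_add_smul_mem_target {c : ℝ → ModelS d} (hc : ContinuousOn c (Icc α β))
    (hct : ∀ t ∈ Icc α β, c t ∈ (extChartAt (𝓡 d) x₀).target) (hη : Continuous η) :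
    ∃ ε : ℝ, 0 < ε ∧ ∀ r ∈ Ioo (-ε) ε, ∀ t ∈ Icc α β,
      c t + r • η t ∈ (extChartAt (𝓡 d) x₀).target := by
  have hev : ∀ᶠ r in 𝓝 (0 : ℝ), ∀ t ∈ Icc α β, t ∈ Icc α β →
      c t + r • η t ∈ (extChartAt (𝓡 d) x₀).target := by
    refine isCompact_Icc.eventually_forall_of_forall_eventually fun t ht => ?_
    have h1 : ContinuousWithinAt (fun p : ℝ × ℝ => c p.2 + p.1 • η p.2) (univ ×ˢ Icc α β)
        ((0 : ℝ), t) :=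
      ((hc t ht).comp continuousWithinAt_snd fun p hp => hp.2).add
        ((continuous_fst.smul (hη.comp continuous_snd)).continuousWithinAt)
    have h2 := h1.eventually_mem ((isOpen_extChartAt_target x₀).mem_nhds
      (by simpa only [zero_smul, add_zero] using hct t ht))
    rw [eventually_nhdsWithin_iff] at h2
    filter_upwards [h2] with p hp hp2
    exact hp ⟨mem_univ _, hp2⟩
  obtain ⟨ε, hε, hsub⟩ := Metric.mem_nhds_iff.1 hev
  rw [Real.ball_eq_Ioo, zero_sub, zero_add] at hsub
  exact ⟨ε, hε, fun r hr t ht => hsub hr t ht ht⟩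

variable (h : t₀ < t₁) (hq : ContMDiffOn 𝓘(ℝ, ℝ) (𝓡 d) 1 q (Icc t₀ t₁))
  (hsrc : ∀ t ∈ Icc α β, q t ∈ (extChartAt (𝓡 d) x₀).source)
  (hη' : Continuous η') (hη : ∀ t, HasDerivAt η (η' t) t) (hη0 : ∀ t, t ∉ Ioo α β → η t = 0)

omit [IsManifold (𝓡 d) 2 S] in
theorem isOpen_coordChange_source (x₀ x₁ : S) :
    IsOpen ((extChartAt (𝓡 d) x₀).symm ≫ extChartAt (𝓡 d) x₁).source := by
  rw [PartialEquiv.trans_source, PartialEquiv.symm_source]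
  exact (continuousOn_extChartAt_symm x₀).isOpen_inter_preimage (isOpen_extChartAt_target x₀)
    (isOpen_extChartAt_source x₁)

-- Applied to a transition map κ: in another chart the velocity of the varied curve is κ'(c + r e)(v
-- + r e'), so its r-derivative involves κ''. This is where transition maps have to be C².
omit [IsManifold (𝓡 d) 2 S] in
theorem hasDerivAt_fderiv_line {F : Type*} [NormedAddCommGroup F] [NormedSpace ℝ F]
    {κ : F → F} {O : Set F} (hO : IsOpen O) (hκ : ContDiffOn ℝ 2 κ O)
    {c e v e' : F} {r : ℝ} (hc : c + r • e ∈ O) :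
    HasDerivAt (fun r : ℝ => fderiv ℝ κ (c + r • e) (v + r • e'))
      (fderiv ℝ (fderiv ℝ κ) (c + r • e) e (v + r • e') + fderiv ℝ κ (c + r • e) e') r := by
  have hκ1 : ContDiffOn ℝ 1 (fderiv ℝ κ) O := hκ.fderiv_of_isOpen hO (by norm_num)
  have hl : ∀ a b : F, HasDerivAt (fun r : ℝ => a + r • b) b r := fun a b => by
    simpa only [one_smul, id] using ((hasDerivAt_id r).smul_const b).const_add a
  have h1 : HasFDerivAt (fderiv ℝ κ) (fderiv ℝ (fderiv ℝ κ) (c + r • e)) (c + r • e) :=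
    ((hκ1.contDiffAt (hO.mem_nhds hc)).differentiableAt one_ne_zero).hasFDerivAt
  have h2 : HasDerivAt (fun r : ℝ => fderiv ℝ κ (c + r • e))
      (fderiv ℝ (fderiv ℝ κ) (c + r • e) e) r := h1.comp_hasDerivAt r (hl c e)
  exact h2.clm_apply (hl v e')

include h hq

omit h in
theorem contDiffWithinAt_chartCurve_add {r t : ℝ} (ht : t ∈ Icc t₀ t₁)
    (hx : q t ∈ (extChartAt (𝓡 d) x₀).source) (hηc : ContDiff ℝ 1 η) :
    ContDiffWithinAt ℝ 1 (fun p : ℝ × ℝ => chartCurve (𝓡 d) x₀ q p.2 + p.1 • η p.2)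
      (univ ×ˢ Icc t₀ t₁) (r, t) := by
  have h1 : ContDiffWithinAt ℝ 1 (fun p : ℝ × ℝ => chartCurve (𝓡 d) x₀ q p.2)
      (univ ×ˢ Icc t₀ t₁) (r, t) :=
    ContDiffWithinAt.comp (g := chartCurve (𝓡 d) x₀ q) (r, t)
      (contDiffWithinAt_chartCurve one_le_two (hq t ht) hx) contDiffWithinAt_snd fun _ hp => hp.2
  exact h1.add (contDiff_fst.smul (hηc.comp contDiff_snd)).contDiffWithinAt

include hη hη0

omit h in
/-- The velocity of the variation in any chart. -/
theorem hasDerivWithinAt_chartVariation {x₁ : S} {r t : ℝ} (ht : t ∈ Icc t₀ t₁)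
    (hx : q t ∈ (extChartAt (𝓡 d) x₀).source)
    (hO : chartCurve (𝓡 d) x₀ q t + r • η t ∈
      ((extChartAt (𝓡 d) x₀).symm ≫ extChartAt (𝓡 d) x₁).source) :
    HasDerivWithinAt (chartCurve (𝓡 d) x₁ (chartVariation q x₀ α β η r))
      (fderiv ℝ (extChartAt (𝓡 d) x₁ ∘ (extChartAt (𝓡 d) x₀).symm)
        (chartCurve (𝓡 d) x₀ q t + r • η t)
        (derivWithin (chartCurve (𝓡 d) x₀ q) (Icc t₀ t₁) t + r • η' t)) (Icc t₀ t₁) t := by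
  have hOo := isOpen_coordChange_source (d := d) x₀ x₁
  have h1 := ((((contDiffOn_ext_coord_change (I := 𝓡 d) (n := 2) x₁ x₀).contDiffAt
    (hOo.mem_nhds hO)).differentiableAt two_ne_zero).hasFDerivAt)
  have h2 := (hasDerivWithinAt_chartCurve hq ht hx).fun_add
    ((hη t).hasDerivWithinAt.const_smul r (s := Icc t₀ t₁))
  refine (h1.comp_hasDerivWithinAt t h2).congr_of_eventuallyEq ?_ ?_
  · filter_upwards [eventually_mem_source hq ht hx] with u hu
    exact congrArg (extChartAt (𝓡 d) x₁) (chartVariation_of_mem_source hη0 r hu)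
  · exact congrArg (extChartAt (𝓡 d) x₁) (chartVariation_of_mem_source hη0 r hx)

omit hη

omit h in
theorem contMDiffWithinAt_chartVariation {ε r t : ℝ}
    (hsrc : ∀ t ∈ Icc α β, q t ∈ (extChartAt (𝓡 d) x₀).source) (hηc : ContDiff ℝ 1 η)
    (ht : t ∈ Icc t₀ t₁) (hGt : q t ∈ (extChartAt (𝓡 d) x₀).source →
      chartCurve (𝓡 d) x₀ q t + r • η t ∈ (extChartAt (𝓡 d) x₀).target) :
    ContMDiffWithinAt 𝓘(ℝ, ℝ × ℝ) (𝓡 d) 1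
      (fun p : ℝ × ℝ => chartVariation q x₀ α β η p.1 p.2) (Ioo (-ε) ε ×ˢ Icc t₀ t₁) (r, t) := by
  have : IsManifold (𝓡 d) 1 S := IsManifold.of_le one_le_two
  by_cases hx : q t ∈ (extChartAt (𝓡 d) x₀).source
  · have h1 := (contDiffWithinAt_chartCurve_add hq (r := r) ht hx hηc).mono
      (prod_mono (subset_univ (Ioo (-ε) ε)) le_rfl)
    have h2 := ((contMDiffOn_extChartAt_symm (I := 𝓡 d) (n := 1) x₀).contMDiffAt
      ((isOpen_extChartAt_target x₀).mem_nhds (hGt hx))).comp_contMDiffWithinAt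
      (r, t) h1.contMDiffWithinAt
    refine h2.congr_of_eventuallyEq ?_ (chartVariation_of_mem_source hη0 r hx)
    filter_upwards [eventually_nhdsWithin_prod_snd (eventually_mem_source hq ht hx)] with p hp
    exact chartVariation_of_mem_source hη0 p.1 hp
  · have hm : t ∉ Icc α β := fun hm => hx (hsrc t hm)
    have hsnd : ContMDiffWithinAt 𝓘(ℝ, ℝ × ℝ) 𝓘(ℝ, ℝ) 1 (fun p : ℝ × ℝ => p.2)
        (Ioo (-ε) ε ×ˢ Icc t₀ t₁) (r, t) := contDiff_snd.contMDiff.contMDiffAt.contMDiffWithinAt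
    have h2 : ContMDiffWithinAt 𝓘(ℝ, ℝ × ℝ) (𝓡 d) 1 (fun p : ℝ × ℝ => q p.2)
        (Ioo (-ε) ε ×ˢ Icc t₀ t₁) (r, t) :=
      ContMDiffWithinAt.comp (g := q) (r, t) (hq t ht) hsnd fun p hp => hp.2
    refine h2.congr_of_eventuallyEq ?_ (chartVariation_of_notMem r hm)
    filter_upwards [eventually_nhdsWithin_prod_snd
      (mem_nhdsWithin_of_mem_nhds (isClosed_Icc.isOpen_compl.mem_nhds hm))] with p hp
    exact chartVariation_of_notMem p.1 hp

include hη hη'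

/-- The condition on mixed derivatives refers to a chart around the current point, in general not
the chart defining the variation, hence the transition map. The result involves only c and c', so q
being C¹ is enough. -/
theorem mixed_chartVariation_of_mem_source {ε r t : ℝ} {x₁ : S} (ht : t ∈ Icc t₀ t₁)
    (hx : q t ∈ (extChartAt (𝓡 d) x₀).source) (hηc : ContDiff ℝ 1 η)
    (hO : chartCurve (𝓡 d) x₀ q t + r • η t ∈
      ((extChartAt (𝓡 d) x₀).symm ≫ extChartAt (𝓡 d) x₁).source) :
    ∃ V ∈ 𝓝[Ioo (-ε) ε ×ˢ Icc t₀ t₁] (r, t),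
      (∀ p ∈ V, DifferentiableAt ℝ (fun r => derivWithin
        (chartCurve (𝓡 d) x₁ (chartVariation q x₀ α β η r)) (Icc t₀ t₁) p.2) p.1) ∧
      ContinuousOn (fun p : ℝ × ℝ => deriv (fun r => derivWithin
        (chartCurve (𝓡 d) x₁ (chartVariation q x₀ α β η r)) (Icc t₀ t₁) p.2) p.1) V := by
  have hOo := isOpen_coordChange_source (d := d) x₀ x₁
  have hκ2 : ContDiffOn ℝ 2 (extChartAt (𝓡 d) x₁ ∘ (extChartAt (𝓡 d) x₀).symm)
    ((extChartAt (𝓡 d) x₀).symm ≫ extChartAt (𝓡 d) x₁).source :=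
    contDiffOn_ext_coord_change x₁ x₀
  have hvel : ∀ r : ℝ, ∀ u ∈ Icc t₀ t₁, q u ∈ (extChartAt (𝓡 d) x₀).source →
      chartCurve (𝓡 d) x₀ q u + r • η u ∈
        ((extChartAt (𝓡 d) x₀).symm ≫ extChartAt (𝓡 d) x₁).source →
      derivWithin (chartCurve (𝓡 d) x₁ (chartVariation q x₀ α β η r)) (Icc t₀ t₁) u
        = fderiv ℝ (extChartAt (𝓡 d) x₁ ∘ (extChartAt (𝓡 d) x₀).symm)
          (chartCurve (𝓡 d) x₀ q u + r • η u)
          (derivWithin (chartCurve (𝓡 d) x₀ q) (Icc t₀ t₁) u + r • η' u) :=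
    fun r u hu hux huO => (hasDerivWithinAt_chartVariation hq hη hη0 hu hux huO).derivWithin
      (uniqueDiffOn_Icc h u hu)
  -- From here on only the C² regularity of the transition map κ on the open set O is used, together
  -- with the velocity formula.
  generalize extChartAt (𝓡 d) x₁ ∘ (extChartAt (𝓡 d) x₀).symm = κ at hκ2 hvel
  generalize ((extChartAt (𝓡 d) x₀).symm ≫ extChartAt (𝓡 d) x₁).source = O at *
  have hκ1 : ContDiffOn ℝ 1 (fderiv ℝ κ) O := hκ2.fderiv_of_isOpen hOo (by norm_num)
  have hκ0 : ContinuousOn (fderiv ℝ (fderiv ℝ κ)) O :=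
    hκ1.continuousOn_fderiv_of_isOpen hOo le_rfl
  set V : Set (ℝ × ℝ) := {p | p ∈ Ioo (-ε) ε ×ˢ Icc t₀ t₁ ∧
    q p.2 ∈ (extChartAt (𝓡 d) x₀).source ∧
      chartCurve (𝓡 d) x₀ q p.2 + p.1 • η p.2 ∈ O} with hV
  have hGc : ∀ p : ℝ × ℝ, p.2 ∈ Icc t₀ t₁ → q p.2 ∈ (extChartAt (𝓡 d) x₀).source →
      ContinuousWithinAt (fun p : ℝ × ℝ => chartCurve (𝓡 d) x₀ q p.2 + p.1 • η p.2)
        (Ioo (-ε) ε ×ˢ Icc t₀ t₁) p := fun p hp hpx =>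
    (contDiffWithinAt_chartCurve_add hq (r := p.1) hp hpx hηc).continuousWithinAt.mono
      (prod_mono (subset_univ (Ioo (-ε) ε)) le_rfl)
  have hd : ∀ p ∈ V,
      HasDerivAt (fun r => derivWithin (chartCurve (𝓡 d) x₁ (chartVariation q x₀ α β η r))
        (Icc t₀ t₁) p.2)
        (fderiv ℝ (fderiv ℝ κ) (chartCurve (𝓡 d) x₀ q p.2 + p.1 • η p.2) (η p.2)
          (derivWithin (chartCurve (𝓡 d) x₀ q) (Icc t₀ t₁) p.2 + p.1 • η' p.2)
          + fderiv ℝ κ (chartCurve (𝓡 d) x₀ q p.2 + p.1 • η p.2) (η' p.2)) p.1 := by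
    intro p hp
    refine (hasDerivAt_fderiv_line hOo hκ2 hp.2.2).congr_of_eventuallyEq ?_
    have hline : ContinuousAt (fun r : ℝ => chartCurve (𝓡 d) x₀ q p.2 + r • η p.2) p.1 := by
      fun_prop
    filter_upwards [hline.eventually_mem (hOo.mem_nhds hp.2.2)] with r' hr'
    exact hvel r' p.2 hp.1.2 hp.2.1 hr'
  refine ⟨V, ?_, fun p hp => (hd p hp).differentiableAt, ?_⟩
  · have e1 := (hGc (r, t) ht hx).eventually_mem (hOo.mem_nhds hO)
    have e2 : ∀ᶠ p : ℝ × ℝ in 𝓝[Ioo (-ε) ε ×ˢ Icc t₀ t₁] (r, t),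
        q p.2 ∈ (extChartAt (𝓡 d) x₀).source :=
      eventually_nhdsWithin_prod_snd (eventually_mem_source hq ht hx)
    have e3 : ∀ᶠ p in 𝓝[Ioo (-ε) ε ×ˢ Icc t₀ t₁] (r, t), p ∈ Ioo (-ε) ε ×ˢ Icc t₀ t₁ :=
      self_mem_nhdsWithin
    exact e3.and (e2.and e1)
  refine ContinuousOn.congr ?_ fun p hp => (hd p hp).deriv
  have hGcV : ContinuousOn (fun p : ℝ × ℝ => chartCurve (𝓡 d) x₀ q p.2 + p.1 • η p.2) V :=
    fun p hp => (hGc p hp.1.2 hp.2.1).mono fun x hx => hx.1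
  have hGm : MapsTo (fun p : ℝ × ℝ => chartCurve (𝓡 d) x₀ q p.2 + p.1 • η p.2) V O :=
    fun p hp => hp.2.2
  have hηcont : ContinuousOn (fun p : ℝ × ℝ => η p.2) V :=
    (hηc.continuous.comp continuous_snd).continuousOn
  have hη'cont : ContinuousOn (fun p : ℝ × ℝ => η' p.2) V :=
    (hη'.comp continuous_snd).continuousOn
  have hc' : ContinuousOn (fun p : ℝ × ℝ =>
      derivWithin (chartCurve (𝓡 d) x₀ q) (Icc t₀ t₁) p.2) V := fun p hp =>
    ContinuousWithinAt.comp (g := derivWithin (chartCurve (𝓡 d) x₀ q) (Icc t₀ t₁))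
      (t := Icc t₀ t₁)
      (ContDiffWithinAt.derivWithin_right' (m := 0)
        (contDiffWithinAt_chartCurve one_le_two (hq p.2 hp.1.2) hp.2.1)
        (uniqueDiffOn_Icc h) (by simp) hp.1.2).continuousWithinAt
      continuousWithinAt_snd fun x hx => hx.1.2
  exact (((hκ0.comp hGcV hGm).clm_apply hηcont).clm_apply
    (hc'.add (continuousOn_fst.smul hη'cont))).add
    ((hκ1.continuousOn.comp hGcV hGm).clm_apply hη'cont)

include hsrc

/-- The variations in a chart are `C¹` families of `C¹` curves. -/
theorem isVariation_chartVariation (hsub : Icc α β ⊆ Icc t₀ t₁) {ε : ℝ} (hε : 0 < ε)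
    (hεt : ∀ r ∈ Ioo (-ε) ε, ∀ t ∈ Icc α β,
      chartCurve (𝓡 d) x₀ q t + r • η t ∈ (extChartAt (𝓡 d) x₀).target) :
    IsVariation (𝓡 d) t₀ t₁ q ε (chartVariation q x₀ α β η) := by
  have hηc : ContDiff ℝ 1 η := by
    rw [contDiff_one_iff_deriv]
    exact ⟨fun t => (hη t).differentiableAt, by rwa [show deriv η = η' from
      funext fun t => (hη t).deriv]⟩
  have hend : ∀ t, t ∉ Ioo t₀ t₁ → ∀ r, chartVariation q x₀ α β η r t = q t := by
    intro t ht r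
    have hαβ : t ∉ Ioo α β := by
      intro hm
      have hI := (Icc_subset_Icc_iff (hm.1.trans hm.2).le).1 hsub
      exact ht ⟨hI.1.trans_lt hm.1, hm.2.trans_le hI.2⟩
    exact chartVariation_of_eq_zero hη0 hsrc r (by rw [hη0 t hαβ, smul_zero])
  have hGt : ∀ r ∈ Ioo (-ε) ε, ∀ t, q t ∈ (extChartAt (𝓡 d) x₀).source →
      chartCurve (𝓡 d) x₀ q t + r • η t ∈ (extChartAt (𝓡 d) x₀).target := by
    intro r hr t ht
    by_cases hm : t ∈ Icc α β
    · exact hεt r hr t hm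
    · rw [hη0 t fun h => hm (Ioo_subset_Icc_self h), smul_zero, add_zero]
      exact (extChartAt (𝓡 d) x₀).map_source ht
  refine ⟨hε, fun t _ => chartVariation_of_eq_zero hη0 hsrc 0 (zero_smul _ _),
    fun r _ => hend t₀ (fun h => lt_irrefl _ h.1) r,
    fun r _ => hend t₁ (fun h => lt_irrefl _ h.2) r,
    fun p hp => contMDiffWithinAt_chartVariation hq hη0 hsrc hηc hp.2 (hGt p.1 hp.1 p.2), ?_⟩
  rintro ⟨r, t⟩ ⟨hr, ht⟩
  by_cases hx : q t ∈ (extChartAt (𝓡 d) x₀).source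
  · refine mixed_chartVariation_of_mem_source h hq hη' hη hη0 ht hx hηc ?_
    rw [PartialEquiv.trans_source, PartialEquiv.symm_source]
    refine ⟨hGt r hr t hx, ?_⟩
    rw [mem_preimage, ← chartVariation_of_mem_source hη0 r hx]
    exact mem_extChartAt_source _
  · have hm : t ∉ Icc α β := fun hm => hx (hsrc t hm)
    set x₁ := chartVariation q x₀ α β η r t
    have hconst : ∀ u ∉ Icc α β, ∀ r, derivWithin
        (chartCurve (𝓡 d) x₁ (chartVariation q x₀ α β η r)) (Icc t₀ t₁) u
        = derivWithin (chartCurve (𝓡 d) x₁ q) (Icc t₀ t₁) u := by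
      intro u hu r
      refine Filter.EventuallyEq.derivWithin_eq ?_ ?_
      · filter_upwards [mem_nhdsWithin_of_mem_nhds (isClosed_Icc.isOpen_compl.mem_nhds hu)]
          with u' hu'
        exact congrArg (extChartAt (𝓡 d) x₁) (chartVariation_of_notMem r hu')
      · exact congrArg (extChartAt (𝓡 d) x₁) (chartVariation_of_notMem r hu)
    refine ⟨{p | p.2 ∉ Icc α β}, eventually_nhdsWithin_prod_snd
      (mem_nhdsWithin_of_mem_nhds (isClosed_Icc.isOpen_compl.mem_nhds hm)), ?_, ?_⟩
    · intro p hp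
      simp only [hconst p.2 hp]
      exact differentiableAt_const _
    · refine (continuousOn_const (c := 0)).congr fun p hp => ?_
      simp only [hconst p.2 hp, deriv_const]

end ChartVariation

end

/-! ### Stationary curves satisfy the Euler-Lagrange equations. -/

section

variable {d : ℕ} {T : Set ℝ} {S : Type*} [TopologicalSpace S]
  [ChartedSpace (ModelS d) S] [IsManifold (𝓡 d) 2 S]

section Congr

variable {E : Type*} [NormedAddCommGroup E] [NormedSpace ℝ E]
  {H : Type*} [TopologicalSpace H] {I : ModelWithCorners ℝ E H}
  {N : Type*} [TopologicalSpace N] [ChartedSpace H N]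

theorem lagrangian_velocity_congr (L : ∀ x : N, TangentSpace I x → ℝ) {J : Set ℝ} {s : ℝ}
    {γ₁ γ₂ : ℝ → N} (h : γ₁ =ᶠ[𝓝[J] s] γ₂) (hs : γ₁ s = γ₂ s) :
    L (γ₁ s) (velocity I J γ₁ s) = L (γ₂ s) (velocity I J γ₂ s) := by
  have hv : (velocity I J γ₁ s : E) = velocity I J γ₂ s :=
    congrArg (fun A : ℝ →L[ℝ] E => A 1) (h.mfderivWithin_eq hs)
  have key : ∀ (y : N) (u : TangentSpace I (γ₂ s)) (w : TangentSpace I y), y = γ₂ s →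
      (u : E) = (w : E) → L y w = L (γ₂ s) u := by
    rintro y u w rfl huw
    exact congrArg _ huw.symm
  exact key _ _ _ hs hv.symm

theorem integral_eq_of_eqOn_zero {g : ℝ → ℝ} {a b α β : ℝ} (hα : a ≤ α) (hαβ : α ≤ β)
    (hβ : β ≤ b) (hg : ContinuousOn g (Icc a b)) (h0 : ∀ t ∈ Icc a b, t ∉ Icc α β → g t = 0) :
    ∫ t in a..b, g t = ∫ t in α..β, g t := by
  have hi : ∀ {x y}, a ≤ x → x ≤ y → y ≤ b → IntervalIntegrable g volume x y :=
    fun hx hxy hy => (hg.mono (Icc_subset_Icc hx hy)).intervalIntegrable_of_Icc hxy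
  have hz : ∀ {x y}, x ≤ y → (∀ t ∈ Ioo x y, g t = 0) → ∫ t in x..y, g t = 0 := by
    intro x y hxy h
    rw [intervalIntegral.integral_of_le hxy, integral_Ioc_eq_integral_Ioo]
    exact setIntegral_eq_zero_of_forall_eq_zero h
  rw [← intervalIntegral.integral_add_adjacent_intervals (b := α)
      (hi le_rfl hα (hαβ.trans hβ)) (hi hα (hαβ.trans hβ) le_rfl),
    ← intervalIntegral.integral_add_adjacent_intervals (a := α) (b := β)
      (hi hα hαβ hβ) (hi (hα.trans hαβ) hβ le_rfl),
    hz hα fun t ht => h0 t ⟨ht.1.le, ht.2.le.trans (hαβ.trans hβ)⟩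
      fun h => absurd h.1 (not_le.2 ht.2),
    hz hβ fun t ht => h0 t ⟨(hα.trans hαβ).trans ht.1.le, ht.2.le⟩
      fun h => absurd h.2 (not_le.2 ht.1)]
  simp

end Congr

namespace Data

variable (D : Data d T S) {t₀ t₁ : ℝ} {q : ℝ → S} {x₀ : S} {α β : ℝ}
  (h : t₀ < t₁) (hT : IsOpen T) (hJ : Icc t₀ t₁ ⊆ T)
  (hq : ContMDiffOn 𝓘(ℝ, ℝ) (𝓡 d) 1 q (Icc t₀ t₁))
  (hsub : Icc α β ⊆ Icc t₀ t₁) (hsrc : ∀ t ∈ Icc α β, q t ∈ (extChartAt (𝓡 d) x₀).source)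
include h hT hJ hq hsub hsrc

/-- The directions (0, 0, w) and (0, w, 0) give the continuity of momentum and force needed for the
du Bois-Reymond lemma. -/
theorem continuousOn_fderiv_lagrangianCoord (a b : ModelS d) :
    ContinuousOn (fun t => fderiv ℝ (fun p : ℝ × ModelS d × ModelS d =>
      lagrangianCoord (𝓡 d) D.lagrangian x₀ p.1 p.2.1 p.2.2)
      (t, chartCurve (𝓡 d) x₀ q t, derivWithin (chartCurve (𝓡 d) x₀ q) (Icc t₀ t₁) t)
      (0, a, b)) (Icc α β) := by
  have hO : IsOpen (T ×ˢ (extChartAt (𝓡 d) x₀).target ×ˢ (univ : Set (ModelS d))) :=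
    hT.prod ((isOpen_extChartAt_target x₀).prod isOpen_univ)
  have hc : ∀ t ∈ Icc α β, ContDiffWithinAt ℝ 1 (chartCurve (𝓡 d) x₀ q) (Icc t₀ t₁) t :=
    fun t ht => contDiffWithinAt_chartCurve one_le_two (hq t (hsub ht)) (hsrc t ht)
  refine (ContinuousOn.comp
    ((D.contDiffOn_lagrangianCoord x₀).continuousOn_fderiv_of_isOpen hO le_rfl)
    (f := fun t => (t, chartCurve (𝓡 d) x₀ q t,
      derivWithin (chartCurve (𝓡 d) x₀ q) (Icc t₀ t₁) t)) ?_ ?_).clm_apply continuousOn_const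
  · refine continuousOn_id.prodMk (ContinuousOn.prodMk ?_ ?_)
    · exact fun t ht => (hc t ht).continuousWithinAt.mono hsub
    · exact fun t ht => (ContDiffWithinAt.derivWithin_right' (m := 0) (hc t ht)
        (uniqueDiffOn_Icc h) (by simp) (hsub ht)).continuousWithinAt.mono hsub
  · exact fun t ht => ⟨hJ (hsub ht), (extChartAt (𝓡 d) x₀).map_source (hsrc t ht), mem_univ _⟩

theorem continuousOn_momentum (w : ModelS d) :
    ContinuousOn (D.momentum t₀ t₁ q x₀ w) (Icc α β) := by
  refine (D.continuousOn_fderiv_lagrangianCoord h hT hJ hq hsub hsrc 0 w).congr fun t ht => ?_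
  have hz : chartCurve (𝓡 d) x₀ q t ∈ (extChartAt (𝓡 d) x₀).target :=
    (extChartAt (𝓡 d) x₀).map_source (hsrc t ht)
  beta_reduce
  rw [D.fderiv_lagrangianCoord_apply hT (hJ (hsub ht)) hz, map_zero, zero_add, momentum]

theorem continuousOn_force (w : ModelS d) :
    ContinuousOn (D.force t₀ t₁ q x₀ w) (Icc α β) := by
  refine (D.continuousOn_fderiv_lagrangianCoord h hT hJ hq hsub hsrc w 0).congr fun t ht => ?_
  have hz : chartCurve (𝓡 d) x₀ q t ∈ (extChartAt (𝓡 d) x₀).target :=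
    (extChartAt (𝓡 d) x₀).map_source (hsrc t ht)
  beta_reduce
  rw [D.fderiv_lagrangianCoord_apply hT (hJ (hsub ht)) hz, map_zero, add_zero, force]

omit hJ hT in
theorem density_chartVariation {η η' : ℝ → ModelS d} (hη : ∀ t, HasDerivAt η (η' t) t)
    (hη0 : ∀ t, t ∉ Ioo α β → η t = 0) {r t : ℝ} (ht : t ∈ Icc α β)
    (hrt : chartCurve (𝓡 d) x₀ q t + r • η t ∈ (extChartAt (𝓡 d) x₀).target) :
    D.density t₀ t₁ (chartVariation q x₀ α β η) r t
      = lagrangianCoord (𝓡 d) D.lagrangian x₀ t (chartCurve (𝓡 d) x₀ q t + r • η t)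
        (derivWithin (chartCurve (𝓡 d) x₀ q) (Icc t₀ t₁) t + r • η' t) := by
  have ht0 := hsub ht
  have hx := hsrc t ht
  have hd := (hasDerivWithinAt_chartCurve hq ht0 hx).fun_add
    ((hη t).hasDerivWithinAt.const_smul r (s := Icc t₀ t₁))
  have hcont := hd.continuousWithinAt
  have hev : ∀ᶠ u in 𝓝[Icc t₀ t₁] t, chartVariation q x₀ α β η r u
      = (extChartAt (𝓡 d) x₀).symm (chartCurve (𝓡 d) x₀ q u + r • η u) :=
    (eventually_mem_source hq ht0 hx).mono fun u hu => chartVariation_of_mem_source hη0 r hu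
  have hval := chartVariation_of_mem_source hη0 r hx
  have hchart : ∀ u, chartVariation q x₀ α β η r u
      = (extChartAt (𝓡 d) x₀).symm (chartCurve (𝓡 d) x₀ q u + r • η u) →
      chartCurve (𝓡 d) x₀ q u + r • η u ∈ (extChartAt (𝓡 d) x₀).target →
      chartCurve (𝓡 d) x₀ (chartVariation q x₀ α β η r) u
        = chartCurve (𝓡 d) x₀ q u + r • η u := by
    intro u hu hut
    rw [chartCurve, hu, (extChartAt (𝓡 d) x₀).right_inv hut]
  have hd' : HasDerivWithinAt (chartCurve (𝓡 d) x₀ (chartVariation q x₀ α β η r))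
      (derivWithin (chartCurve (𝓡 d) x₀ q) (Icc t₀ t₁) t + r • η' t) (Icc t₀ t₁) t := by
    refine hd.congr_of_eventuallyEq ?_ (hchart t hval hrt)
    filter_upwards [hev, hcont.eventually_mem ((isOpen_extChartAt_target x₀).mem_nhds hrt)]
      with u hu hut
    exact hchart u hu hut
  have hQc : ContinuousWithinAt (chartVariation q x₀ α β η r) (Icc t₀ t₁) t := by
    refine ContinuousWithinAt.congr_of_eventuallyEq ?_ hev hval
    exact ContinuousAt.comp_continuousWithinAt (g := (extChartAt (𝓡 d) x₀).symm)
      (continuousAt_extChartAt_symm'' hrt) hcont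
  have hQsrc : chartVariation q x₀ α β η r t ∈ (extChartAt (𝓡 d) x₀).source := by
    rw [hval]
    exact (extChartAt (𝓡 d) x₀).map_target hrt
  rw [density, lagrangianCoord_chartCurve D.lagrangian t (uniqueDiffOn_Icc h t ht0) hQc hQsrc hd',
    hchart t hval hrt]

/-- A stationary point satisfies the Euler-Lagrange equations in every chart. -/
theorem hasDerivWithinAt_momentum_of_isStationary (hαβ : α < β)
    (H : IsStationary (𝓡 d) D.lagrangian t₀ t₁ q) (w : ModelS d) :
    ∀ t ∈ Icc α β, HasDerivWithinAt (D.momentum t₀ t₁ q x₀ w) (D.force t₀ t₁ q x₀ w t)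
      (Icc α β) t := by
  refine hasDerivWithinAt_of_forall_integral_eq_zero hαβ
    (D.continuousOn_momentum h hT hJ hq hsub hsrc w) (D.continuousOn_force h hT hJ hq hsub hsrc w)
    fun ξ ξ' hξ'c hξ hξ0 => ?_
  have hη : ∀ t, HasDerivAt (fun t => ξ t • w) (ξ' t • w) t := fun t => (hξ t).smul_const w
  have hη'c : Continuous fun t => ξ' t • w := hξ'c.smul continuous_const
  have hη0 : ∀ t, t ∉ Ioo α β → ξ t • w = 0 := fun t ht => by rw [hξ0 t ht, zero_smul]
  have hηc : Continuous fun t => ξ t • w :=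
    continuous_iff_continuousAt.2 fun t => (hη t).continuousAt
  have hcc : ContinuousOn (chartCurve (𝓡 d) x₀ q) (Icc α β) := fun t ht =>
    (contDiffWithinAt_chartCurve one_le_two (hq t (hsub ht))
      (hsrc t ht)).continuousWithinAt.mono hsub
  have hct : ∀ t ∈ Icc α β, chartCurve (𝓡 d) x₀ q t ∈ (extChartAt (𝓡 d) x₀).target :=
    fun t ht => (extChartAt (𝓡 d) x₀).map_source (hsrc t ht)
  obtain ⟨ε, hε, hεt⟩ := exists_add_smul_mem_target hcc hct hηc
  have hQ := isVariation_chartVariation h hq hsrc hη'c hη hη0 hsub hε hεt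
  obtain ⟨hgc, hgd⟩ := D.hasDerivAt_action h hT hJ hQ
  have hzero := hgd.unique (H ε _ hQ)
  -- For the variation field ξw the integrand is ξF + ξ'p, the form treated by the du Bois-Reymond
  -- lemma; outside `[α, β]` nothing varies and the integrand is zero.
  have hin : ∀ t ∈ Icc α β,
      deriv (fun r => D.density t₀ t₁ (chartVariation q x₀ α β fun t => ξ t • w) r t) 0
        = ξ t * D.force t₀ t₁ q x₀ w t + ξ' t * D.momentum t₀ t₁ q x₀ w t := by
    intro t ht
    have hz := hct t ht
    have hL := (((D.contDiffOn_lagrangianCoord x₀).contDiffAt (prod_target_univ_mem_nhds hT hz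
      (hJ (hsub ht)) (derivWithin (chartCurve (𝓡 d) x₀ q) (Icc t₀ t₁) t))).differentiableAt
      one_ne_zero).hasFDerivAt
    have hline := HasFDerivAt.hasDerivAt_line (w := ((0 : ℝ), ξ t • w, ξ' t • w)) hL
    rw [D.fderiv_lagrangianCoord_apply hT (hJ (hsub ht)) hz, map_smul, map_smul] at hline
    refine (hline.congr_of_eventuallyEq ?_).deriv
    filter_upwards [Ioo_mem_nhds (neg_lt_zero.2 hε) hε] with r hr
    rw [D.density_chartVariation h hq hsub hsrc hη hη0 ht (hεt r hr t ht)]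
    simp only [Prod.smul_mk, smul_zero, Prod.mk_add_mk, add_zero]
  have hout : ∀ t ∈ Icc t₀ t₁, t ∉ Icc α β →
      deriv (fun r => D.density t₀ t₁ (chartVariation q x₀ α β fun t => ξ t • w) r t) 0 = 0 := by
    intro t _ ht
    have : (fun r => D.density t₀ t₁ (chartVariation q x₀ α β fun t => ξ t • w) r t)
        = fun _ => D.lagrangian t (q t) (velocity (𝓡 d) (Icc t₀ t₁) q t) := by
      funext r
      refine lagrangian_velocity_congr (D.lagrangian t) ?_ (chartVariation_of_notMem r ht)
      filter_upwards [mem_nhdsWithin_of_mem_nhds (isClosed_Icc.isOpen_compl.mem_nhds ht)]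
        with u hu
      exact chartVariation_of_notMem r hu
    rw [this, deriv_const]
  have hI := (Icc_subset_Icc_iff hαβ.le).1 hsub
  rw [integral_eq_of_eqOn_zero hI.1 hαβ.le hI.2 hgc hout] at hzero
  rw [← hzero]
  refine intervalIntegral.integral_congr fun t ht => ?_
  rw [uIcc_of_le hαβ.le] at ht
  exact (hin t ht).symm

omit hsub hsrc

theorem isStationary_iff :
    IsStationary (𝓡 d) D.lagrangian t₀ t₁ q ↔
      SatisfiesEulerLagrange (𝓡 d) D.lagrangian univ (Icc t₀ t₁) q := by
  refine ⟨fun H => ?_, D.isStationary_of_satisfiesEulerLagrange h hT hJ⟩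
  rw [satisfiesEulerLagrange_iff]
  intro t ht w
  obtain ⟨α, β, hαβ, htαβ, hsub, hV, hn⟩ := exists_Icc_subset_of_mem_nhdsWithin h ht
    (eventually_mem_source hq ht (mem_extChartAt_source (I := 𝓡 d) (q t)))
  exact (D.hasDerivWithinAt_momentum_of_isStationary h hT hJ hq hsub hV hαβ H w t
    htαβ).mono_of_mem_nhdsWithin hn

end Data

end

/-! ### Acceleration of light lifts and C² regularity of stationary curves. -/

section

section Calculus

theorem hasDerivWithinAt_bilinear {F : Type*} [NormedAddCommGroup F] [NormedSpace ℝ F]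
    {M : ℝ → F →L[ℝ] F →L[ℝ] ℝ} {M' : F →L[ℝ] F →L[ℝ] ℝ}
    {u v : ℝ → F} {u' v' : F} {J : Set ℝ} {s : ℝ} (hM : HasDerivWithinAt M M' J s)
    (hu : HasDerivWithinAt u u' J s) (hv : HasDerivWithinAt v v' J s) :
    HasDerivWithinAt (fun σ => M σ (u σ) (v σ))
      (M' (u s) (v s) + M s u' (v s) + M s (u s) v') J s :=
  ((hM.clm_apply hu).clm_apply hv).congr_deriv (by simp)

end Calculus

section Geodesics

variable {E : Type*} [NormedAddCommGroup E] [NormedSpace ℝ E]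
  {H : Type*} [TopologicalSpace H] {I : ModelWithCorners ℝ E H}
  {N : Type*} [TopologicalSpace N] [ChartedSpace H N]
  {g : ∀ x : N, TangentSpace I x →L[ℝ] TangentSpace I x →L[ℝ] ℝ} {x₀ : N} {z : E}

theorem fderiv_metricCoord (hg : DifferentiableAt ℝ (metricForm I g x₀) z) (u v e : E) :
    fderiv ℝ (fun z' => metricCoord I g x₀ z' u v) z e
      = fderiv ℝ (metricForm I g x₀) z e u v := by
  have h1 : HasFDerivAt (fun z' => metricForm I g x₀ z' u) _ z :=
    hg.hasFDerivAt.clm_apply (hasFDerivAt_const u z)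
  have h2 : HasFDerivAt (fun z' => metricForm I g x₀ z' u v) _ z :=
    h1.clm_apply (hasFDerivAt_const v z)
  have h3 : fderiv ℝ (fun z' => metricCoord I g x₀ z' u v) z = _ := h2.fderiv
  rw [h3]
  simp

theorem christoffelFirst_eq (hg : DifferentiableAt ℝ (metricForm I g x₀) z) (u v w : E) :
    christoffelFirst I g x₀ z u v w = 1 / 2 * (fderiv ℝ (metricForm I g x₀) z u v w
      + fderiv ℝ (metricForm I g x₀) z v u w - fderiv ℝ (metricForm I g x₀) z w u v) := by
  rw [christoffelFirst, fderiv_metricCoord hg, fderiv_metricCoord hg, fderiv_metricCoord hg]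

variable {J : Set ℝ} {c c' : ℝ → E} {c'' : E} {s : ℝ}

/-- The derivative along a curve of the component of its velocity in a fixed direction. -/
theorem hasDerivWithinAt_metricCoord_velocity
    (hg : DifferentiableAt ℝ (metricForm I g x₀) (c s))
    (hc : HasDerivWithinAt c (c' s) J s) (hc' : HasDerivWithinAt c' c'' J s) (w : E) :
    HasDerivWithinAt (fun σ => metricCoord I g x₀ (c σ) (c' σ) w)
      (metricCoord I g x₀ (c s) c'' w + christoffelFirst I g x₀ (c s) (c' s) (c' s) w
        + 1 / 2 * fderiv ℝ (fun Z => metricCoord I g x₀ Z (c' s) (c' s)) (c s) w) J s := by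
  have h1 := hasDerivWithinAt_bilinear
    (HasFDerivAt.comp_hasDerivWithinAt (l := metricForm I g x₀) s hg.hasFDerivAt hc) hc' (hasDerivWithinAt_const s J w)
  refine HasDerivWithinAt.congr_deriv h1 ?_
  -- By definition Γ(c', c', w) equals ∂_{c'} g(c', w) − ½ ∂_w g(c', c'), so half the gradient term
  -- completes the derivative of the metric coefficients.
  rw [christoffelFirst_eq hg, fderiv_metricCoord hg, ← metricForm_apply]
  simp only [map_zero, add_zero, Function.comp]
  ring

/-- The derivative along a curve of the square of its velocity. -/
theorem hasDerivWithinAt_metricCoord_self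
    (hg : DifferentiableAt ℝ (metricForm I g x₀) (c s))
    (hsymm : ∀ u v, metricCoord I g x₀ (c s) u v = metricCoord I g x₀ (c s) v u)
    (hc : HasDerivWithinAt c (c' s) J s) (hc' : HasDerivWithinAt c' c'' J s) :
    HasDerivWithinAt (fun σ => metricCoord I g x₀ (c σ) (c' σ) (c' σ))
      (2 * (metricCoord I g x₀ (c s) c'' (c' s)
        + christoffelFirst I g x₀ (c s) (c' s) (c' s) (c' s))) J s := by
  have h1 := hasDerivWithinAt_bilinear
    (HasFDerivAt.comp_hasDerivWithinAt (l := metricForm I g x₀) s hg.hasFDerivAt hc) hc' hc'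
  refine HasDerivWithinAt.congr_deriv h1 ?_
  have h2 := hsymm (c' s) c''
  rw [← metricForm_apply, ← metricForm_apply] at h2
  rw [christoffelFirst_eq hg, ← metricForm_apply]
  simp only [Function.comp, h2]
  ring

/-- The components, in the chart around `γ s`, of the covariant acceleration of a curve. -/
def acceleration (I : ModelWithCorners ℝ E H)
    (g : ∀ x : N, TangentSpace I x →L[ℝ] TangentSpace I x →L[ℝ] ℝ)
    (J : Set ℝ) (γ : ℝ → N) (s : ℝ) (w : E) : ℝ :=
  metricCoord I g (γ s) (chartCurve I (γ s) γ s)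
      (derivWithin (derivWithin (chartCurve I (γ s) γ) J) J s) w
    + christoffelFirst I g (γ s) (chartCurve I (γ s) γ s)
      (derivWithin (chartCurve I (γ s) γ) J s) (derivWithin (chartCurve I (γ s) γ) J s) w

-- Linearity in the direction allows the vanishing of the acceleration to be tested on a spanning
-- set.
set_option synthInstance.maxHeartbeats 200000 in
theorem exists_linearMap_eq_acceleration {γ : ℝ → N}
    (hg : DifferentiableAt ℝ (metricForm I g (γ s)) (chartCurve I (γ s) γ s)) :
    ∃ ℓ : E →ₗ[ℝ] ℝ, ∀ w, ℓ w = acceleration I g J γ s w := by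
  refine ⟨⟨⟨fun w => acceleration I g J γ s w, fun u w => ?_⟩, fun r w => ?_⟩, fun w => rfl⟩ <;>
  · simp only [acceleration, christoffelFirst_eq hg, ← metricForm_apply, map_add,
      map_smul, add_apply, smul_apply, smul_eq_mul, RingHom.id_apply]
    ring

end Geodesics

section Inverse

variable {E : Type*} [NormedAddCommGroup E] [NormedSpace ℝ E] [FiniteDimensional ℝ E]

theorem isInvertible_of_pos {A : E →L[ℝ] E →L[ℝ] ℝ} (hA : ∀ u, u ≠ 0 → 0 < A u u) :
    A.IsInvertible := by
  have hinj : Function.Injective A.toLinearMap := by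
    rw [← LinearMap.ker_eq_bot, LinearMap.ker_eq_bot']
    intro u hu
    by_contra hne
    have h1 := hA u hne
    have h2 : A u = 0 := hu
    rw [h2] at h1
    exact lt_irrefl _ h1
  have hfin : Module.finrank ℝ E = Module.finrank ℝ (E →L[ℝ] ℝ) := by
    rw [← (LinearMap.toContinuousLinearMap (𝕜 := ℝ) (E := E) (F' := ℝ)).finrank_eq]
    exact Subspace.dual_finrank_eq.symm
  have : FiniteDimensional ℝ (E →L[ℝ] ℝ) :=
    (LinearMap.toContinuousLinearMap (𝕜 := ℝ) (E := E) (F' := ℝ)).finiteDimensional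
  refine ⟨(LinearEquiv.ofInjectiveOfFinrankEq A.toLinearMap hinj hfin).toContinuousLinearEquiv, ?_⟩
  ext u v
  rfl

/-- A vector field along a curve is `C^n` if its dual with respect to a positive definite `C^n`
bilinear form is. -/
theorem contDiffOn_of_contDiffOn_apply {J : Set ℝ} {n : WithTop ℕ∞}
    {A : ℝ → E →L[ℝ] E →L[ℝ] ℝ} {v : ℝ → E} (hA : ContDiffOn ℝ n A J)
    (hpos : ∀ t ∈ J, ∀ u, u ≠ 0 → 0 < A t u u)
    (hAv : ∀ w, ContDiffOn ℝ n (fun t => A t (v t) w) J) : ContDiffOn ℝ n v J := by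
  have h1 : ContDiffOn ℝ n (fun t => A t (v t)) J := contDiffOn_clm_apply.2 hAv
  have h2 : ContDiffOn ℝ n (fun t => (A t).inverse) J := fun t ht => by
    have : CompleteSpace E := FiniteDimensional.complete ℝ E
    exact ContDiffAt.comp_contDiffWithinAt (g := ContinuousLinearMap.inverse) t
      (isInvertible_of_pos (hpos t ht)).contDiffAt_map_inverse (hA t ht)
  refine (h2.clm_apply h1).congr fun t ht => ?_
  exact ((isInvertible_of_pos (hpos t ht)).inverse_apply_eq.2 rfl).symm

end Inverse

variable {d : ℕ} {T : Set ℝ} {S : Type*} [TopologicalSpace S]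
  [ChartedSpace (ModelS d) S] [IsManifold (𝓡 d) 2 S]

namespace Data

variable (D : Data d T S) {t₀ t₁ : ℝ} {q : ℝ → S} (h : t₀ < t₁)
  (hT : IsOpen T) (hJ : Icc t₀ t₁ ⊆ T) (hq : ContMDiffOn 𝓘(ℝ, ℝ) (𝓡 d) 1 q (Icc t₀ t₁))

include h hT hJ hq in
/-- Stationary curves are `C²`. -/
theorem contMDiffOn_two_of_isStationary (H : IsStationary (𝓡 d) D.lagrangian t₀ t₁ q) :
    ContMDiffOn 𝓘(ℝ, ℝ) (𝓡 d) 2 q (Icc t₀ t₁) := by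
  intro t ht
  obtain ⟨α, β, hαβ, htαβ, hsub, hsrc, hn⟩ := exists_Icc_subset_of_mem_nhdsWithin h ht
    (eventually_mem_source hq ht (mem_extChartAt_source (I := 𝓡 d) (q t)))
  set x₀ := q t with hx₀
  set c := chartCurve (𝓡 d) x₀ q with hc
  set c' := derivWithin c (Icc t₀ t₁) with hc'
  have hsrc' : ∀ u ∈ Icc α β, q u ∈ (extChartAt (𝓡 d) x₀).source := hsrc
  have hcd : ∀ u ∈ Icc α β, HasDerivWithinAt c (c' u) (Icc α β) u := fun u hu =>
    (hasDerivWithinAt_chartCurve hq (hsub hu) (hsrc' u hu)).mono hsub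
  have hc1 : ContDiffOn ℝ 1 c (Icc α β) := fun u hu =>
    (contDiffWithinAt_chartCurve one_le_two (hq u (hsub hu)) (hsrc' u hu)).mono hsub
  have hm : MapsTo (fun u => (u, c u)) (Icc α β) (T ×ˢ (extChartAt (𝓡 d) x₀).target) :=
    fun u hu => ⟨hJ (hsub hu), (extChartAt (𝓡 d) x₀).map_source (hsrc' u hu)⟩
  have hp : ContDiffOn ℝ 1 (fun u => (u, c u)) (Icc α β) := contDiffOn_id.prodMk hc1
  have hA := (D.contDiffOn_cA x₀).comp hp hm
  have hB := (D.contDiffOn_cB x₀).comp hp hm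
  have hψ := (D.contDiffOn_cψ x₀).comp hp hm
  -- The momentum is differentiable with derivative the force, which is continuous: one degree more
  -- than the velocity of a C¹ curve offers by itself.
  have hP : ∀ w, ContDiffOn ℝ 1 (D.momentum t₀ t₁ q x₀ w) (Icc α β) := fun w => by
    have := contDiffOn_succ_of_hasDerivWithinAt (n := 0) hαβ
      (D.hasDerivWithinAt_momentum_of_isStationary h hT hJ hq hsub hsrc' hαβ H w)
      (contDiffOn_zero.2 (D.continuousOn_force h hT hJ hq hsub hsrc' w))
    simpa using this
  -- Inverting the Legendre map: a(c', ·) = ψ(p − b) has a C¹ right-hand side, and a is C¹ and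
  -- positive definite along the curve.
  have hv : ContDiffOn ℝ 1 c' (Icc α β) := by
    refine contDiffOn_of_contDiffOn_apply hA
      (fun u hu w hw => D.cA_pos (hm hu).1 (hm hu).2 hw) fun w => ?_
    refine (hψ.mul ((hP w).sub (hB.clm_apply (contDiffOn_const (c := w))))).congr fun u hu => ?_
    have hψ0 : D.cψ x₀ u (c u) ≠ 0 := (D.cψ_pos (hm hu).1).ne'
    simp only [Function.comp, momentum]
    rw [D.fderiv_lagrangianCoord_velocity (hm hu).1]
    change D.cA x₀ u (c u) (c' u) w = D.cψ x₀ u (c u) *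
      (1 / D.cψ x₀ u (c u) * D.cA x₀ u (c u) (c' u) w + D.cB x₀ u (c u) w - D.cB x₀ u (c u) w)
    field_simp
    ring
  have hc2 : ContDiffOn ℝ 2 c (Icc α β) := by
    have := contDiffOn_succ_of_hasDerivWithinAt (n := 1) hαβ hcd (by exact_mod_cast hv)
    rw [Nat.cast_one, one_add_one_eq_two] at this
    exact this
  exact contMDiffWithinAt_of_chartCurve le_rfl (hq t ht).continuousWithinAt
    (mem_extChartAt_source x₀) ((hc2 t htαβ).mono_of_mem_nhdsWithin hn)

variable {s₀ s₁ : ℝ} {τ τ' : ℝ → ℝ} (y₀ : ℝ) (hs : s₀ < s₁)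
  (hm : MapsTo τ (Icc s₀ s₁) (Icc t₀ t₁))
  (hτ : ∀ s ∈ Icc s₀ s₁, HasDerivWithinAt τ (τ' s) (Icc s₀ s₁) s)

theorem metricCoord_dy {p₀ : ℝ × S × ℝ} {z : ℝ × ModelS d × ℝ}
    (hz : z.2.1 ∈ (extChartAt (𝓡 d) p₀.2.1).target) (v : ℝ × ModelS d × ℝ) :
    metricCoord (modelM d) D.metric p₀ z v (0, 0, 1) = -(D.cψ p₀.2.1 z.1 z.2.1 * v.1) := by
  rw [D.metricCoord_metric p₀ hz]
  simp

/-- The coefficients of the metric depend on t and q only, so translations in y are isometries; this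
is the source of the conserved momentum. -/
theorem fderiv_metricCoord_dy {p₀ : ℝ × S × ℝ} {z : ℝ × ModelS d × ℝ} (hT : IsOpen T)
    (hz1 : z.1 ∈ T) (hz : z.2.1 ∈ (extChartAt (𝓡 d) p₀.2.1).target) (v : ℝ × ModelS d × ℝ) :
    fderiv ℝ (fun Z => metricCoord (modelM d) D.metric p₀ Z v v) z (0, 0, 1) = 0 := by
  have h1 : DifferentiableAt ℝ (fun Z => metricCoord (modelM d) D.metric p₀ Z v v) z :=
    (((((D.contDiffOn_metricForm p₀).contDiffAt
      (prod_target_univ_mem_nhds (t := z.1) hT hz hz1 z.2.2)).differentiableAt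
      one_ne_zero).clm_apply (differentiableAt_const v)).clm_apply (differentiableAt_const v) :)
  have h2 := HasFDerivAt.hasDerivAt_line (w := ((0 : ℝ), (0 : ModelS d), (1 : ℝ))) h1.hasFDerivAt
  refine (h2.congr_of_eventuallyEq (f₁ := fun _ => metricCoord (modelM d) D.metric p₀ z v v)
    (Filter.Eventually.of_forall fun r => ?_)).unique (hasDerivAt_const _ _)
  have e1 : (z + r • ((0 : ℝ), (0 : ModelS d), (1 : ℝ))).1 = z.1 := by simp
  have e2 : (z + r • ((0 : ℝ), (0 : ModelS d), (1 : ℝ))).2.1 = z.2.1 := by simp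
  beta_reduce
  rw [D.metricCoord_metric p₀ hz, D.metricCoord_metric p₀ (by rw [e2]; exact hz), e1, e2]

include h hT hJ hq hs hm hτ

omit h hq hτ in
/-- The covariant acceleration of a reparametrized light lift, in terms of the derivative of its
momenta. -/
theorem hasDerivWithinAt_metricCoord_lightLift
    (hγ : ContMDiffOn 𝓘(ℝ, ℝ) (modelM d) 2 (D.lightLift t₀ t₁ q y₀ ∘ τ) (Icc s₀ s₁))
    {s : ℝ} (hsJ : s ∈ Icc s₀ s₁) :
    let p₀ := D.lightLift t₀ t₁ q y₀ (τ s)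
    let c := chartCurve (modelM d) p₀ (D.lightLift t₀ t₁ q y₀ ∘ τ)
    let c' := derivWithin c (Icc s₀ s₁)
    let c'' := derivWithin c' (Icc s₀ s₁)
    DifferentiableAt ℝ (metricForm (modelM d) D.metric p₀) (c s) ∧
    (∀ w, HasDerivWithinAt (fun σ => metricCoord (modelM d) D.metric p₀ (c σ) (c' σ) w)
      (metricCoord (modelM d) D.metric p₀ (c s) (c'' s) w
        + christoffelFirst (modelM d) D.metric p₀ (c s) (c' s) (c' s) w
        + 1 / 2 * fderiv ℝ (fun Z => metricCoord (modelM d) D.metric p₀ Z (c' s) (c' s)) (c s) w)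
      (Icc s₀ s₁) s) ∧
    HasDerivWithinAt (fun σ => metricCoord (modelM d) D.metric p₀ (c σ) (c' σ) (c' σ))
      (2 * (metricCoord (modelM d) D.metric p₀ (c s) (c'' s) (c' s)
        + christoffelFirst (modelM d) D.metric p₀ (c s) (c' s) (c' s) (c' s))) (Icc s₀ s₁) s := by
  intro p₀ c c' c''
  have hx : q (τ s) ∈ (extChartAt (𝓡 d) p₀.2.1).source := mem_extChartAt_source (q (τ s))
  have hz : chartCurve (𝓡 d) p₀.2.1 q (τ s) ∈ (extChartAt (𝓡 d) p₀.2.1).target :=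
    (extChartAt (𝓡 d) p₀.2.1).map_source hx
  have hcs : c s = (τ s, chartCurve (𝓡 d) p₀.2.1 q (τ s), D.liftY t₀ t₁ q y₀ (τ s)) :=
    chartCurve_spacetime p₀ _ s
  have hg : DifferentiableAt ℝ (metricForm (modelM d) D.metric p₀) (c s) := by
    rw [hcs]
    exact ((D.contDiffOn_metricForm p₀).contDiffAt
      (prod_target_univ_mem_nhds hT hz (hJ (hm hsJ)) _)).differentiableAt one_ne_zero
  have hJu := uniqueDiffOn_Icc hs
  have hc2 : ContDiffWithinAt ℝ 2 c (Icc s₀ s₁) s :=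
    contDiffWithinAt_chartCurve le_rfl (hγ s hsJ) (mem_extChartAt_source p₀)
  have hd : HasDerivWithinAt c (c' s) (Icc s₀ s₁) s :=
    (hc2.differentiableWithinAt two_ne_zero).hasDerivWithinAt
  have hd' : HasDerivWithinAt c' (c'' s) (Icc s₀ s₁) s :=
    ((ContDiffWithinAt.derivWithin_right' (m := 1) hc2 hJu (by norm_num) hsJ
      ).differentiableWithinAt one_ne_zero).hasDerivWithinAt
  refine ⟨hg, hasDerivWithinAt_metricCoord_velocity hg hd hd',
    hasDerivWithinAt_metricCoord_self hg (fun u v => ?_) hd hd'⟩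
  rw [hcs]
  exact D.metricCoord_symm (hJ (hm hsJ)) hz u v

/-- The derivative of the momentum conjugate to `y`. -/
theorem metricCoord_lightLift_dy {s σ : ℝ} (hσ : σ ∈ Icc s₀ s₁)
    (hx : q (τ σ) ∈ (extChartAt (𝓡 d) (q (τ s))).source) :
    metricCoord (modelM d) D.metric (D.lightLift t₀ t₁ q y₀ (τ s))
      (chartCurve (modelM d) (D.lightLift t₀ t₁ q y₀ (τ s)) (D.lightLift t₀ t₁ q y₀ ∘ τ) σ)
      (derivWithin (chartCurve (modelM d) (D.lightLift t₀ t₁ q y₀ (τ s))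
        (D.lightLift t₀ t₁ q y₀ ∘ τ)) (Icc s₀ s₁) σ) (0, 0, 1)
      = -(D.ψ (τ σ) (q (τ σ)) * τ' σ) := by
  rw [D.derivWithin_chartCurve_lightLift h hT hJ hq _ y₀ (uniqueDiffOn_Icc hs) hm hτ hσ hx,
    chartCurve_spacetime, ← D.cψ_chartCurve hx]
  exact D.metricCoord_dy (p₀ := D.lightLift t₀ t₁ q y₀ (τ s))
    (z := (τ σ, chartCurve (𝓡 d) (q (τ s)) q (τ σ), D.liftY t₀ t₁ q y₀ (τ σ)))
    ((extChartAt (𝓡 d) (q (τ s))).map_source hx) _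

omit h hT hJ hs [IsManifold (𝓡 d) 2 S] in
theorem eventually_mem_source_comp {s : ℝ} (hsJ : s ∈ Icc s₀ s₁) :
    ∀ᶠ σ in 𝓝[Icc s₀ s₁] s, σ ∈ Icc s₀ s₁ ∧ q (τ σ) ∈ (extChartAt (𝓡 d) (q (τ s))).source := by
  have hev : ∀ᶠ σ in 𝓝[Icc s₀ s₁] s, q (τ σ) ∈ (extChartAt (𝓡 d) (q (τ s))).source :=
    ((hτ s hsJ).continuousWithinAt.tendsto_nhdsWithin hm).eventually
      (eventually_mem_source hq (hm hsJ) (mem_extChartAt_source _))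
  exact eventually_mem_nhdsWithin.and hev

variable (hγ : ContMDiffOn 𝓘(ℝ, ℝ) (modelM d) 2 (D.lightLift t₀ t₁ q y₀ ∘ τ) (Icc s₀ s₁))
include hγ

/-- The acceleration of a light lift in the direction of `y` is the derivative of the momentum
conjugate to `y`. -/
theorem hasDerivWithinAt_momentum_dy {s : ℝ} (hsJ : s ∈ Icc s₀ s₁) :
    HasDerivWithinAt (fun σ => -(D.ψ (τ σ) (q (τ σ)) * τ' σ))
      (acceleration (modelM d) D.metric (Icc s₀ s₁) (D.lightLift t₀ t₁ q y₀ ∘ τ) s (0, 0, 1))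
      (Icc s₀ s₁) s := by
  have hx : q (τ s) ∈ (extChartAt (𝓡 d) (q (τ s))).source := mem_extChartAt_source _
  obtain ⟨-, h1, -⟩ := D.hasDerivWithinAt_metricCoord_lightLift hT hJ y₀ hs hm hγ hsJ
  have h2 := h1 (0, 0, 1)
  have h4 : fderiv ℝ (fun Z => metricCoord (modelM d) D.metric (D.lightLift t₀ t₁ q y₀ (τ s)) Z
      (derivWithin (chartCurve (modelM d) (D.lightLift t₀ t₁ q y₀ (τ s))
        (D.lightLift t₀ t₁ q y₀ ∘ τ)) (Icc s₀ s₁) s)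
      (derivWithin (chartCurve (modelM d) (D.lightLift t₀ t₁ q y₀ (τ s))
        (D.lightLift t₀ t₁ q y₀ ∘ τ)) (Icc s₀ s₁) s))
      (chartCurve (modelM d) (D.lightLift t₀ t₁ q y₀ (τ s)) (D.lightLift t₀ t₁ q y₀ ∘ τ) s)
      (0, 0, 1) = 0 := by
    refine D.fderiv_metricCoord_dy hT ?_ ?_ _ <;> rw [chartCurve_spacetime]
    · exact hJ (hm hsJ)
    · exact (extChartAt (𝓡 d) (q (τ s))).map_source hx
  rw [h4, mul_zero, add_zero] at h2
  refine h2.congr_of_eventuallyEq ?_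
    (D.metricCoord_lightLift_dy h hT hJ hq y₀ hs hm hτ hsJ hx).symm
  filter_upwards [eventually_mem_source_comp hq hm hτ hsJ] with σ hσ
  exact (D.metricCoord_lightLift_dy h hT hJ hq y₀ hs hm hτ hσ.1 hσ.2).symm

/-- The acceleration of a light lift is orthogonal to its velocity. -/
theorem acceleration_velocity {s : ℝ} (hsJ : s ∈ Icc s₀ s₁) :
    acceleration (modelM d) D.metric (Icc s₀ s₁) (D.lightLift t₀ t₁ q y₀ ∘ τ) s
      (derivWithin (chartCurve (modelM d) (D.lightLift t₀ t₁ q y₀ (τ s))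
        (D.lightLift t₀ t₁ q y₀ ∘ τ)) (Icc s₀ s₁) s) = 0 := by
  obtain ⟨-, -, h1⟩ := D.hasDerivWithinAt_metricCoord_lightLift hT hJ y₀ hs hm hγ hsJ
  have key : ∀ σ ∈ Icc s₀ s₁, q (τ σ) ∈ (extChartAt (𝓡 d) (q (τ s))).source →
      metricCoord (modelM d) D.metric (D.lightLift t₀ t₁ q y₀ (τ s))
        (chartCurve (modelM d) (D.lightLift t₀ t₁ q y₀ (τ s)) (D.lightLift t₀ t₁ q y₀ ∘ τ) σ)
        (derivWithin (chartCurve (modelM d) (D.lightLift t₀ t₁ q y₀ (τ s))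
          (D.lightLift t₀ t₁ q y₀ ∘ τ)) (Icc s₀ s₁) σ)
        (derivWithin (chartCurve (modelM d) (D.lightLift t₀ t₁ q y₀ (τ s))
          (D.lightLift t₀ t₁ q y₀ ∘ τ)) (Icc s₀ s₁) σ) = 0 := by
    intro σ hσ hx
    rw [D.derivWithin_chartCurve_lightLift h hT hJ hq _ y₀ (uniqueDiffOn_Icc hs) hm hτ hσ hx,
      chartCurve_spacetime]
    exact D.metricCoord_lift_eq_zero (D.lightLift t₀ t₁ q y₀ (τ s))
      (z := (τ σ, chartCurve (𝓡 d) (q (τ s)) q (τ σ), D.liftY t₀ t₁ q y₀ (τ σ)))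
      (hJ (hm hσ)) ((extChartAt (𝓡 d) (q (τ s))).map_source hx) _ _
  -- The square of the velocity vanishes along the whole lift, and its derivative is twice the
  -- acceleration paired with the velocity.
  have h2 := (hasDerivWithinAt_const s (Icc s₀ s₁) (0 : ℝ)).congr_of_eventuallyEq
    ((eventually_mem_source_comp hq hm hτ hsJ).mono fun σ hσ => key σ hσ.1 hσ.2)
    (key s hsJ (mem_extChartAt_source _))
  have h3 := (uniqueDiffOn_Icc hs s hsJ).eq_deriv _ h1 h2
  exact (mul_eq_zero.1 h3).resolve_left two_ne_zero

/-- The spatial components of the acceleration of a light lift vanish if and only if the momentum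
of the classical Lagrangian varies according to the Euler-Lagrange equations. -/
theorem acceleration_spatial_eq_zero_iff {μ : ℝ} (hμ : μ ≠ 0)
    (hμτ : ∀ s ∈ Icc s₀ s₁, D.ψ (τ s) (q (τ s)) * τ' s = μ) {s : ℝ} (hsJ : s ∈ Icc s₀ s₁)
    (w : ModelS d) :
    acceleration (modelM d) D.metric (Icc s₀ s₁) (D.lightLift t₀ t₁ q y₀ ∘ τ) s (0, w, 0) = 0 ↔
    HasDerivWithinAt (D.momentum t₀ t₁ q (q (τ s)) w ∘ τ)
      (τ' s * D.force t₀ t₁ q (q (τ s)) w (τ s)) (Icc s₀ s₁) s := by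
  have hJu := uniqueDiffOn_Icc hs
  obtain ⟨-, h1, -⟩ := D.hasDerivWithinAt_metricCoord_lightLift hT hJ y₀ hs hm hγ hsJ
  have h2 := h1 (0, w, 0)
  rw [D.fderiv_metricCoord_lightLift_spatial h hT hJ hq
    (D.lightLift t₀ t₁ q y₀ (τ s)) y₀ hJu hm hτ hsJ (mem_extChartAt_source _) w] at h2
  rw [← D.spatial_eulerLagrange_iff h hT hJ hq y₀ hJu hm hτ hμ hμτ hsJ w one_ne_zero rfl]
  simp only [one_mul]
  have e : 1 / 2 * (2 * D.ψ (τ s) (q (τ s)) * τ' s ^ 2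
      * D.force t₀ t₁ q (D.lightLift t₀ t₁ q y₀ (τ s)).2.1 w (τ s))
      = μ * (τ' s * D.force t₀ t₁ q (q (τ s)) w (τ s)) := by
    rw [← hμτ s hsJ]
    simp only [lightLift]
    ring
  rw [e] at h2
  constructor
  · intro h0
    exact h2.congr_deriv (add_eq_right.2 h0)
  · intro h3
    exact add_eq_right.1 ((hJu s hsJ).eq_deriv _ h2 h3)

/-- Along an affinely parametrized geodesic, `ψ dt/ds` is constant. -/
theorem conserved_of_acceleration_dy_eq_zero
    (H : ∀ s ∈ Icc s₀ s₁, acceleration (modelM d) D.metric (Icc s₀ s₁)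
      (D.lightLift t₀ t₁ q y₀ ∘ τ) s (0, 0, 1) = 0) :
    ∀ s ∈ Icc s₀ s₁, D.ψ (τ s) (q (τ s)) * τ' s = D.ψ (τ s₀) (q (τ s₀)) * τ' s₀ := by
  have hd := fun s hsJ =>
    (D.hasDerivWithinAt_momentum_dy h hT hJ hq y₀ hs hm hτ hγ hsJ).congr_deriv (H s hsJ)
  intro s hsJ
  have := constant_of_has_deriv_right_zero (f := fun σ => -(D.ψ (τ σ) (q (τ σ)) * τ' σ))
    (a := s₀) (b := s₁) (fun s hs => (hd s hs).continuousWithinAt)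
    (fun s hs => (hd s (Ico_subset_Icc_self hs)).mono_of_mem_nhdsWithin
      (Icc_mem_nhdsGE_of_mem hs)) s hsJ
  exact neg_inj.1 this

/-- If the momentum conjugate to `y` is constant and the spatial components of the acceleration of
a light lift vanish, then it is an affinely parametrized geodesic. -/
theorem acceleration_eq_zero {μ : ℝ} (hμ : μ ≠ 0)
    (hμτ : ∀ s ∈ Icc s₀ s₁, D.ψ (τ s) (q (τ s)) * τ' s = μ) {s : ℝ} (hsJ : s ∈ Icc s₀ s₁)
    (H : ∀ w, HasDerivWithinAt (D.momentum t₀ t₁ q (q (τ s)) w ∘ τ)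
      (τ' s * D.force t₀ t₁ q (q (τ s)) w (τ s)) (Icc s₀ s₁) s) (w : ℝ × ModelS d × ℝ) :
    acceleration (modelM d) D.metric (Icc s₀ s₁) (D.lightLift t₀ t₁ q y₀ ∘ τ) s w = 0 := by
  have hJu := uniqueDiffOn_Icc hs
  obtain ⟨hg, -, -⟩ := D.hasDerivWithinAt_metricCoord_lightLift hT hJ y₀ hs hm hγ hsJ
  obtain ⟨ℓ, hℓ⟩ := exists_linearMap_eq_acceleration (J := Icc s₀ s₁)
    (γ := D.lightLift t₀ t₁ q y₀ ∘ τ) hg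
  have hτ0 : τ' s ≠ 0 := fun h0 => hμ (by rw [← hμτ s hsJ, h0, mul_zero])
  have hy : ℓ (0, 0, 1) = 0 := by
    rw [hℓ]
    exact (hJu s hsJ).eq_deriv _ (D.hasDerivWithinAt_momentum_dy h hT hJ hq y₀ hs hm hτ hγ hsJ)
      ((hasDerivWithinAt_const s (Icc s₀ s₁) (-μ)).congr
        (fun σ hσ => congrArg Neg.neg (hμτ σ hσ)) (congrArg Neg.neg (hμτ s hsJ)))
  have hS : ∀ v : ModelS d, ℓ (0, v, 0) = 0 := fun v => by
    rw [hℓ]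
    exact (D.acceleration_spatial_eq_zero_iff h hT hJ hq y₀ hs hm hτ hγ hμ hμτ hsJ v).2 (H v)
  have hv := D.acceleration_velocity h hT hJ hq y₀ hs hm hτ hγ hsJ
  rw [← hℓ, D.derivWithin_chartCurve_lightLift h hT hJ hq (D.lightLift t₀ t₁ q y₀ (τ s)) y₀ hJu hm
    hτ hsJ (mem_extChartAt_source _)] at hv
  rw [← hℓ]
  generalize derivWithin (chartCurve (𝓡 d) (D.lightLift t₀ t₁ q y₀ (τ s)).2.1 q)
    (Icc t₀ t₁) (τ s) = v at hv
  generalize τ' s * lagrangianCoord (𝓡 d) D.lagrangian _ (τ s) _ v = e at hv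
  -- The velocity has t-component τ' ≠ 0. A multiple of it accounts for the t-component of `w`, and
  -- the rest is spanned by spatial directions and ∂_y.
  have hw : w = (w.1 / τ' s) • (τ' s, τ' s • v, e) + (0, w.2.1 - w.1 • v, 0)
      + (w.2.2 - w.1 / τ' s * e) • (0, 0, 1) := by
    refine Prod.ext ?_ (Prod.ext ?_ ?_)
    · simp [hτ0]
    · simp [smul_smul, hτ0]
    · simp
  rw [hw, map_add, map_add, map_smul, map_smul, hv, hS, hy, smul_zero, smul_zero, add_zero,
    add_zero]

end Data

end

/-! ### Stationary curves and lightlike geodesics. -/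

section

variable {d : ℕ} {T : Set ℝ} {S : Type*} [TopologicalSpace S]
  [ChartedSpace (ModelS d) S] [IsManifold (𝓡 d) 2 S]

namespace Data

variable (D : Data d T S) {t₀ t₁ : ℝ} {q : ℝ → S} (h : t₀ < t₁)
  (hT : IsOpen T) (hJ : Icc t₀ t₁ ⊆ T) (hq : ContMDiffOn 𝓘(ℝ, ℝ) (𝓡 d) 1 q (Icc t₀ t₁))
  (y₀ : ℝ)
include h hT hJ hq

theorem isStationary_of_isUnparametrizedLightlikeGeodesic
    (H : IsUnparametrizedLightlikeGeodesic (modelM d) D.metric t₀ t₁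
      (D.lightLift t₀ t₁ q y₀)) : IsStationary (𝓡 d) D.lagrangian t₀ t₁ q := by
  rw [D.isStationary_iff h hT hJ hq]
  obtain ⟨s₀, s₁, τ, hs, h₀, h₁, hτ1, hpos, ⟨hγ, hacc⟩, -⟩ := H
  set τ' := derivWithin τ (Icc s₀ s₁) with hτ'
  have hτ : ∀ s ∈ Icc s₀ s₁, HasDerivWithinAt τ (τ' s) (Icc s₀ s₁) s := fun s hsJ =>
    (hτ1.differentiableOn one_ne_zero s hsJ).hasDerivWithinAt
  have hm : MapsTo τ (Icc s₀ s₁) (Icc t₀ t₁) :=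
    mapsTo_Icc_of_hasDerivWithinAt_pos hτ h₀ h₁ fun s hsJ _ => hpos s hsJ
  have hs₀ := left_mem_Icc.2 hs.le
  set ν := D.ψ (τ s₀) (q (τ s₀)) * τ' s₀ with hν
  have hν0 : 0 < ν := mul_pos (D.ψ_curve_pos hJ (hm hs₀)) (hpos s₀ hs₀)
  have hψτ : ∀ s ∈ Icc s₀ s₁, D.ψ (τ s) (q (τ s)) * τ' s = ν :=
    D.conserved_of_acceleration_dy_eq_zero h hT hJ hq y₀ hs hm hτ hγ
      fun s hsJ => hacc s hsJ (0, 0, 1)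
  -- The conserved quantity ν is ψ dt/ds, whereas the normalization in use is 2ψ dt/ds = μ; hence μ
  -- = 2ν.
  have hτ'eq : ∀ s ∈ Icc s₀ s₁, τ' s = 2 * ν / (2 * D.ψ (τ s) (q (τ s))) := fun s hsJ => by
    have := (D.ψ_curve_pos (q := q) hJ (hm hsJ)).ne'
    rw [← hψτ s hsJ]
    field_simp
  refine D.satisfiesEulerLagrange_of_comp hJ hq hs (mul_pos two_pos hν0) hm h₀ h₁
    (fun s hsJ => (hτ s hsJ).congr_deriv (hτ'eq s hsJ)) fun s hsJ w => ?_
  rw [← hτ'eq s hsJ]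
  exact (D.acceleration_spatial_eq_zero_iff h hT hJ hq y₀ hs hm hτ hγ hν0.ne' hψτ hsJ w).1
    (hacc s hsJ (0, w, 0))

/-- The affine parameter is the one with ψ dt/ds = 1, which makes the momentum conjugate to y
constant. -/
theorem isUnparametrizedLightlikeGeodesic_of_isStationary
    (H : IsStationary (𝓡 d) D.lagrangian t₀ t₁ q) :
    IsUnparametrizedLightlikeGeodesic (modelM d) D.metric t₀ t₁ (D.lightLift t₀ t₁ q y₀) := by
  have hq2 := D.contMDiffOn_two_of_isStationary h hT hJ hq H
  rw [D.isStationary_iff h hT hJ hq, satisfiesEulerLagrange_iff] at H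
  obtain ⟨s₁, τ, hs, h₀, h₁, hm, hτ⟩ := exists_reparametrization (k := fun t => D.ψ t (q t)) h
    (D.continuousOn_ψ hJ hq) fun t ht => D.ψ_curve_pos hJ ht
  have hψ0 : ∀ s ∈ Icc 0 s₁, 0 < D.ψ (τ s) (q (τ s)) := fun s hsJ => D.ψ_curve_pos hJ (hm hsJ)
  have hψ1 : ContDiffOn ℝ 1 (fun t => D.ψ t (q t)) (Icc t₀ t₁) :=
    (D.ψ_contMDiffOn.comp (contMDiffOn_id.prodMk hq)
      fun t ht => ⟨hJ ht, mem_univ _⟩).contDiffOn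
  -- A bootstrap on τ' = 1/ψ(τ, q(τ)): the right-hand side is continuous, so τ is C¹; then it is C¹,
  -- so τ is C².
  have hτ1 : ContDiffOn ℝ 1 τ (Icc 0 s₁) := by
    have hτc : ContinuousOn τ (Icc 0 s₁) := fun s hsJ => (hτ s hsJ).continuousWithinAt
    have hc : ContDiffOn ℝ ((0 : ℕ) : WithTop ℕ∞) (fun s => 1 / D.ψ (τ s) (q (τ s)))
        (Icc 0 s₁) :=
      contDiffOn_zero.2 (continuousOn_const.div
        ((D.continuousOn_ψ hJ hq).comp hτc hm) fun s hsJ => (hψ0 s hsJ).ne')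
    simpa using contDiffOn_succ_of_hasDerivWithinAt (n := 0) hs hτ hc
  have hτ2 : ContDiffOn ℝ 2 τ (Icc 0 s₁) := by
    have hc : ContDiffOn ℝ ((1 : ℕ) : WithTop ℕ∞) (fun s => 1 / D.ψ (τ s) (q (τ s)))
        (Icc 0 s₁) := by
      rw [Nat.cast_one]
      exact contDiffOn_const.div (hψ1.comp hτ1 hm) fun s hsJ => (hψ0 s hsJ).ne'
    have := contDiffOn_succ_of_hasDerivWithinAt (n := 1) hs hτ hc
    rwa [Nat.cast_one, one_add_one_eq_two] at this
  have hlift : ContMDiffOn 𝓘(ℝ, ℝ) (modelM d) 2 (D.lightLift t₀ t₁ q y₀) (Icc t₀ t₁) := by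
    have := D.contMDiffOn_lightLift h hT hJ hq y₀ (n := 1) le_rfl
      (by rwa [Nat.cast_one, one_add_one_eq_two])
    rwa [Nat.cast_one, one_add_one_eq_two] at this
  have hγ : ContMDiffOn 𝓘(ℝ, ℝ) (modelM d) 2 (D.lightLift t₀ t₁ q y₀ ∘ τ) (Icc 0 s₁) :=
    hlift.comp hτ2.contMDiffOn fun _ hsJ => hm hsJ
  have hpos : ∀ s ∈ Icc 0 s₁, 0 < derivWithin τ (Icc 0 s₁) s := fun s hsJ => by
    rw [(hτ s hsJ).derivWithin (uniqueDiffOn_Icc hs s hsJ)]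
    exact one_div_pos.2 (hψ0 s hsJ)
  refine ⟨0, s₁, τ, hs, h₀, h₁, hτ1, hpos, ⟨hγ, fun s hsJ w => ?_⟩,
    D.isLightlikeOn_lightLift_comp h hT hJ hq y₀ hs hm hτ1 hpos⟩
  exact D.acceleration_eq_zero h hT hJ hq y₀ hs hm hτ hγ one_ne_zero
    (fun s hsJ => mul_one_div_cancel (hψ0 s hsJ).ne') hsJ
    (fun w => (H (τ s) (hm hsJ) w).scomp s (hτ s hsJ) hm) w

end Data

end

end Eisenhart

end

theorem mainTheorem5 {d : ℕ} {S : Type*} [TopologicalSpace S]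
    [ChartedSpace (EuclideanSpace ℝ (Fin d)) S] [IsManifold (𝓡 d) 2 S]
    {T : Set ℝ} (hT : IsOpen T) (hT' : IsConnected T) (D : Eisenhart.Data d T S)
    {t₀ t₁ : ℝ} (ht₀ : t₀ ∈ T) (ht₁ : t₁ ∈ T) (h : t₀ < t₁)
    (q : ℝ → S) (hq : ContMDiffOn 𝓘(ℝ, ℝ) (𝓡 d) 1 q (Icc t₀ t₁)) (y₀ : ℝ) :
    Eisenhart.IsLightlikeOn (Eisenhart.modelM d) D.metric (Icc t₀ t₁)
      (D.lightLift t₀ t₁ q y₀) ∧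
    D.liftY t₀ t₁ q y₀ t₁ - D.liftY t₀ t₁ q y₀ t₀
      = Eisenhart.action (𝓡 d) D.lagrangian t₀ t₁ q ∧
    (Eisenhart.IsStationary (𝓡 d) D.lagrangian t₀ t₁ q ↔
      Eisenhart.IsUnparametrizedLightlikeGeodesic (Eisenhart.modelM d) D.metric t₀ t₁
        (D.lightLift t₀ t₁ q y₀)) ∧
    (D.SatisfiesZeroEulerLagrange t₀ t₁ q ↔
      Eisenhart.SatisfiesEulerLagrange (𝓡 d) D.lagrangian univ (Icc t₀ t₁) q) := by
  -- A connected subset of the line contains the interval between any two of its points, so all the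
  -- data are regular along the curve.
  have hJ : Icc t₀ t₁ ⊆ T := hT'.isPreconnected.ordConnected.out ht₀ ht₁
  refine ⟨D.isLightlikeOn_lightLift h hT hJ hq y₀, ?_,
    ⟨D.isUnparametrizedLightlikeGeodesic_of_isStationary h hT hJ hq y₀,
      D.isStationary_of_isUnparametrizedLightlikeGeodesic h hT hJ hq y₀⟩,
    D.satisfiesZeroEulerLagrange_iff h hT hJ hq⟩
  simp [Eisenhart.Data.liftY, Eisenhart.action]
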